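/- Let $0<\alpha<1$ and $\theta>0$. Let $S_\alpha\ge 0$ have Laplace transform $\mathbb E[e^{-\lambda S_\alpha}]=e^{-\lambda^\alpha}$, let $T_{\alpha,\alpha\theta}$ be independent of $S_\alpha$ with law proportional to $t^{-\alpha\theta}\,\mathbb P(S_\alpha\in dt)$, and let $\varrho_\alpha$ be the probability law on $(0,\infty)$ with density $$\varrho_\alpha(y)=\frac{\sin(\pi\alpha)}{\pi}\,\frac{y^{\alpha-1}}{y^{2\alpha}+2y^\alpha\cos(\pi\alpha)+1}.$$ Let $(\ell_t)_{t\ge0}=(\ell^{(\alpha,\alpha\theta)}_t)_{t\ge 0}$ be a nonnegative process with right-continuous paths, independent of $S_\alpha$, with $\ell_t\overset{d}{=}t^\alpha\ell_1$ for every $t\ge0$ and $(\ell_1)^{1/\alpha}\overset{d}{=}1/T_{\alpha,\alpha\theta}$. Let $M=M_{\alpha\theta}(\varrho_\alpha)=\int_0^\infty x\,D(dx)$, where $D$ is a Dirichlet process with parameter measure $\alpha\theta\,\varrho_\alpha$. For a probability law $H$ on $(0,\infty)$, with $H(t)=H((0,t])$, and $c>0$, put $$\Delta_c(t|H)=\frac1\pi\sin(\pi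 cH(t))\,e^{-c\Phi(t)},\qquad \Phi(t)=\int_{\{x\ne t\}}\log|t-x|\,H(dx).$$ Then the integral defining $M$ is almost surely finite, and $$M_{\alpha\theta}(\varrho_\alpha)\overset{d}{=}\big[\ell^{(\alpha,\alpha\theta)}_{S_\alpha}\big]^{1/\alpha}\overset{d}{=}S_\alpha/T_{\alpha,\alpha\theta}.$$ For every $x\ge0$, $$\mathbb P(M\le x)=\int_0^x(x-t)^{\alpha\theta-1}\Delta_{\alpha\theta}(t|\varrho_\alpha)\,dt,$$ and, explicitly, $$\Delta_{\alpha\theta}(x|\varrho_\alpha)=\frac1\pi\,\frac{\sin(\pi\theta\alpha F(x))}{[x^{2\alpha}+2x^\alpha\cos(\alpha\pi)+1]^{\theta/2}},$$ where $F(x)=\varrho_\alpha((0,x])=1-\frac1{\pi\alpha}\cot^{-1}\!\Big(\cot(\pi\alpha)+\frac{x^\alpha}{\sin(\pi\alpha)}\Big)$, with $\cot^{-1}$ taking values in $(0,\pi)$. Moreover $M$ has on $(0,\infty)$ the nonnegative density $$f(x)=\int_0^x(x-t)^{\alpha\theta-1}d_{\alpha\theta}(t|\varrho_\alpha)\,dt,\qquad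 x>0,$$ where, for $x>0$, $$d_{\alpha\theta}(x|\varrho_\alpha)=\frac{d}{dx}\Delta_{\alpha\theta}(x|\varrho_\alpha)=\frac{\alpha\theta x^{\alpha-1}}{\pi}\,\frac{\sin(\pi\alpha[1-\theta F(x)])-x^\alpha\sin(\pi\theta\alpha F(x))}{[x^{2\alpha}+2x^\alpha\cos(\alpha\pi)+1]^{\theta/2+1}}.$$ All the integrals above converge absolutely. -/

import Mathlib

open MeasureTheory ProbabilityTheory Set Filter Topology
open scoped NNReal ENNReal Real

noncomputable section

/-- The Gamma law with shape `a` and scale `1`; shape `0` is the point mass at `0`. -/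
def gammaLaw (a : ℝ) : Measure ℝ :=
  if 0 < a then gammaMeasure a 1 else Measure.dirac 0

/-- The Dirichlet distribution with parameters `a 0, …, a (n-1)` (zero parameters allowed): the law
of `(G₀/G, …, Gₙ₋₁/G)` for independent `Gᵢ` with law Gamma(`a i`) and `G = G₀ + ⋯ + Gₙ₋₁`. -/
def dirichletLaw {n : ℕ} (a : Fin n → ℝ) : Measure (Fin n → ℝ) :=
  (Measure.pi fun i => gammaLaw (a i)).map fun g i => g i / ∑ j, g j

/-- `D` is a Dirichlet process on `E` with parameter measure `c • H`: a random probability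
measure such that `(D(A₀), …, D(Aₙ₋₁))` has the Dirichlet distribution with parameters
`c * H(Aᵢ)`, for every finite measurable partition `A₀, …, Aₙ₋₁` of `E`. -/
structure IsDirichletProcess {Ω E : Type*} [MeasurableSpace Ω] [MeasurableSpace E]
    (c : ℝ) (H : Measure E) (D : Ω → Measure E) (P : Measure Ω) : Prop where
  measurable : Measurable D
  isProbabilityMeasure : ∀ ω, IsProbabilityMeasure (D ω)
  law_partition : ∀ (n : ℕ) (A : Fin n → Set E), (∀ i, MeasurableSet (A i)) →
    Pairwise (fun i j => Disjoint (A i) (A j)) → (⋃ i, A i) = univ →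
    P.map (fun ω i => (D ω).real (A i)) = dirichletLaw fun i => c * H.real (A i)

/-- The mean functional `∫ x D(dx)` of a random measure `D` on `ℝ`. -/
def meanFunctional {Ω : Type*} (D : Ω → Measure ℝ) (ω : Ω) : ℝ :=
  ∫ x, x ∂(D ω)

/-- `μ` is the law of the unilateral `α`-stable variable `S_α`: it is carried by `[0, ∞)` and has
Laplace transform `E[exp (-l S_α)] = exp (-l ^ α)`. -/
structure IsPositiveStable (α : ℝ) (μ : Measure ℝ) : Prop where
  isProbabilityMeasure : IsProbabilityMeasure μ
  nonneg : μ (Iio 0) = 0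
  laplace : ∀ l : ℝ, 0 ≤ l → ∫ s, Real.exp (-(l * s)) ∂μ = Real.exp (-(l ^ α))

/-- The probability measure proportional to `t ^ (-a) μ(dt)`. -/
def powerTilt (a : ℝ) (μ : Measure ℝ) : Measure ℝ :=
  (∫⁻ t, ENNReal.ofReal (t ^ (-a)) ∂μ)⁻¹ • μ.withDensity fun t => ENNReal.ofReal (t ^ (-a))

/-- `τ` is the law of `T_{α,a}`, i.e. `τ(dt)` is proportional to `t ^ (-a) P(S_α ∈ dt)`. -/
def IsTiltedStable (α a : ℝ) (τ : Measure ℝ) : Prop :=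
  ∃ μ : Measure ℝ, IsPositiveStable α μ ∧ τ = powerTilt a μ

/-- `ℓ` is a local time process `(ℓ_t^{(α,a)})_{t ≥ 0}`: a nonnegative process with
right-continuous paths, with `(ℓ_1)^{1/α}` distributed as `1/T_{α,a}`, and with the scaling
property that `ℓ_t` is distributed as `t ^ α * ℓ_1`. -/
structure IsPDLocalTime {Ω : Type*} [MeasurableSpace Ω] (α a : ℝ) (ℓ : ℝ≥0 → Ω → ℝ)
    (P : Measure Ω) : Prop where
  measurable : ∀ t, Measurable (ℓ t)
  nonneg : ∀ t ω, 0 ≤ ℓ t ω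
  right_continuous : ∀ ω t, ContinuousWithinAt (fun s => ℓ s ω) (Ici t) t
  law_one : ∃ τ : Measure ℝ, IsTiltedStable α a τ ∧
    P.map (fun ω => ℓ 1 ω ^ (1 / α)) = τ.map fun t => 1 / t
  scaling : ∀ t : ℝ≥0, P.map (ℓ t) = P.map fun ω => (t : ℝ) ^ α * ℓ 1 ω

/-- `x ^ (2α) + 2 x ^ α cos (απ) + 1`. -/
def lampertiPoly (α x : ℝ) : ℝ :=
  x ^ (2 * α) + 2 * x ^ α * Real.cos (α * π) + 1

/-- The density `ϱ_α` of `X_α`, on `(0, ∞)`. -/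
def lampertiDensity (α y : ℝ) : ℝ :=
  Real.sin (π * α) / π * (y ^ (α - 1) / lampertiPoly α y)

/-- The law `ϱ_α(y) dy` on `(0, ∞)` of `X_α`. -/
def lampertiLaw (α : ℝ) : Measure ℝ :=
  (volume.restrict (Ioi 0)).withDensity fun y => ENNReal.ofReal (lampertiDensity α y)

/-- The inverse cotangent, with values in `(0, π)`. -/
def arccot (y : ℝ) : ℝ := π / 2 - Real.arctan y

/-- The explicit formula for the distribution function `F_{X_α}` on `[0, ∞)`. -/
def lampertiCDF (α x : ℝ) : ℝ :=
  1 - 1 / (π * α) * arccot (Real.cot (π * α) + x ^ α / Real.sin (π * α))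

/-- `Φ(t) = E[log |t - X| ; X ≠ t]` for `X` with law `H`. -/
def logPotential (H : Measure ℝ) (t : ℝ) : ℝ :=
  ∫ x in {x | x ≠ t}, Real.log |t - x| ∂H

/-- The Cifarelli–Regazzini function `Δ_c(t|H) = (1/π) sin(π c H(t)) exp(-c Φ(t))`, with
`H(t) = H((-∞, t])`. -/
def crDelta (c : ℝ) (H : Measure ℝ) (t : ℝ) : ℝ :=
  1 / π * Real.sin (π * c * H.real (Iic t)) * Real.exp (-(c * logPotential H t))

/-- The explicit expression for `d_{αθ}(x|ϱ_α)`. -/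
def lampertiD (α θ x : ℝ) : ℝ :=
  α * θ * x ^ (α - 1) / π *
    ((Real.sin (π * α * (1 - θ * lampertiCDF α x))
        - x ^ α * Real.sin (π * θ * α * lampertiCDF α x))
      / lampertiPoly α x ^ (θ / 2 + 1))

end

/-! Everything is read off the generalized Stieltjes transform `s ↦ E[(s + X)^(-αθ)]`, which
determines a law on `[0, ∞)` (`measure_eq_of_stieltjes`): differentiation in `s` raises the order by
one, and at `s = 1` the transforms of orders `αθ + n` are the moments of a finite measure
transported by `1/(1 + x)`. The variables to be compared all have transform `(1 + s^α)^(-θ)`.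

For the Dirichlet mean, the Markov–Krein identity `E[(1 + lM)^(-c)] = exp(-c ∫ log(1 + ly) H(dy))`
with `c = αθ` reduces this to the logarithmic transform of `ϱ_α`, which is `α⁻¹ log(1 + l^α)`
(`log_transform_lampertiLaw`). For `S/T`, a Gamma integral expresses `E[(T + lS)^(-αθ)]` through the
two Laplace transforms, so that it depends on `l` only through `1 + l^α`
(`lintegral_stable_add_rpow`); the tilt converts it into the transform of the ratio. For the local
time, scaling and independence replace `ℓ_S^{1/α}` by `S ℓ_1^{1/α}` (`map_process_at_indep`).

The analytic source is `(1 + e^{αw})^(-θ)`, holomorphic for `|Im w| < π/α`, hence around the closed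
strip `|Im w| ≤ π`. Its jump between the two edges is `2πi Δ(e^x)`, and Cauchy's theorem on long
rectangles shows that the ordinary Stieltjes transform of `Δ` is again `(1 + s^α)^(-θ)`
(`integral_lampertiDelta_div_add_exp`). For `θ = 1` one has `Δ(y) = y ϱ_α(y)`; integrating that case
on the logarithmic scale gives the logarithmic transform, and its boundary values on the negative
half-line give the potential `Φ`, which identifies `Δ` with the Cifarelli–Regazzini function
(`crDelta_lampertiLaw`).

The distribution function and the fractional integral of `Δ` then have the same transform of order
`αθ + 1` (`stieltjes_cdf`, `stieltjes_abel`), so they agree almost everywhere, and everywhere by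
right-continuity. Differentiation of the fractional integral gives the density (`hasDerivAt_abel`),
nonnegative because a distribution function increases. -/

/-! ### Uniqueness from moments and from generalized Stieltjes transforms. -/

/-- Finite measures carried by `[0, 1]` are determined by their moments. -/
theorem measure_eq_of_moments {μ ν : Measure ℝ} [IsFiniteMeasure μ] [IsFiniteMeasure ν]
    (hμ : ∀ᵐ x ∂μ, |x| ≤ 1) (hν : ∀ᵐ x ∂ν, |x| ≤ 1)
    (h : ∀ n : ℕ, ∫ x, x ^ n ∂μ = ∫ x, x ^ n ∂ν) : μ = ν := by
  -- The characteristic function is the sum of the moment series; its terms are dominated by `|t|^n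
  -- / n!`, constant in `x` and summable.
  have key : ∀ (m : Measure ℝ) [IsFiniteMeasure m], (∀ᵐ x ∂m, |x| ≤ 1) → ∀ t : ℝ,
      HasSum (fun n : ℕ => (t * Complex.I) ^ n / (n.factorial : ℂ) * ((∫ x, x ^ n ∂m : ℝ) : ℂ))
        (charFun m t) := by
    intro m _ hm t
    rw [charFun_apply_real]
    have := hasSum_integral_of_dominated_convergence (μ := m)
      (F := fun (n : ℕ) (x : ℝ) => (t * Complex.I) ^ n / (n.factorial : ℂ) * ((x ^ n : ℝ) : ℂ))
      (f := fun x : ℝ => Complex.exp (t * x * Complex.I))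
      (fun n _ => |t| ^ n / n.factorial) ?_ ?_ ?_ ?_ ?_
    · convert! this using 2 with n
      rw [integral_const_mul, integral_complex_ofReal]
    · intro n
      exact ((Complex.measurable_ofReal.comp (measurable_id.pow_const n)).const_mul
        _).aestronglyMeasurable
    · intro n
      filter_upwards [hm] with x hx
      rw [norm_mul, norm_div, norm_pow, norm_mul, Complex.norm_I, mul_one, Complex.norm_real,
        Complex.norm_natCast, Complex.norm_real, norm_pow]
      refine mul_le_of_le_one_right (by positivity) (pow_le_one₀ (norm_nonneg _) hx)
    · exact ae_of_all _ fun x => Real.summable_pow_div_factorial _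
    · exact integrable_const _
    · refine ae_of_all _ fun x => ?_
      have := NormedSpace.expSeries_div_hasSum_exp (t * x * Complex.I : ℂ)
      rw [← Complex.exp_eq_exp_ℂ] at this
      convert! this using 2 with n
      push_cast
      ring
  refine Measure.ext_of_charFun (funext fun t => ?_)
  refine (key μ hμ t).unique ?_
  simp_rw [h]
  exact key ν hν t

section Stieltjes

variable {μ ν : Measure ℝ} {a : ℝ}

theorem integrable_rpow_neg_succ (hμ : ∀ᵐ x ∂μ, 0 ≤ x) {s : ℝ} (hs : 0 < s)
    (hi : Integrable (fun x => (s + x) ^ (-a)) μ) :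
    Integrable (fun x => (s + x) ^ (-(a + 1))) μ := by
  refine (hi.const_mul s⁻¹).mono' (by fun_prop : Measurable _).aestronglyMeasurable ?_
  filter_upwards [hμ] with x hx
  have hp : 0 < s + x := by linarith
  rw [Real.norm_of_nonneg (by positivity), neg_add, Real.rpow_add hp, mul_comm, Real.rpow_neg_one]
  gcongr
  linarith

/-- Differentiation of a generalized Stieltjes transform. -/
theorem hasDerivAt_stieltjes (ha : 0 < a) (hμ : ∀ᵐ x ∂μ, 0 ≤ x)
    (hi : ∀ s : ℝ, 0 < s → Integrable (fun x => (s + x) ^ (-a)) μ) {s : ℝ} (hs : 0 < s) :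
    HasDerivAt (fun s => ∫ x, (s + x) ^ (-a) ∂μ) (-a * ∫ x, (s + x) ^ (-(a + 1)) ∂μ) s := by
  -- The neighbourhood `Ioi (s / 2)` stays away from `0`, so the derivative is bounded there by its
  -- size at `s / 2`.
  have h := hasDerivAt_integral_of_dominated_loc_of_deriv_le (μ := μ) (x₀ := s)
    (s := Ioi (s / 2)) (F := fun s x => (s + x) ^ (-a))
    (F' := fun s x => -a * (s + x) ^ (-(a + 1)))
    (bound := fun x => a * (s / 2 + x) ^ (-(a + 1)))
    (Ioi_mem_nhds (by linarith)) (Eventually.of_forall fun s =>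
      (by fun_prop : Measurable _).aestronglyMeasurable) (hi s hs)
    (by fun_prop : Measurable _).aestronglyMeasurable ?_ ?_ ?_
  · rw [← integral_const_mul]
    exact h.2
  · filter_upwards [hμ] with x hx y hy
    have hy' : s / 2 < y := hy
    rw [norm_mul, norm_neg, Real.norm_of_nonneg ha.le,
      Real.norm_of_nonneg (Real.rpow_nonneg (by linarith) _)]
    refine mul_le_mul_of_nonneg_left ?_ ha.le
    exact Real.rpow_le_rpow_of_nonpos (by linarith) (by linarith) (by linarith)
  · exact (integrable_rpow_neg_succ hμ (by linarith) (hi _ (by linarith))).const_mul _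
  · filter_upwards [hμ] with x hx y hy
    have hy' : s / 2 < y := hy
    have := ((hasDerivAt_id y).add_const x).rpow_const (p := -a) (Or.inl (by simp; linarith))
    convert! this using 1
    simp only [id, one_mul]
    ring_nf

/-- Differentiating an identity of order `a` gives, up to the nonzero factor `-a`, the identity of
order `a + 1`. -/
theorem stieltjes_eq_add_nat (ha : 0 < a) (hμ : ∀ᵐ x ∂μ, 0 ≤ x) (hν : ∀ᵐ x ∂ν, 0 ≤ x)
    (hμi : ∀ s : ℝ, 0 < s → Integrable (fun x => (s + x) ^ (-a)) μ)
    (hνi : ∀ s : ℝ, 0 < s → Integrable (fun x => (s + x) ^ (-a)) ν)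
    (h : ∀ s : ℝ, 0 < s → ∫ x, (s + x) ^ (-a) ∂μ = ∫ x, (s + x) ^ (-a) ∂ν) (n : ℕ) :
    ∀ s : ℝ, 0 < s → ∫ x, (s + x) ^ (-(a + n)) ∂μ = ∫ x, (s + x) ^ (-(a + n)) ∂ν := by
  induction n generalizing a with
  | zero => simpa using h
  | succ n ih =>
    intro s hs
    have := ih (a := a + 1) (by linarith)
      (fun s hs => integrable_rpow_neg_succ hμ hs (hμi s hs))
      (fun s hs => integrable_rpow_neg_succ hν hs (hνi s hs)) ?_ s hs
    · convert this using 4 <;> (push_cast; ring)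
    · intro s hs
      have h1 := hasDerivAt_stieltjes ha hμ hμi hs
      have h2 := hasDerivAt_stieltjes ha hν hνi hs
      have h3 := h1.unique (h2.congr_of_eventuallyEq
        (by filter_upwards [Ioi_mem_nhds hs] with t ht using h t ht))
      exact mul_left_cancel₀ (by linarith) h3

/-- A measure on `[0, ∞)` is determined by its generalized Stieltjes transform. -/
theorem measure_eq_of_stieltjes (ha : 0 < a) (hμ : ∀ᵐ x ∂μ, 0 ≤ x) (hν : ∀ᵐ x ∂ν, 0 ≤ x)
    (hμi : ∀ s : ℝ, 0 < s → Integrable (fun x => (s + x) ^ (-a)) μ)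
    (hνi : ∀ s : ℝ, 0 < s → Integrable (fun x => (s + x) ^ (-a)) ν)
    (h : ∀ s : ℝ, 0 < s → ∫ x, (s + x) ^ (-a) ∂μ = ∫ x, (s + x) ^ (-a) ∂ν) : μ = ν := by
  -- The weight makes the measure finite, and `u` carries it to a bounded interval, where moments
  -- determine it. Both operations are undone afterwards by `inv` and `back`.
  set w : ℝ → ℝ≥0∞ := fun x => ENNReal.ofReal ((1 + x) ^ (-a)) with hw
  have hwm : Measurable w := by fun_prop
  set u : ℝ → ℝ := fun x => (1 + x)⁻¹ with hu
  have hum : Measurable u := by fun_prop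
  have fin : ∀ {m : Measure ℝ}, Integrable (fun x => (1 + x) ^ (-a)) m →
      IsFiniteMeasure (m.withDensity w) := fun hm =>
    isFiniteMeasure_withDensity_ofReal hm.2
  have := fin (hμi 1 one_pos)
  have := fin (hνi 1 one_pos)
  have nn : ∀ {m : Measure ℝ}, (∀ᵐ x ∂m, 0 ≤ x) → ∀ᵐ x ∂(m.withDensity w), 0 ≤ x := fun hm =>
    (withDensity_absolutelyContinuous _ _).ae_le hm
  have bd : ∀ {m : Measure ℝ}, (∀ᵐ x ∂m, 0 ≤ x) →
      ∀ᵐ y ∂((m.withDensity w).map u), |y| ≤ 1 := by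
    intro m hm
    refine (ae_map_iff hum.aemeasurable (measurableSet_le (by fun_prop) (by fun_prop))).2 ?_
    filter_upwards [nn hm] with x hx
    have : 0 < 1 + x := by linarith
    rw [abs_of_pos (by positivity)]
    exact inv_le_one_of_one_le₀ (by linarith)
  have mom : ∀ {m : Measure ℝ}, (∀ᵐ x ∂m, 0 ≤ x) → ∀ n : ℕ,
      ∫ y, y ^ n ∂((m.withDensity w).map u) = ∫ x, (1 + x) ^ (-(a + n)) ∂m := by
    intro m hm n
    rw [integral_map hum.aemeasurable (by fun_prop),
      integral_withDensity_eq_integral_toReal_smul hwm (by simp [hw])]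
    refine integral_congr_ae ?_
    filter_upwards [hm] with x hx
    have hp : 0 < 1 + x := by linarith
    simp only [hw, hu, smul_eq_mul]
    rw [ENNReal.toReal_ofReal (by positivity), neg_add, Real.rpow_add hp, Real.rpow_neg hp.le n,
      Real.rpow_natCast, inv_pow]
  have e1 : (μ.withDensity w).map u = (ν.withDensity w).map u :=
    measure_eq_of_moments (bd hμ) (bd hν) fun n => by
      rw [mom hμ, mom hν, stieltjes_eq_add_nat ha hμ hν hμi hνi h n 1 one_pos]
  have inv : ∀ {m : Measure ℝ}, (∀ᵐ x ∂m, 0 ≤ x) →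
      ((m.withDensity w).map u).map (fun y => y⁻¹ - 1) = m.withDensity w := by
    intro m hm
    rw [Measure.map_map (by fun_prop) hum]
    conv_rhs => rw [← Measure.map_id (μ := m.withDensity w)]
    refine Measure.map_congr ?_
    filter_upwards [nn hm] with x hx
    simp [hu]
  have e2 : μ.withDensity w = ν.withDensity w := by rw [← inv hμ, ← inv hν, e1]
  have back : ∀ {m : Measure ℝ}, (∀ᵐ x ∂m, 0 ≤ x) →
      (m.withDensity w).withDensity (fun x => (w x)⁻¹) = m := by
    intro m hm
    refine withDensity_inv_same hwm ?_ (ae_of_all _ fun x => ENNReal.ofReal_ne_top)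
    filter_upwards [hm] with x hx
    have hp : 0 < 1 + x := by linarith
    exact (ENNReal.ofReal_pos.2 (by positivity)).ne'
  rw [← back hμ, ← back hν, e2]

end Stieltjes

/-! ### Products of Gamma laws and the Dirichlet distribution. -/

theorem lintegral_pi_prod {n : ℕ} (μ : Fin n → Measure ℝ) [∀ i, SigmaFinite (μ i)]
    {f : Fin n → ℝ → ℝ≥0∞} (hf : ∀ i, Measurable (f i)) :
    ∫⁻ x, ∏ i, f i (x i) ∂(Measure.pi μ) = ∏ i, ∫⁻ x, f i x ∂(μ i) := by
  induction n with
  | zero => simp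
  | succ n ih =>
    calc
      _ = ∫⁻ x : ℝ × (Fin n → ℝ), f 0 x.1 * ∏ i : Fin n, f i.succ (x.2 i)
            ∂((μ 0).prod (Measure.pi fun i => μ i.succ)) := by
        rw [← ((measurePreserving_piFinSuccAbove μ 0).symm).lintegral_comp_emb
          (MeasurableEquiv.measurableEmbedding _)]
        simp_rw [MeasurableEquiv.piFinSuccAbove_symm_apply, Fin.insertNthEquiv,
          Fin.prod_univ_succ, Fin.insertNth_zero, Equiv.coe_fn_mk, Fin.cons_succ,
          Fin.zero_succAbove, cast_eq, Fin.cons_zero]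
      _ = (∫⁻ x, f 0 x ∂μ 0) * ∏ i : Fin n, ∫⁻ x, f i.succ x ∂(μ i.succ) := by
        rw [← ih _ fun i => hf i.succ, ← lintegral_prod_mul (hf 0).aemeasurable]
        exact (Finset.measurable_prod _
          fun i _ => (hf i.succ).comp (measurable_pi_apply i)).aemeasurable
      _ = _ := by rw [Fin.prod_univ_succ]

theorem pi_withDensity {n : ℕ} (μ : Fin n → Measure ℝ) [∀ i, SigmaFinite (μ i)]
    {f : Fin n → ℝ → ℝ≥0∞} (hf : ∀ i, Measurable (f i))
    [∀ i, SigmaFinite ((μ i).withDensity (f i))] :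
    Measure.pi (fun i => (μ i).withDensity (f i)) =
      (Measure.pi μ).withDensity fun x => ∏ i, f i (x i) := by
  refine Measure.pi_eq fun s hs => ?_
  rw [withDensity_apply _ (MeasurableSet.univ_pi hs),
    ← lintegral_indicator (MeasurableSet.univ_pi hs)]
  have : ∀ x : Fin n → ℝ, (univ.pi s).indicator (fun x => ∏ i, f i (x i)) x =
      ∏ i, (s i).indicator (f i) (x i) := by
    intro x
    by_cases hx : x ∈ univ.pi s
    · rw [indicator_of_mem hx]
      exact Finset.prod_congr rfl fun i _ => (indicator_of_mem (hx i trivial) _).symm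
    · rw [indicator_of_notMem hx]
      simp only [Set.mem_pi, mem_univ, true_implies, not_forall] at hx
      obtain ⟨i, hi⟩ := hx
      exact (Finset.prod_eq_zero (Finset.mem_univ i) (indicator_of_notMem hi _)).symm
  simp_rw [this]
  rw [lintegral_pi_prod _ fun i => (hf i).indicator (hs i)]
  refine Finset.prod_congr rfl fun i _ => ?_
  rw [lintegral_indicator (hs i), withDensity_apply _ (hs i)]

instance isProbabilityMeasure_gammaLaw (a : ℝ) : IsProbabilityMeasure (gammaLaw a) := by
  unfold gammaLaw
  split_ifs with h
  · exact isProbabilityMeasure_gammaMeasure h one_pos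
  · infer_instance

theorem gammaLaw_nonneg (a : ℝ) : ∀ᵐ x ∂gammaLaw a, 0 ≤ x := by
  unfold gammaLaw
  split_ifs with h
  · rw [gammaMeasure, ae_withDensity_iff (by unfold gammaPDF; fun_prop)]
    refine ae_of_all _ fun x hx => ?_
    by_contra hn
    exact hx (gammaPDF_of_neg (not_le.1 hn))
  · simp

theorem gammaLaw_pos {a : ℝ} (ha : 0 < a) : ∀ᵐ x ∂gammaLaw a, 0 < x := by
  have h0 : ∀ᵐ x ∂gammaLaw a, x ≠ 0 := by
    rw [gammaLaw, if_pos ha, gammaMeasure]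
    exact (withDensity_absolutelyContinuous _ _).ae_le (Measure.ae_ne volume 0)
  filter_upwards [gammaLaw_nonneg a, h0] with x h1 h2 using lt_of_le_of_ne h1 h2.symm

/-- The density of the law of `g / t` with respect to the law of `g`, for a Gamma variable. -/
theorem gammaLaw_map_mul {a : ℝ} (ha : 0 ≤ a) {t : ℝ} (ht : 0 < t) :
    (gammaLaw a).map (fun g => t⁻¹ * g) =
      (gammaLaw a).withDensity fun g => ENNReal.ofReal (t ^ a * Real.exp (-((t - 1) * g))) := by
  rcases ha.eq_or_lt with rfl | ha
  · simp only [gammaLaw, lt_irrefl, if_false]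
    rw [Measure.map_dirac' (by fun_prop), mul_zero]
    refine (Measure.ext fun s hs => ?_)
    classical
    rw [withDensity_apply _ hs, setLIntegral_dirac' (by fun_prop) hs]
    simp [Measure.dirac_apply' _ hs, indicator_apply]
  · have hpm : Measurable (gammaPDF a 1) := by unfold gammaPDF; fun_prop
    rw [gammaLaw, if_pos ha, gammaMeasure]
    refine Measure.ext_of_lintegral _ fun φ hφ => ?_
    rw [lintegral_map hφ (by fun_prop),
      lintegral_withDensity_eq_lintegral_mul _ hpm
        (g := fun g => φ (t⁻¹ * g)) (hφ.comp (by fun_prop)),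
      lintegral_withDensity_eq_lintegral_mul _ (by fun_prop) hφ,
      lintegral_withDensity_eq_lintegral_mul _ hpm (by fun_prop)]
    set F : ℝ → ℝ≥0∞ := fun y => gammaPDF a 1 (t * y) * φ y with hF
    have hFm : Measurable F := (hpm.comp (by fun_prop)).mul hφ
    have e1 : ∀ g, (gammaPDF a 1 * fun x => φ (t⁻¹ * x)) g = F (t⁻¹ * g) := fun g => by
      simp [hF, mul_inv_cancel_left₀ ht.ne']
    simp_rw [e1]
    rw [← lintegral_map hFm (by fun_prop : Measurable fun g : ℝ => t⁻¹ * g),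
      Real.map_volume_mul_left (inv_ne_zero ht.ne'), lintegral_smul_measure, inv_inv,
      abs_of_pos ht, smul_eq_mul, ← lintegral_const_mul _ hFm]
    refine lintegral_congr_ae ?_
    filter_upwards [Measure.ae_ne volume (0 : ℝ)] with y hy
    simp only [hF, Pi.mul_apply]
    rw [← mul_assoc, ← mul_assoc]
    congr 1
    rcases lt_or_ge y 0 with h | h
    · rw [gammaPDF_of_neg h, gammaPDF_of_neg (mul_neg_of_pos_of_neg ht h)]; simp
    · have hy : 0 < y := lt_of_le_of_ne h (Ne.symm hy)
      rw [gammaPDF_of_nonneg h, gammaPDF_of_nonneg (by positivity),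
        ← ENNReal.ofReal_mul ht.le,
        ← ENNReal.ofReal_mul (by have := Real.Gamma_pos_of_pos ha; positivity)]
      congr 1
      rw [Real.mul_rpow ht.le h, Real.rpow_sub_one ht.ne', one_mul, one_mul,
        show -(t * y) = -((t - 1) * y) + -y by ring, Real.exp_add]
      field_simp

/-- The change of scale for independent Gamma variables. -/
theorem lintegral_pi_gammaLaw_div {n : ℕ} {a : Fin n → ℝ} (ha : ∀ i, 0 ≤ a i) {t : ℝ} (ht : 0 < t)
    {φ : (Fin n → ℝ) → ℝ≥0∞} (hφ : Measurable φ) :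
    ∫⁻ g, φ (fun i => t⁻¹ * g i) ∂(Measure.pi fun i => gammaLaw (a i)) =
      ∫⁻ g, ENNReal.ofReal (t ^ (∑ i, a i) * Real.exp (-((t - 1) * ∑ i, g i))) * φ g
        ∂(Measure.pi fun i => gammaLaw (a i)) := by
  set w : Fin n → ℝ → ℝ≥0∞ :=
    fun i g => ENNReal.ofReal (t ^ a i * Real.exp (-((t - 1) * g))) with hw
  have hwm : ∀ i, Measurable (w i) := fun i => by fun_prop
  have hmap : ∀ i, (gammaLaw (a i)).map (fun g => t⁻¹ * g) = (gammaLaw (a i)).withDensity (w i) :=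
    fun i => gammaLaw_map_mul (ha i) ht
  have hprob : ∀ i, IsProbabilityMeasure ((gammaLaw (a i)).map fun g => t⁻¹ * g) := fun i =>
    Measure.isProbabilityMeasure_map (by fun_prop)
  have hprob' : ∀ i, IsProbabilityMeasure ((gammaLaw (a i)).withDensity (w i)) := fun i =>
    hmap i ▸ hprob i
  have e := Measure.pi_map_pi (μ := fun i => gammaLaw (a i)) (f := fun _ g => t⁻¹ * g)
    (fun i => by fun_prop)
  simp_rw [hmap] at e
  rw [pi_withDensity _ hwm] at e
  have hp : ∀ g : Fin n → ℝ, ∏ i, w i (g i) =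
      ENNReal.ofReal (t ^ (∑ i, a i) * Real.exp (-((t - 1) * ∑ i, g i))) := fun g => by
    rw [hw, ← ENNReal.ofReal_prod_of_nonneg fun i _ => by positivity, Finset.prod_mul_distrib,
      Real.rpow_sum_of_pos ht, ← Real.exp_sum, Finset.mul_sum, Finset.sum_neg_distrib]
  simp_rw [hp] at e
  rw [← lintegral_map hφ (f := φ) (by fun_prop), e, lintegral_withDensity_eq_lintegral_mul _
    (by fun_prop) hφ]
  rfl

/-- The rescaled law in `gammaLaw_map_mul` has mass one; integrating its density gives the value,
shape `0` included. -/
theorem lintegral_gammaLaw_exp {a : ℝ} (ha : 0 ≤ a) {t : ℝ} (ht : 0 < t) :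
    ∫⁻ g, ENNReal.ofReal (Real.exp (-((t - 1) * g))) ∂gammaLaw a = ENNReal.ofReal (t ^ (-a)) := by
  have h := DFunLike.congr_fun (gammaLaw_map_mul ha ht) univ
  rw [Measure.map_apply (by fun_prop) MeasurableSet.univ, preimage_univ, measure_univ,
    withDensity_apply _ MeasurableSet.univ, Measure.restrict_univ] at h
  simp_rw [ENNReal.ofReal_mul (Real.rpow_nonneg ht.le a)] at h
  rw [lintegral_const_mul _ (by fun_prop)] at h
  rw [Real.rpow_neg ht.le, ENNReal.ofReal_inv_of_pos (by positivity)]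
  exact ENNReal.eq_inv_of_mul_eq_one_left (by rw [mul_comm]; exact h.symm)

theorem lintegral_rpow_mul_exp {c B : ℝ} (hc : 0 < c) (hB : 0 < B) :
    ∫⁻ t in Ioi (0 : ℝ), ENNReal.ofReal (t ^ (c - 1) * Real.exp (-(B * t))) =
      ENNReal.ofReal (Real.Gamma c * B ^ (-c)) := by
  have h := Real.integral_rpow_mul_exp_neg_mul_Ioi hc hB
  have hG := Real.Gamma_pos_of_pos hc
  rw [← ofReal_integral_eq_lintegral_ofReal, h]
  · rw [one_div, Real.inv_rpow hB.le, Real.rpow_neg hB.le, mul_comm]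
  · refine not_imp_comm.1 integral_undef ?_
    rw [h]
    positivity
  · filter_upwards [ae_restrict_mem measurableSet_Ioi] with t ht
    have : 0 < t := ht
    simp only [Pi.zero_apply]
    positivity

/-- The substitution `t ↦ 1/t` yields `B^c t^(c-1) e^(-Bt)`, so `B` disappears from the value. In
the Dirichlet identity `B` is the total of the Gamma variables, which is eliminated this way. -/
theorem lintegral_rpow_mul_exp_inv {c B : ℝ} (hc : 0 < c) (hB : 0 < B) :
    ∫⁻ t in Ioi (0 : ℝ), ENNReal.ofReal (t⁻¹ * (B * t⁻¹) ^ c * Real.exp (-(B * t⁻¹))) =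
      ENNReal.ofReal (Real.Gamma c) := by
  have h := Real.integral_rpow_mul_exp_neg_mul_Ioi hc hB
  have hG := Real.Gamma_pos_of_pos hc
  have h2 := integral_comp_rpow_Ioi (fun t : ℝ => t ^ (c - 1) * Real.exp (-(B * t)))
    (p := -1) (by norm_num)
  rw [h] at h2
  have h3 : ∫ t in Ioi (0 : ℝ), t⁻¹ * (B * t⁻¹) ^ c * Real.exp (-(B * t⁻¹)) = Real.Gamma c := by
    have : ∫ t in Ioi (0 : ℝ), t⁻¹ * (B * t⁻¹) ^ c * Real.exp (-(B * t⁻¹)) =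
        ∫ x in Ioi (0 : ℝ), B ^ c * ((|(-1 : ℝ)| * x ^ (-1 - 1 : ℝ)) •
          ((x ^ (-1 : ℝ)) ^ (c - 1) * Real.exp (-(B * x ^ (-1 : ℝ))))) := by
      refine setIntegral_congr_fun measurableSet_Ioi fun x hx => ?_
      have hx : 0 < x := hx
      simp only [abs_neg, abs_one, one_mul, smul_eq_mul]
      rw [Real.rpow_neg_one, Real.mul_rpow hB.le (by positivity),
        Real.rpow_sub_one (inv_pos.2 hx).ne', Real.rpow_sub_one hx.ne', Real.rpow_neg_one]
      field_simp
    rw [this, integral_const_mul, h2, one_div, Real.inv_rpow hB.le]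
    field_simp
  rw [← ofReal_integral_eq_lintegral_ofReal, h3]
  · refine not_imp_comm.1 integral_undef ?_
    rw [h3]
    positivity
  · filter_upwards [ae_restrict_mem measurableSet_Ioi] with t ht
    have : 0 < t := ht
    simp only [Pi.zero_apply]
    positivity

theorem pi_gammaLaw_nonneg {n : ℕ} (a : Fin n → ℝ) :
    ∀ᵐ g ∂(Measure.pi fun i => gammaLaw (a i)), ∀ i, 0 ≤ g i := by
  rw [ae_all_iff]
  intro i
  exact (measurePreserving_eval _ i).quasiMeasurePreserving.ae (gammaLaw_nonneg (a i))

theorem pi_gammaLaw_sum_pos {n : ℕ} {a : Fin n → ℝ} (ha : ∀ i, 0 ≤ a i) (hs : 0 < ∑ i, a i) :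
    ∀ᵐ g ∂(Measure.pi fun i => gammaLaw (a i)), 0 < ∑ i, g i := by
  obtain ⟨i, -, hi⟩ := Finset.exists_ne_zero_of_sum_ne_zero hs.ne'
  have h1 := (measurePreserving_eval (fun i => gammaLaw (a i)) i).quasiMeasurePreserving.ae
    (gammaLaw_pos (lt_of_le_of_ne (ha i) hi.symm))
  filter_upwards [pi_gammaLaw_nonneg a, h1] with g h0 h1
  exact Finset.sum_pos' (fun i _ => h0 i) ⟨i, Finset.mem_univ i, h1⟩

/-- The Markov–Krein identity for the Dirichlet distribution. -/
theorem lintegral_dirichletLaw_rpow {n : ℕ} {a : Fin n → ℝ} (ha : ∀ i, 0 ≤ a i)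
    (hs : 0 < ∑ i, a i) {β : Fin n → ℝ} (hβ : ∀ i, 0 < β i) :
    ∫⁻ x, ENNReal.ofReal ((∑ i, β i * x i) ^ (-(∑ i, a i))) ∂(dirichletLaw a) =
      ∏ i, ENNReal.ofReal (β i ^ (-(a i))) := by
  set c := ∑ i, a i with hc
  set γ := Measure.pi fun i => gammaLaw (a i) with hγ
  have hG := Real.Gamma_pos_of_pos hs
  have hGE : ENNReal.ofReal (Real.Gamma c) ≠ 0 := (ENNReal.ofReal_pos.2 hG).ne'
  have hae : ∀ᵐ g ∂γ, 0 < ∑ i, g i ∧ 0 < ∑ i, β i * g i := by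
    filter_upwards [pi_gammaLaw_nonneg a, pi_gammaLaw_sum_pos ha hs] with g h0 h1
    refine ⟨h1, ?_⟩
    obtain ⟨i, -, hi⟩ := Finset.exists_ne_zero_of_sum_ne_zero h1.ne'
    exact Finset.sum_pos' (fun i _ => mul_nonneg (hβ i).le (h0 i))
      ⟨i, Finset.mem_univ i, mul_pos (hβ i) (lt_of_le_of_ne (h0 i) hi.symm)⟩
  rw [dirichletLaw, lintegral_map (by fun_prop) (by fun_prop)]
  refine (ENNReal.mul_right_inj hGE ENNReal.ofReal_ne_top).1 ?_
  rw [← lintegral_const_mul _ (by fun_prop)]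
  calc
    -- A Gamma integral in `t` replaces the negative power; normalization by the total contributes
    -- `(∑ g)^c`.
    _ = ∫⁻ g, (∫⁻ t in Ioi (0 : ℝ), ENNReal.ofReal
          (t ^ (c - 1) * (∑ i, g i) ^ c * Real.exp (-((∑ i, β i * g i) * t)))) ∂γ := by
      refine lintegral_congr_ae ?_
      filter_upwards [hae] with g ⟨h1, h2⟩
      have e : ∀ t : ℝ, ENNReal.ofReal
          (t ^ (c - 1) * (∑ i, g i) ^ c * Real.exp (-((∑ i, β i * g i) * t))) =
          ENNReal.ofReal ((∑ i, g i) ^ c) *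
            ENNReal.ofReal (t ^ (c - 1) * Real.exp (-((∑ i, β i * g i) * t))) := fun t => by
        rw [← ENNReal.ofReal_mul (by positivity)]
        ring_nf
      simp_rw [e]
      rw [lintegral_const_mul _ (by fun_prop), lintegral_rpow_mul_exp hs h2,
        ← ENNReal.ofReal_mul hG.le, ← ENNReal.ofReal_mul (by positivity)]
      congr 1
      have : ∑ i, β i * (g i / ∑ j, g j) = (∑ i, β i * g i) / ∑ j, g j := by
        rw [Finset.sum_div]
        exact Finset.sum_congr rfl fun i _ => by ring
      rw [this, Real.div_rpow h2.le h1.le, Real.rpow_neg h1.le c]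
      field_simp
    _ = ∫⁻ t in Ioi (0 : ℝ), ∫⁻ g, ENNReal.ofReal
          (t ^ (c - 1) * (∑ i, g i) ^ c * Real.exp (-((∑ i, β i * g i) * t))) ∂γ :=
      lintegral_lintegral_swap (by fun_prop)
    -- For fixed `t`, all Gamma variables are rescaled by `t⁻¹`. This leaves `t` attached to the
    -- total alone, so the independence of the total and the normalized vector is not needed.
    _ = ∫⁻ t in Ioi (0 : ℝ), ∫⁻ g, ENNReal.ofReal (Real.exp (-∑ i, (β i - 1) * g i)) *
          ENNReal.ofReal (t⁻¹ * ((∑ i, g i) * t⁻¹) ^ c * Real.exp (-((∑ i, g i) * t⁻¹))) ∂γ := by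
      refine setLIntegral_congr_fun measurableSet_Ioi fun t ht => ?_
      have ht : 0 < t := ht
      have h := lintegral_pi_gammaLaw_div ha ht (φ := fun g => ENNReal.ofReal
        (t⁻¹ * (∑ i, g i) ^ c * Real.exp (-((∑ i, β i * g i) * t) + (t - 1) * ∑ i, g i)))
        (by fun_prop)
      refine (Eq.trans ?_ h.symm).trans ?_
      · refine lintegral_congr_ae ?_
        filter_upwards [hae] with g ⟨h1, h2⟩
        rw [← ENNReal.ofReal_mul (by positivity), Real.exp_add, Real.exp_neg ((t - 1) * _),
          Real.rpow_sub_one ht.ne', ← hc]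
        congr 1
        field_simp
      · refine lintegral_congr_ae ?_
        filter_upwards [hae] with g ⟨h1, h2⟩
        rw [← ENNReal.ofReal_mul (by positivity)]
        have e1 : ∑ i, t⁻¹ * g i = (∑ i, g i) * t⁻¹ := by
          rw [← Finset.mul_sum, mul_comm]
        have e2 : ∑ i, β i * (t⁻¹ * g i) = (∑ i, β i * g i) * t⁻¹ := by
          rw [Finset.sum_mul]
          exact Finset.sum_congr rfl fun i _ => by ring
        have e3 : ∑ i, (β i - 1) * g i = ∑ i, β i * g i - ∑ i, g i := by
          rw [← Finset.sum_sub_distrib]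
          exact Finset.sum_congr rfl fun i _ => by ring
        rw [e1, e2, e3, mul_left_comm (Real.exp _), ← Real.exp_add]
        congr 3
        field_simp
        ring
    _ = ∫⁻ g, (∫⁻ t in Ioi (0 : ℝ), ENNReal.ofReal (Real.exp (-∑ i, (β i - 1) * g i)) *
          ENNReal.ofReal (t⁻¹ * ((∑ i, g i) * t⁻¹) ^ c * Real.exp (-((∑ i, g i) * t⁻¹)))) ∂γ :=
      lintegral_lintegral_swap (by fun_prop)
    _ = ∫⁻ g, ENNReal.ofReal (Real.Gamma c) *
          ∏ i, ENNReal.ofReal (Real.exp (-((β i - 1) * g i))) ∂γ := by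
      refine lintegral_congr_ae ?_
      filter_upwards [hae] with g ⟨h1, h2⟩
      rw [lintegral_const_mul _ (by fun_prop), lintegral_rpow_mul_exp_inv hs h1, mul_comm,
        ← ENNReal.ofReal_prod_of_nonneg fun i _ => by positivity, ← Real.exp_sum,
        Finset.sum_neg_distrib]
    _ = _ := by
      rw [lintegral_const_mul _ (by fun_prop), hγ, lintegral_pi_prod (f := fun i y =>
        ENNReal.ofReal (Real.exp (-((β i - 1) * y)))) _ fun i => by fun_prop]
      congr 1
      exact Finset.prod_congr rfl fun i _ => lintegral_gammaLaw_exp (ha i) (hβ i)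

/-! ### The Markov–Krein identity for Dirichlet processes. -/

section DirichletProcess

variable {Ω E : Type*} [MeasurableSpace Ω] [MeasurableSpace E] {c : ℝ} {H : Measure E}
  {D : Ω → Measure E} {P : Measure Ω}

theorem IsDirichletProcess.measurable_real (hD : IsDirichletProcess c H D P) {A : Set E}
    (hA : MeasurableSet A) : Measurable fun ω => (D ω).real A :=
  ((Measure.measurable_coe hA).comp hD.measurable).ennreal_toReal

/-- A Dirichlet process does not charge the null sets of its parameter measure. -/
theorem IsDirichletProcess.ae_measure_eq_zero (hD : IsDirichletProcess c H D P) {A : Set E}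
    (hA : MeasurableSet A) (h0 : H A = 0) : ∀ᵐ ω ∂P, D ω A = 0 := by
  have hm : Measurable fun ω i => (D ω).real ((![A, Aᶜ] : Fin 2 → Set E) i) :=
    measurable_pi_lambda _ fun i => hD.measurable_real (by fin_cases i <;> simp [hA])
  have hl := hD.law_partition 2 ![A, Aᶜ] (fun i => by fin_cases i <;> simp [hA])
    (fun i j hij => by
      fin_cases i <;> fin_cases j <;> simp_all [disjoint_compl_right, disjoint_compl_left])
    (by ext x; simp [Fin.exists_fin_two, em])
  have h1 : ∀ᵐ x ∂(P.map fun ω i => (D ω).real ((![A, Aᶜ] : Fin 2 → Set E) i)), x 0 = 0 := by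
    rw [hl, dirichletLaw]
    refine (ae_map_iff (by fun_prop) (measurableSet_eq_fun (by fun_prop) (by fun_prop))).2 ?_
    have h2 : ∀ᵐ x ∂gammaLaw (c * H.real A), x = 0 := by
      simp [gammaLaw, measureReal_def, h0]
    have h3 := (measurePreserving_eval
      (fun i => gammaLaw (c * H.real ((![A, Aᶜ] : Fin 2 → Set E) i))) 0).quasiMeasurePreserving.ae
        h2
    filter_upwards [h3] with g hg
    have hg : g 0 = 0 := hg
    simp [hg]
  have h4 := ae_of_ae_map hm.aemeasurable h1
  filter_upwards [h4] with ω hω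
  have := hD.isProbabilityMeasure ω
  exact (measureReal_eq_zero_iff (measure_ne_top _ _)).1 hω

theorem IsDirichletProcess.measurable_lintegral (hD : IsDirichletProcess c H D P)
    {f : E → ℝ≥0∞} (hf : Measurable f) : Measurable fun ω => ∫⁻ x, f x ∂(D ω) :=
  (Measure.measurable_lintegral hf).comp hD.measurable

/-- The fibres of `g` form a finite partition, on which the law is Dirichlet. With weights `1 +
value`, the linear form is `1 + ∫ g dD` because `D` has mass one, and the total parameter is `c`
because `H` has mass one. -/
theorem IsDirichletProcess.markovKrein_simpleFunc [IsProbabilityMeasure H] (hc : 0 < c)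
    (hD : IsDirichletProcess c H D P) (g : SimpleFunc E ℝ≥0∞) (hg : ∀ x, g x < ∞) :
    ∫⁻ ω, (1 + ∫⁻ x, g x ∂(D ω)) ^ (-c) ∂P =
      ENNReal.ofReal (Real.exp
        (-(c * (∫⁻ x, ENNReal.ofReal (Real.log (1 + (g x).toReal)) ∂H).toReal))) := by
  classical
  set n := g.range.card
  set e : Fin n ≃ g.range := g.range.equivFin.symm
  set A : Fin n → Set E := fun i => g ⁻¹' {(e i : ℝ≥0∞)} with hA
  have hAm : ∀ i, MeasurableSet (A i) := fun i => g.measurableSet_fiber _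
  have hfin : ∀ i, (e i : ℝ≥0∞) < ∞ := fun i => by
    obtain ⟨x, hx⟩ := SimpleFunc.mem_range.1 (e i).2
    exact hx ▸ hg x
  have hdisj : Pairwise fun i j => Disjoint (A i) (A j) := fun i j hij =>
    Disjoint.preimage _ (by
      simpa [Subtype.ext_iff] using fun h => hij (e.injective (Subtype.ext h)))
  have hun : (⋃ i, A i) = univ := by
    refine eq_univ_of_forall fun x => mem_iUnion.2 ⟨e.symm ⟨g x, SimpleFunc.mem_range_self g x⟩, ?_⟩
    simp [hA]
  have hsum : ∀ (m : Measure E) [IsProbabilityMeasure m], ∑ i, m.real (A i) = 1 := by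
    intro m _
    rw [← measureReal_iUnion_fintype hdisj hAm, hun, probReal_univ]
  have hint : ∀ (m : Measure E) (φ : ℝ≥0∞ → ℝ≥0∞), ∫⁻ x, φ (g x) ∂m = ∑ i, φ (e i) * m (A i) := by
    intro m φ
    have := SimpleFunc.map_lintegral φ g (μ := m)
    rw [← SimpleFunc.lintegral_eq_lintegral] at this
    simp only [SimpleFunc.coe_map, Function.comp_apply] at this
    rw [this, ← Finset.sum_coe_sort, ← e.sum_comp]
  set β : Fin n → ℝ := fun i => 1 + (e i : ℝ≥0∞).toReal with hβ
  have hβ1 : ∀ i, 1 ≤ β i := fun i => by simp [hβ]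
  have hβ0 : ∀ i, 0 < β i := fun i => one_pos.trans_le (hβ1 i)
  have hcsum : ∑ i, c * H.real (A i) = c := by rw [← Finset.mul_sum, hsum, mul_one]
  have hlaw := hD.law_partition n A hAm hdisj hun
  have key := lintegral_dirichletLaw_rpow (a := fun i => c * H.real (A i))
    (fun i => by positivity) (by rw [hcsum]; exact hc) hβ0
  rw [← hlaw, lintegral_map (by fun_prop)
    (measurable_pi_lambda _ fun i => hD.measurable_real (hAm i)), hcsum] at key
  calc
    _ = ∫⁻ ω, ENNReal.ofReal ((∑ i, β i * (D ω).real (A i)) ^ (-c)) ∂P := by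
      refine lintegral_congr fun ω => ?_
      have := hD.isProbabilityMeasure ω
      have h1 : ∑ i, β i * (D ω).real (A i) =
          1 + ∑ i, (e i : ℝ≥0∞).toReal * (D ω).real (A i) := by
        simp only [hβ, add_mul, one_mul, Finset.sum_add_distrib, hsum (D ω)]
      have h2 : (0 : ℝ) ≤ ∑ i, (e i : ℝ≥0∞).toReal * (D ω).real (A i) :=
        Finset.sum_nonneg fun i _ => by positivity
      rw [h1, ← ENNReal.ofReal_rpow_of_pos (by linarith), ENNReal.ofReal_add zero_le_one h2,
        ENNReal.ofReal_one, ENNReal.ofReal_sum_of_nonneg fun i _ => by positivity]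
      congr 2
      refine (hint (D ω) id).trans ?_
      refine Finset.sum_congr rfl fun i _ => ?_
      rw [ENNReal.ofReal_mul ENNReal.toReal_nonneg, ENNReal.ofReal_toReal (hfin i).ne,
        measureReal_def, ENNReal.ofReal_toReal (measure_ne_top _ _), id]
    _ = _ := by
      rw [key, ← ENNReal.ofReal_prod_of_nonneg fun i _ => Real.rpow_nonneg (hβ0 i).le _,
        hint H fun r => ENNReal.ofReal (Real.log (1 + r.toReal)),
        ENNReal.toReal_sum fun i _ => ENNReal.mul_ne_top ENNReal.ofReal_ne_top (measure_ne_top _ _),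
        Finset.mul_sum, ← Finset.sum_neg_distrib, Real.exp_sum]
      congr 1
      refine Finset.prod_congr rfl fun i _ => ?_
      rw [Real.rpow_def_of_pos (hβ0 i), ENNReal.toReal_mul,
        ENNReal.toReal_ofReal (Real.log_nonneg (hβ1 i)), measureReal_def]
      congr 1
      ring

/-- The Markov–Krein identity for a Dirichlet process. -/
theorem IsDirichletProcess.markovKrein [IsProbabilityMeasure H] (hc : 0 < c)
    [IsFiniteMeasure P] (hD : IsDirichletProcess c H D P) {f : E → ℝ} (hf : Measurable f)
    (hlog : ∫⁻ x, ENNReal.ofReal (Real.log (1 + (ENNReal.ofReal (f x)).toReal)) ∂H ≠ ∞) :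
    ∫⁻ ω, (1 + ∫⁻ x, ENNReal.ofReal (f x) ∂(D ω)) ^ (-c) ∂P =
      ENNReal.ofReal (Real.exp (-(c *
        (∫⁻ x, ENNReal.ofReal (Real.log (1 + (ENNReal.ofReal (f x)).toReal)) ∂H).toReal))) := by
  set φ : E → ℝ≥0∞ := fun x => ENNReal.ofReal (f x) with hφ
  have hφm : Measurable φ := by fun_prop
  set g := SimpleFunc.eapprox φ with hg
  have hgt : ∀ x, Tendsto (fun n => g n x) atTop (𝓝 (φ x)) := SimpleFunc.tendsto_eapprox hφm
  have hgm : Monotone g := SimpleFunc.monotone_eapprox φ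
  have hgl : ∀ n x, g n x < ∞ := SimpleFunc.eapprox_lt_top φ
  have hgr : ∀ x, Tendsto (fun n => (g n x).toReal) atTop (𝓝 (φ x).toReal) := fun x =>
    (ENNReal.tendsto_toReal ENNReal.ofReal_ne_top).comp (hgt x)
  have h1 : ∀ ω, Tendsto (fun n => ∫⁻ x, g n x ∂(D ω)) atTop (𝓝 (∫⁻ x, φ x ∂(D ω))) := fun ω =>
    lintegral_tendsto_of_tendsto_of_monotone (fun n => (g n).measurable.aemeasurable)
      (ae_of_all _ fun x i j hij => hgm hij x) (ae_of_all _ hgt)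
  -- The base is at least `1` and the exponent negative, so `1` dominates; the limit is legitimate
  -- even where the mean of `f` is infinite.
  have h2 : Tendsto (fun n => ∫⁻ ω, (1 + ∫⁻ x, g n x ∂(D ω)) ^ (-c) ∂P) atTop
      (𝓝 (∫⁻ ω, (1 + ∫⁻ x, φ x ∂(D ω)) ^ (-c) ∂P)) := by
    refine tendsto_lintegral_of_dominated_convergence (fun _ => 1)
      (fun n => ((hD.measurable_lintegral (g n).measurable).const_add 1).pow_const _)
      (fun n => ae_of_all _ fun ω => ?_) (by simp) (ae_of_all _ fun ω => ?_)
    · exact ENNReal.rpow_le_one_of_one_le_of_neg le_self_add (by linarith)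
    · exact ((ENNReal.continuous_rpow_const).tendsto _).comp ((h1 ω).const_add 1)
  have h3 : Tendsto (fun n => ∫⁻ x, ENNReal.ofReal (Real.log (1 + (g n x).toReal)) ∂H) atTop
      (𝓝 (∫⁻ x, ENNReal.ofReal (Real.log (1 + (φ x).toReal)) ∂H)) := by
    refine lintegral_tendsto_of_tendsto_of_monotone (fun n => ?_)
      (ae_of_all _ fun x i j hij => ?_) (ae_of_all _ fun x => ?_)
    · have := (g n).measurable
      exact (by fun_prop : Measurable _).aemeasurable
    · have := ENNReal.toReal_mono (hgl j x).ne (hgm hij x)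
      have h0 : 0 ≤ (g i x).toReal := ENNReal.toReal_nonneg
      exact ENNReal.ofReal_le_ofReal (Real.log_le_log (by linarith) (by linarith))
    · have h0 : (1 + (φ x).toReal) ≠ 0 := by positivity
      exact (ENNReal.continuous_ofReal.tendsto _).comp
        ((Real.continuousAt_log h0).tendsto.comp ((hgr x).const_add 1))
  have h4 : Tendsto (fun n => ENNReal.ofReal (Real.exp
      (-(c * (∫⁻ x, ENNReal.ofReal (Real.log (1 + (g n x).toReal)) ∂H).toReal)))) atTop
      (𝓝 (ENNReal.ofReal (Real.exp
      (-(c * (∫⁻ x, ENNReal.ofReal (Real.log (1 + (φ x).toReal)) ∂H).toReal))))) :=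
    (ENNReal.continuous_ofReal.tendsto _).comp ((Real.continuous_exp.tendsto _).comp
      (((ENNReal.tendsto_toReal hlog).comp h3).const_mul c).neg)
  simp_rw [hD.markovKrein_simpleFunc hc _ (hgl _)] at h2
  exact tendsto_nhds_unique h2 h4

end DirichletProcess

/-! ### The polynomial, its angle, and the holomorphic function on the strip. -/

section Lamperti

variable {α θ : ℝ}

theorem sin_pi_mul_pos (hα0 : 0 < α) (hα1 : α < 1) : 0 < Real.sin (π * α) :=
  Real.sin_pos_of_pos_of_lt_pi (by positivity) (by nlinarith [Real.pi_pos])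

/-- The polynomial is both `|x^α + e^(iπα)|²` and `|1 + x^α e^(iπα)|²`. The first form bounds it
below by a constant, the second by a multiple of `x^(2α)`. -/
theorem lampertiPoly_eq {x : ℝ} (hx : 0 ≤ x) :
    lampertiPoly α x = (x ^ α + Real.cos (π * α)) ^ 2 + Real.sin (π * α) ^ 2 := by
  rw [lampertiPoly, mul_comm 2 α, Real.rpow_mul hx, mul_comm α π, Real.rpow_two]
  nlinarith [Real.sin_sq_add_cos_sq (π * α)]

theorem lampertiPoly_eq' {x : ℝ} (hx : 0 ≤ x) :
    lampertiPoly α x =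
      (1 + x ^ α * Real.cos (π * α)) ^ 2 + (x ^ α) ^ 2 * Real.sin (π * α) ^ 2 := by
  rw [lampertiPoly_eq hx]
  nlinarith [Real.sin_sq_add_cos_sq (π * α)]

theorem sin_sq_le_lampertiPoly {x : ℝ} (hx : 0 ≤ x) : Real.sin (π * α) ^ 2 ≤ lampertiPoly α x := by
  rw [lampertiPoly_eq hx]
  nlinarith [sq_nonneg (x ^ α + Real.cos (π * α))]

theorem rpow_mul_sin_sq_le_lampertiPoly {x : ℝ} (hx : 0 ≤ x) :
    (x ^ α) ^ 2 * Real.sin (π * α) ^ 2 ≤ lampertiPoly α x := by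
  rw [lampertiPoly_eq' hx]
  nlinarith [sq_nonneg (1 + x ^ α * Real.cos (π * α))]

theorem lampertiPoly_pos (hα0 : 0 < α) (hα1 : α < 1) {x : ℝ} (hx : 0 ≤ x) :
    0 < lampertiPoly α x := by
  have := sin_pi_mul_pos hα0 hα1
  exact lt_of_lt_of_le (by positivity) (sin_sq_le_lampertiPoly hx)

/-- The explicit form of the Cifarelli–Regazzini function of `ϱ_α`. -/
noncomputable def lampertiDelta (α θ x : ℝ) : ℝ :=
  1 / π * (Real.sin (π * θ * α * lampertiCDF α x) / lampertiPoly α x ^ (θ / 2))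

theorem measurable_lampertiPoly : Measurable (lampertiPoly α) := by
  unfold lampertiPoly
  fun_prop

theorem measurable_lampertiCDF : Measurable (lampertiCDF α) := by
  unfold lampertiCDF arccot
  fun_prop

theorem measurable_lampertiDelta : Measurable (lampertiDelta α θ) := by
  have := measurable_lampertiPoly (α := α)
  have := measurable_lampertiCDF (α := α)
  unfold lampertiDelta
  fun_prop

/-- Polar form: `π α F(x)` is the angle of `1 + x^α e^(iπα)`. If `y` denotes the quantity inside
`arccot`, then `sin(πα) y = x^α + cos(πα)`; hence the modulus is `sin(πα) √(1 + y²)` and the angle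
`πα - arccot y`. -/
theorem one_add_rpow_mul_exp (hα0 : 0 < α) (hα1 : α < 1) {x : ℝ} (hx : 0 ≤ x) :
    (1 + (x ^ α : ℝ) * Complex.exp (π * α * Complex.I) : ℂ) =
      (lampertiPoly α x ^ (1 / 2 : ℝ) : ℝ) *
        (Real.cos (π * α * lampertiCDF α x) + Real.sin (π * α * lampertiCDF α x) * Complex.I) := by
  have hs := sin_pi_mul_pos hα0 hα1
  have hπ := Real.pi_pos
  have hp := lampertiPoly_pos hα0 hα1 hx
  set y := Real.cot (π * α) + x ^ α / Real.sin (π * α) with hy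
  have hF : π * α * lampertiCDF α x = π * α - (π / 2 - Real.arctan y) := by
    rw [lampertiCDF, arccot, ← hy]
    field_simp
  have hq : lampertiPoly α x ^ (1 / 2 : ℝ) = Real.sin (π * α) * √(1 + y ^ 2) := by
    rw [← Real.sqrt_eq_rpow, Real.sqrt_eq_iff_mul_self_eq hp.le (by positivity),
      lampertiPoly_eq hx]
    symm
    have : √(1 + y ^ 2) * √(1 + y ^ 2) = 1 + y ^ 2 := Real.mul_self_sqrt (by positivity)
    have e : Real.sin (π * α) * y = Real.cos (π * α) + x ^ α := by
      rw [hy, Real.cot_eq_cos_div_sin]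
      field_simp
    calc _ = Real.sin (π * α) ^ 2 * (√(1 + y ^ 2) * √(1 + y ^ 2)) := by ring
      _ = Real.sin (π * α) ^ 2 + (Real.sin (π * α) * y) ^ 2 := by rw [this]; ring
      _ = _ := by rw [e]; ring
  have e : Real.sin (π * α) * y = Real.cos (π * α) + x ^ α := by
    rw [hy, Real.cot_eq_cos_div_sin]
    field_simp
  have h0 : √(1 + y ^ 2) ≠ 0 := by positivity
  clear_value y
  have hc : Real.cos (π / 2 - Real.arctan y) = y / √(1 + y ^ 2) := by
    rw [Real.cos_pi_div_two_sub, Real.sin_arctan]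
  have hsn : Real.sin (π / 2 - Real.arctan y) = 1 / √(1 + y ^ 2) := by
    rw [Real.sin_pi_div_two_sub, Real.cos_arctan]
  have hexp : Complex.exp (π * α * Complex.I) =
      Real.cos (π * α) + Real.sin (π * α) * Complex.I := by
    rw [Complex.exp_mul_I]
    push_cast
    ring
  rw [hF, hq, hexp, Real.cos_sub (π * α), Real.sin_sub (π * α), hc, hsn]
  have h2 := Real.sin_sq_add_cos_sq (π * α)
  have hX : x ^ α = Real.sin (π * α) * y - Real.cos (π * α) := by linarith
  rw [hX]
  generalize Real.sin (π * α) = S at h2 ⊢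
  generalize Real.cos (π * α) = C at h2 ⊢
  apply Complex.ext
  · simp
    field_simp
    linear_combination -h2
  · simp
    field_simp

/-- The angle stays in the principal branch, so the logarithm of the polar form can be read off. -/
theorem lampertiCDF_bounds (hα0 : 0 < α) (hα1 : α < 1) (x : ℝ) :
    -π < π * α * lampertiCDF α x ∧ π * α * lampertiCDF α x < π := by
  have hπ := Real.pi_pos
  have h1 := Real.arctan_lt_pi_div_two (Real.cot (π * α) + x ^ α / Real.sin (π * α))
  have h2 := Real.neg_pi_div_two_lt_arctan (Real.cot (π * α) + x ^ α / Real.sin (π * α))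
  have hF : π * α * lampertiCDF α x =
      π * α - (π / 2 - Real.arctan (Real.cot (π * α) + x ^ α / Real.sin (π * α))) := by
    rw [lampertiCDF, arccot]
    field_simp
  rw [hF]
  constructor <;> nlinarith

theorem abs_lampertiDelta_le (hα0 : 0 < α) (hα1 : α < 1) {x : ℝ} (hx : 0 ≤ x) :
    |lampertiDelta α θ x| ≤ lampertiPoly α x ^ (-(θ / 2)) := by
  have hp := lampertiPoly_pos hα0 hα1 hx
  rw [lampertiDelta, abs_mul, abs_of_pos (by positivity : 0 < 1 / π), abs_div, Real.rpow_neg hp.le,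
    abs_of_pos (by positivity : 0 < lampertiPoly α x ^ (θ / 2)), ← one_div]
  have h1 : 1 / π ≤ 1 := by
    rw [div_le_one Real.pi_pos]; linarith [Real.pi_gt_three]
  have h2 := Real.abs_sin_le_one (π * θ * α * lampertiCDF α x)
  calc 1 / π * (|Real.sin (π * θ * α * lampertiCDF α x)| / lampertiPoly α x ^ (θ / 2))
      ≤ 1 * (1 / lampertiPoly α x ^ (θ / 2)) := by gcongr
    _ = _ := one_mul _

theorem abs_lampertiDelta_le_const (hα0 : 0 < α) (hα1 : α < 1) (hθ : 0 < θ) {x : ℝ} (hx : 0 ≤ x) :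
    |lampertiDelta α θ x| ≤ Real.sin (π * α) ^ (-θ) := by
  have hs := sin_pi_mul_pos hα0 hα1
  refine (abs_lampertiDelta_le hα0 hα1 hx).trans ?_
  calc _ ≤ (Real.sin (π * α) ^ 2) ^ (-(θ / 2)) :=
        Real.rpow_le_rpow_of_nonpos (by positivity) (sin_sq_le_lampertiPoly hx) (by linarith)
    _ = _ := by
      rw [← Real.rpow_two, ← Real.rpow_mul hs.le]
      ring_nf

theorem abs_lampertiDelta_le_rpow (hα0 : 0 < α) (hα1 : α < 1) (hθ : 0 < θ) {x : ℝ} (hx : 0 < x) :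
    |lampertiDelta α θ x| ≤ x ^ (-(α * θ)) * Real.sin (π * α) ^ (-θ) := by
  have hs := sin_pi_mul_pos hα0 hα1
  refine (abs_lampertiDelta_le hα0 hα1 hx.le).trans ?_
  calc _ ≤ ((x ^ α) ^ 2 * Real.sin (π * α) ^ 2) ^ (-(θ / 2)) :=
        Real.rpow_le_rpow_of_nonpos (by positivity) (rpow_mul_sin_sq_le_lampertiPoly hx.le)
          (by linarith)
    _ = _ := by
      rw [← mul_pow, ← Real.rpow_two, ← Real.rpow_mul (by positivity),
        Real.mul_rpow (by positivity) hs.le, ← Real.rpow_mul hx.le]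
      ring_nf

/-- `Δ` is bounded near `0` and of order `t^(-αθ)` at infinity, which the extra factor `1/t` makes
integrable. -/
theorem integrableOn_lampertiDelta_div (hα0 : 0 < α) (hα1 : α < 1) (hθ : 0 < θ) :
    IntegrableOn (fun t => lampertiDelta α θ t * (1 + t)⁻¹) (Ioi 0) := by
  have hm : Measurable fun t => lampertiDelta α θ t * (1 + t)⁻¹ :=
    measurable_lampertiDelta.mul (by fun_prop)
  have hs := sin_pi_mul_pos hα0 hα1
  rw [← Ioc_union_Ioi_eq_Ioi zero_le_one]
  refine IntegrableOn.union ?_ ?_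
  · refine Measure.integrableOn_of_bounded (M := Real.sin (π * α) ^ (-θ)) (by simp)
      hm.aestronglyMeasurable ?_
    filter_upwards [ae_restrict_mem measurableSet_Ioc] with t ht
    have h0 : 0 < t := ht.1
    rw [norm_mul]
    refine (mul_le_of_le_one_right (norm_nonneg _) ?_).trans
      (abs_lampertiDelta_le_const hα0 hα1 hθ h0.le)
    rw [Real.norm_of_nonneg (by positivity)]
    exact inv_le_one_of_one_le₀ (by linarith)
  · have hi : IntegrableOn (fun t : ℝ => t ^ (-(α * θ) - 1)) (Ioi 1) :=
      integrableOn_Ioi_rpow_of_lt (by nlinarith [mul_pos hα0 hθ]) one_pos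
    refine (hi.mul_const (Real.sin (π * α) ^ (-θ))).mono' hm.aestronglyMeasurable ?_
    filter_upwards [ae_restrict_mem measurableSet_Ioi] with t ht
    have h1 : 1 < t := ht
    have h0 : 0 < t := one_pos.trans h1
    rw [norm_mul, Real.norm_of_nonneg (by positivity : 0 ≤ (1 + t)⁻¹), Real.rpow_sub_one h0.ne',
      div_mul_eq_mul_div, div_eq_mul_inv]
    exact mul_le_mul (abs_lampertiDelta_le_rpow hα0 hα1 hθ h0)
      (inv_anti₀ h0 (by linarith)) (by positivity) (by positivity)

/-- The function `(1 + e ^ (α w)) ^ (-θ)`, holomorphic in the strip `|Im w| < π / α`. -/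
noncomputable def stripFun (α θ : ℝ) (w : ℂ) : ℂ := (1 + Complex.exp (α * w)) ^ (-(θ : ℂ))

/-- The imaginary part is `e^(Re v) sin(Im v)`, nonzero unless `v` is real, and then the value is
positive. -/
theorem one_add_exp_mem_slitPlane {v : ℂ} (hv : |v.im| < π) :
    1 + Complex.exp v ∈ Complex.slitPlane := by
  rw [Complex.mem_slitPlane_iff]
  by_cases h : v.im = 0
  · left
    simp only [Complex.add_re, Complex.one_re, Complex.exp_re, h, Real.cos_zero, mul_one]
    positivity
  · right
    simp only [Complex.add_im, Complex.one_im, Complex.exp_im, zero_add]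
    refine mul_ne_zero (Real.exp_pos _).ne' fun h0 => h ?_
    rw [abs_lt] at hv
    exact (Real.sin_eq_zero_iff_of_lt_of_lt hv.1 hv.2).1 h0

theorem norm_stripFun {w : ℂ} (hw : |α * w.im| < π) :
    ‖stripFun α θ w‖ = ‖1 + Complex.exp (α * w)‖ ^ (-θ) := by
  have h := one_add_exp_mem_slitPlane (v := α * w) (by simpa using hw)
  rw [stripFun, Complex.norm_cpow_of_ne_zero (Complex.slitPlane_ne_zero h)]
  simp

theorem differentiableAt_stripFun {w : ℂ} (hw : |α * w.im| < π) :
    DifferentiableAt ℂ (stripFun α θ) w := by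
  have h := one_add_exp_mem_slitPlane (v := α * w) (by simpa using hw)
  unfold stripFun
  exact DifferentiableAt.cpow_const (by fun_prop) h

/-- The boundary values of `stripFun` on the line `Im w = π`. -/
theorem stripFun_add_pi (hα0 : 0 < α) (hα1 : α < 1) (x : ℝ) :
    stripFun α θ (x + π * Complex.I) = (lampertiPoly α (Real.exp x) ^ (-(θ / 2)) : ℝ) *
      (Real.cos (π * θ * α * lampertiCDF α (Real.exp x)) -
        Real.sin (π * θ * α * lampertiCDF α (Real.exp x)) * Complex.I) := by
  have he := Real.exp_pos x
  have hp := lampertiPoly_pos hα0 hα1 he.le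
  have hb := lampertiCDF_bounds hα0 hα1 (Real.exp x)
  have h1 : (1 + Complex.exp (α * (x + π * Complex.I)) : ℂ) =
      (lampertiPoly α (Real.exp x) ^ (1 / 2 : ℝ) : ℝ) *
        Complex.exp ((π * α * lampertiCDF α (Real.exp x) : ℝ) * Complex.I) := by
    rw [Complex.exp_mul_I, ← Complex.ofReal_cos, ← Complex.ofReal_sin,
      ← one_add_rpow_mul_exp hα0 hα1 he.le, ← Real.exp_mul, Complex.ofReal_exp,
      ← Complex.exp_add]
    push_cast
    ring_nf
  have hr : 0 < lampertiPoly α (Real.exp x) ^ (1 / 2 : ℝ) := by positivity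
  have hlog : Complex.log (1 + Complex.exp (α * (x + π * Complex.I))) =
      (Real.log (lampertiPoly α (Real.exp x) ^ (1 / 2 : ℝ)) : ℝ) +
        (π * α * lampertiCDF α (Real.exp x) : ℝ) * Complex.I := by
    rw [h1, Complex.log_ofReal_mul hr (Complex.exp_ne_zero _), Complex.log_exp]
    · simpa using hb.1
    · simpa using hb.2.le
  have hne : (1 + Complex.exp (α * (x + π * Complex.I)) : ℂ) ≠ 0 := by
    rw [h1]
    exact mul_ne_zero (by exact_mod_cast hr.ne') (Complex.exp_ne_zero _)
  rw [stripFun, Complex.cpow_def_of_ne_zero hne, hlog, Real.log_rpow hp, add_mul, Complex.exp_add,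
    Real.rpow_def_of_pos hp, Complex.ofReal_exp]
  congr 1
  · congr 1
    push_cast
    ring
  · rw [show ((π * α * lampertiCDF α (Real.exp x) : ℝ) * Complex.I * -(θ : ℂ)) =
      (-(π * θ * α * lampertiCDF α (Real.exp x)) : ℝ) * Complex.I by push_cast; ring,
      Complex.exp_mul_I, ← Complex.ofReal_cos, ← Complex.ofReal_sin, Real.cos_neg, Real.sin_neg]
    push_cast
    ring

theorem stripFun_conj {w : ℂ} (hw : |α * w.im| < π) :
    stripFun α θ ((starRingEnd ℂ) w) = (starRingEnd ℂ) (stripFun α θ w) := by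
  have h := one_add_exp_mem_slitPlane (v := α * w) (by simpa using hw)
  have h1 : 1 + Complex.exp (α * (starRingEnd ℂ) w) =
      (starRingEnd ℂ) (1 + Complex.exp (α * w)) := by
    simp [← Complex.exp_conj]
  rw [stripFun, stripFun, h1, Complex.conj_cpow _ _ (Complex.slitPlane_arg_ne_pi h)]
  simp

/-- The values on the two edges are conjugate, so the jump is `-2i` times the imaginary part on the
upper edge. This is how `Δ` enters. -/
theorem stripFun_sub_pi_sub_add_pi (hα0 : 0 < α) (hα1 : α < 1) (x : ℝ) :
    stripFun α θ (x - π * Complex.I) - stripFun α θ (x + π * Complex.I) =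
      2 * π * Complex.I * lampertiDelta α θ (Real.exp x) := by
  have hp := lampertiPoly_pos hα0 hα1 (Real.exp_pos x).le
  have h : (x - π * Complex.I : ℂ) = (starRingEnd ℂ) (x + π * Complex.I) := by
    simp [sub_eq_add_neg]
  rw [h, stripFun_conj, stripFun_add_pi hα0 hα1, lampertiDelta,
    div_eq_mul_inv (Real.sin _), ← Real.rpow_neg hp.le]
  · have := Real.pi_ne_zero
    generalize Real.sin _ = S
    generalize Real.cos _ = C
    apply Complex.ext <;> simp
    field_simp
    ring
  · simp only [Complex.add_im, Complex.ofReal_im, Complex.mul_im, Complex.ofReal_re, Complex.I_im,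
      Complex.I_re, mul_zero, mul_one, zero_add, add_zero]
    rw [abs_of_pos (by positivity)]
    nlinarith [Real.pi_pos]

end Lamperti

/-! ### Contour integration over rectangles in the strip. -/

section Contour

variable {α θ : ℝ} {w₀ : ℂ}

/-- Rotation by `-Im w₀ / 2` places the two summands at opposite angles `∓ Im w₀ / 2`, where their
real parts add up. -/
theorem le_norm_add_exp {t : ℝ} :
    (t + Real.exp w₀.re) * Real.cos (w₀.im / 2) ≤ ‖(t : ℂ) + Complex.exp w₀‖ := by
  have h1 : ‖((t : ℂ) + Complex.exp w₀) * Complex.exp (((-(w₀.im / 2) : ℝ) : ℂ) * Complex.I)‖ =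
      ‖(t : ℂ) + Complex.exp w₀‖ := by
    rw [norm_mul, Complex.norm_exp_ofReal_mul_I, mul_one]
  rw [← h1]
  refine le_trans (le_of_eq ?_) (Complex.re_le_norm _)
  have h2 : Complex.exp w₀ * Complex.exp (((-(w₀.im / 2) : ℝ) : ℂ) * Complex.I) =
      Real.exp w₀.re * Complex.exp (((w₀.im / 2 : ℝ) : ℂ) * Complex.I) := by
    conv_lhs => rw [← Complex.re_add_im w₀]
    rw [Complex.ofReal_exp, ← Complex.exp_add, ← Complex.exp_add]
    congr 1
    apply Complex.ext
    · simp
    · simp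
      ring
  rw [add_mul (t : ℂ), h2, Complex.add_re, Complex.re_ofReal_mul, Complex.re_ofReal_mul,
    Complex.exp_ofReal_mul_I_re, Complex.exp_ofReal_mul_I_re, Real.cos_neg]
  ring

theorem cos_half_im_pos (hw : |w₀.im| < π) : 0 < Real.cos (w₀.im / 2) := by
  rw [abs_lt] at hw
  exact Real.cos_pos_of_mem_Ioo ⟨by linarith, by linarith⟩

theorem add_exp_ne_zero (hw : |w₀.im| < π) {t : ℝ} (ht : 0 ≤ t) :
    (t : ℂ) + Complex.exp w₀ ≠ 0 := by
  have h1 := cos_half_im_pos hw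
  have h2 := Real.exp_pos w₀.re
  exact norm_pos_iff.1 (lt_of_lt_of_le (by positivity) le_norm_add_exp)

theorem norm_inv_add_exp_le (hw : |w₀.im| < π) {t : ℝ} (ht : 0 ≤ t) :
    ‖((t : ℂ) + Complex.exp w₀)⁻¹‖ ≤
      (min 1 (Real.exp w₀.re) * Real.cos (w₀.im / 2))⁻¹ * (1 + t)⁻¹ := by
  have h1 := cos_half_im_pos hw
  have h2 := Real.exp_pos w₀.re
  rw [norm_inv, ← mul_inv]
  refine inv_anti₀ (by positivity) (le_trans ?_ le_norm_add_exp)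
  have h3 := min_le_left 1 (Real.exp w₀.re)
  have h4 := min_le_right 1 (Real.exp w₀.re)
  rw [mul_right_comm]
  refine mul_le_mul_of_nonneg_right ?_ h1.le
  nlinarith

theorem integrableOn_lampertiDelta_div_add_exp (hα0 : 0 < α) (hα1 : α < 1) (hθ : 0 < θ)
    (hw : |w₀.im| < π) :
    IntegrableOn (fun t : ℝ => (lampertiDelta α θ t : ℂ) * ((t : ℂ) + Complex.exp w₀)⁻¹)
      (Ioi 0) := by
  have hm := measurable_lampertiDelta (α := α) (θ := θ)
  refine ((integrableOn_lampertiDelta_div hα0 hα1 hθ).norm.const_mul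
    (min 1 (Real.exp w₀.re) * Real.cos (w₀.im / 2))⁻¹).mono'
    (by fun_prop : Measurable _).aestronglyMeasurable ?_
  filter_upwards [ae_restrict_mem measurableSet_Ioi] with t ht
  have ht : 0 < t := ht
  rw [norm_mul, norm_mul, Complex.norm_real, Real.norm_of_nonneg (by positivity : 0 ≤ (1 + t)⁻¹),
    mul_left_comm]
  exact mul_le_mul_of_nonneg_left (norm_inv_add_exp_le hw ht.le) (norm_nonneg _)

/-- The kernel whose contour integral represents `stripFun`. -/
noncomputable def stripKernel (α θ : ℝ) (w₀ w : ℂ) : ℂ :=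
  (stripFun α θ w - stripFun α θ w₀) * (Complex.exp w / (Complex.exp w - Complex.exp w₀))

/-- Off `w₀` the kernel is a quotient of difference slopes, which still makes sense at `w₀`: the
singularity is removable. -/
theorem stripKernel_eq_dslope {w : ℂ} (h : w ≠ w₀) :
    dslope (stripFun α θ) w₀ w * Complex.exp w / dslope Complex.exp w₀ w =
      stripKernel α θ w₀ w := by
  rw [dslope_of_ne _ h, dslope_of_ne _ h, slope_def_field, slope_def_field, stripKernel]
  have : w - w₀ ≠ 0 := sub_ne_zero.2 h
  rcases eq_or_ne (Complex.exp w - Complex.exp w₀) 0 with h0 | h0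
  · simp [h0]
  · field_simp

theorem abs_mul_im_lt (hα0 : 0 < α) (hα1 : α < 1) {w : ℂ} (hw : |w.im| ≤ π) :
    |α * w.im| < π := by
  rw [abs_mul, abs_of_pos hα0]
  nlinarith [Real.pi_pos, abs_nonneg w.im]

/-- The denominator could vanish only at another solution of `e^w = e^{w₀}`; such a point lies at
vertical distance at least `2π` from `w₀` or on its horizontal line at `w₀` itself, and the bound on
`|Im w|` rules out the former. At `w₀` the slope is `e^{w₀}`. -/
theorem differentiableOn_dslope_div (hα0 : 0 < α) (hα1 : α < 1) (hw : |w₀.im| < π) :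
    DifferentiableOn ℂ
      (fun w => dslope (stripFun α θ) w₀ w * Complex.exp w / dslope Complex.exp w₀ w)
      {w : ℂ | |α * w.im| < π ∧ |w.im| < 2 * π - |w₀.im|} := by
  set U : Set ℂ := {w : ℂ | |α * w.im| < π ∧ |w.im| < 2 * π - |w₀.im|} with hU
  have hUo : IsOpen U := by
    have h1 : Continuous fun w : ℂ => |α * w.im| := by fun_prop
    have h2 : Continuous fun w : ℂ => |w.im| := by fun_prop
    exact (isOpen_lt h1 continuous_const).inter (isOpen_lt h2 continuous_const)
  have hmem : U ∈ 𝓝 w₀ := hUo.mem_nhds ⟨abs_mul_im_lt hα0 hα1 hw.le, by linarith⟩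
  refine DifferentiableOn.div (DifferentiableOn.mul ?_ Complex.differentiable_exp.differentiableOn)
    ?_ ?_
  · exact (Complex.differentiableOn_dslope hmem).2 fun w h =>
      (differentiableAt_stripFun h.1).differentiableWithinAt
  · exact (Complex.differentiableOn_dslope hmem).2 Complex.differentiable_exp.differentiableOn
  · intro w h
    rcases eq_or_ne w w₀ with rfl | hne
    · rw [dslope_same, Complex.deriv_exp]
      exact Complex.exp_ne_zero _
    · rw [dslope_of_ne _ hne, slope_def_field]
      refine div_ne_zero (sub_ne_zero.2 fun he => hne ?_) (sub_ne_zero.2 hne)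
      obtain ⟨n, hn⟩ := Complex.exp_eq_exp_iff_exists_int.1 he
      have him : w.im = w₀.im + n * (2 * π) := by
        rw [hn]; simp
      have hlt : |(n : ℝ) * (2 * π)| < 2 * π := by
        have : (n : ℝ) * (2 * π) = w.im - w₀.im := by linarith
        rw [this]
        have := abs_sub w.im w₀.im
        linarith [h.2]
      rw [abs_mul, abs_of_pos Real.two_pi_pos, mul_lt_iff_lt_one_left Real.two_pi_pos] at hlt
      have hn0 : n = 0 := Int.abs_lt_one_iff.1 (by exact_mod_cast hlt)
      rw [hn, hn0]; simp

/-- Cauchy's theorem on `[-R, R] × [-π, π]`. The closed rectangle lies in the domain of holomorphy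
because `α < 1` and `|Im w₀| < π`, and `w₀` is off the boundary, so the kernel may be written there
without slopes. -/
theorem stripKernel_integral (hα0 : 0 < α) (hα1 : α < 1) (hw : |w₀.im| < π) {R : ℝ}
    (hR : |w₀.re| < R) :
    (∫ x : ℝ in -R..R, stripKernel α θ w₀ (x - π * Complex.I) -
        stripKernel α θ w₀ (x + π * Complex.I)) +
      Complex.I * (∫ y : ℝ in -π..π, stripKernel α θ w₀ (R + y * Complex.I)) -
      Complex.I * (∫ y : ℝ in -π..π, stripKernel α θ w₀ (-R + y * Complex.I)) = 0 := by
  have hπ := Real.pi_pos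
  set K : ℂ → ℂ := fun w =>
    dslope (stripFun α θ) w₀ w * Complex.exp w / dslope Complex.exp w₀ w with hK
  have hd : DifferentiableOn ℂ K {w : ℂ | |α * w.im| < π ∧ |w.im| < 2 * π - |w₀.im|} :=
    differentiableOn_dslope_div hα0 hα1 hw
  have hin : ∀ w : ℂ, |w.im| ≤ π → w ∈ {w : ℂ | |α * w.im| < π ∧ |w.im| < 2 * π - |w₀.im|} :=
    fun w h => ⟨abs_mul_im_lt hα0 hα1 h, by linarith⟩
  have hline : ∀ s : ℝ, |s| ≤ π → Continuous fun x : ℝ => K (x + s * Complex.I) := fun s hs =>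
    hd.continuousOn.comp_continuous (by fun_prop) fun x => hin _ (by simpa using hs)
  have hrect := Complex.integral_boundary_rect_eq_zero_of_differentiableOn K
    (-R - π * Complex.I) (R + π * Complex.I) (hd.mono fun w h => hin w ?_)
  · have re1 : (-R - π * Complex.I : ℂ).re = -R := by simp
    have re2 : (R + π * Complex.I : ℂ).re = R := by simp
    have im1 : (-R - π * Complex.I : ℂ).im = -π := by simp
    have im2 : (R + π * Complex.I : ℂ).im = π := by simp
    rw [re1, re2, im1, im2, ← intervalIntegral.integral_sub
      ((hline (-π) (by simp [abs_of_pos hπ])).intervalIntegrable _ _)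
      ((hline π (by simp [abs_of_pos hπ])).intervalIntegrable _ _)] at hrect
    have hne1 : ∀ (x s : ℝ), |s| = π → (x + s * Complex.I : ℂ) ≠ w₀ := by
      intro x s hs h
      rw [← h] at hw
      simp [hs] at hw
    have hne2 : ∀ (x y : ℝ), |x| = R → (x + y * Complex.I : ℂ) ≠ w₀ := by
      intro x s hs h
      rw [← h] at hR
      simp [hs] at hR
    have hR0 : 0 < R := (abs_nonneg _).trans_lt hR
    simp_rw [hK, stripKernel_eq_dslope (hne1 _ (-π) (by simp [abs_of_pos hπ])),
      stripKernel_eq_dslope (hne1 _ π (abs_of_pos hπ)),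
      stripKernel_eq_dslope (hne2 R _ (abs_of_pos hR0)),
      stripKernel_eq_dslope (hne2 (-R) _ (by simp [abs_of_pos hR0])), smul_eq_mul] at hrect
    push_cast at hrect
    simp only [neg_mul, ← sub_eq_add_neg] at hrect
    exact hrect
  · have h2 := h.2
    simp only [mem_preimage, Complex.sub_im, Complex.neg_im, Complex.ofReal_im, Complex.mul_im,
      Complex.ofReal_re, Complex.I_im, mul_one, Complex.I_re, mul_zero, add_zero, neg_zero,
      zero_sub, Complex.add_im, zero_add] at h2
    rw [uIcc_of_le (by linarith)] at h2
    exact abs_le.2 h2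

/-- Both edges have `e^w = -e^x`, and the constant `stripFun α θ w₀` cancels; what remains is the
jump times a Stieltjes kernel. -/
theorem stripKernel_sub (hα0 : 0 < α) (hα1 : α < 1) (x : ℝ) :
    stripKernel α θ w₀ (x - π * Complex.I) - stripKernel α θ w₀ (x + π * Complex.I) =
      2 * π * Complex.I * (Real.exp x • ((lampertiDelta α θ (Real.exp x) : ℂ) *
        ((Real.exp x : ℂ) + Complex.exp w₀)⁻¹)) := by
  have e1 : Complex.exp (x - π * Complex.I) = -Complex.exp x := by
    rw [Complex.exp_sub, Complex.exp_pi_mul_I, div_neg, div_one]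
  have e2 : Complex.exp (x + π * Complex.I) = -Complex.exp x := by
    rw [Complex.exp_add, Complex.exp_pi_mul_I, mul_neg, mul_one]
  rw [stripKernel, stripKernel, e1, e2, ← sub_mul, sub_sub_sub_cancel_right,
    stripFun_sub_pi_sub_add_pi hα0 hα1, ← neg_add', neg_div_neg_eq, Complex.real_smul,
    Complex.ofReal_exp]
  ring

/-- Reverse triangle inequality for `1 + e^{αw}`; the bound is uniform in `Im w` and controls both
vertical sides. -/
theorem norm_stripFun_le (hα0 : 0 < α) (hα1 : α < 1) (hθ : 0 < θ) {w : ℂ}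
    (hw : |w.im| ≤ π) {δ : ℝ} (hδ : 0 < δ) (h : δ ≤ |Real.exp (α * w.re) - 1|) :
    ‖stripFun α θ w‖ ≤ δ ^ (-θ) := by
  rw [norm_stripFun (abs_mul_im_lt hα0 hα1 hw)]
  refine Real.rpow_le_rpow_of_nonpos hδ (h.trans ?_) (by linarith)
  have h1 := abs_norm_sub_norm_le (Complex.exp (α * w)) (-1)
  rw [Complex.norm_exp, norm_neg, norm_one, sub_neg_eq_add, add_comm] at h1
  simpa using h1

end Contour

section ContourLimit

variable {α θ : ℝ} {w₀ : ℂ}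

/-- To the right `stripFun` decays and the exponential quotient tends to `1`, so the kernel tends to
`-stripFun α θ w₀`: this side carries the value to be represented. -/
theorem tendsto_stripKernel_right (hα0 : 0 < α) (hα1 : α < 1) (hθ : 0 < θ) :
    Tendsto (fun R : ℝ => ∫ y : ℝ in -π..π, (stripKernel α θ w₀ (R + y * Complex.I) +
      stripFun α θ w₀)) atTop (𝓝 0) := by
  have hπ := Real.pi_pos
  have hexp : Tendsto (fun R : ℝ => Real.exp (α * R) - 1) atTop atTop :=
    tendsto_atTop_add_const_right _ _
      (Real.tendsto_exp_atTop.comp (tendsto_id.const_mul_atTop hα0))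
  have hlim : Tendsto (fun R : ℝ => (2 * (Real.exp (α * R) - 1) ^ (-θ) +
      ‖stripFun α θ w₀‖ * (2 * Real.exp w₀.re * Real.exp (-R))) * |π - -π|) atTop (𝓝 0) := by
    have h1 := ((tendsto_rpow_neg_atTop hθ).comp hexp).const_mul 2
    have h2 := (Real.tendsto_exp_neg_atTop_nhds_zero.const_mul
      (2 * Real.exp w₀.re)).const_mul ‖stripFun α θ w₀‖
    simpa using (h1.add h2).mul_const |π - -π|
  refine squeeze_zero_norm' ?_ hlim
  filter_upwards [hexp.eventually_gt_atTop 0,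
    Real.tendsto_exp_atTop.eventually_ge_atTop (2 * Real.exp w₀.re)] with R h1 h2
  refine intervalIntegral.norm_integral_le_of_norm_le_const fun y hy => ?_
  rw [uIoc_of_le (by linarith)] at hy
  have hy' : |y| ≤ π := abs_le.2 ⟨hy.1.le, hy.2⟩
  set w : ℂ := R + y * Complex.I with hw
  have hre : w.re = R := by simp [hw]
  have him : w.im = y := by simp [hw]
  have ha := Real.exp_pos w₀.re
  have hR := Real.exp_pos R
  have hsub : Real.exp R / 2 ≤ ‖Complex.exp w - Complex.exp w₀‖ := by
    have := norm_sub_norm_le (Complex.exp w) (Complex.exp w₀)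
    rw [Complex.norm_exp, Complex.norm_exp, hre] at this
    linarith
  have hne : Complex.exp w - Complex.exp w₀ ≠ 0 :=
    norm_pos_iff.1 (lt_of_lt_of_le (by positivity) hsub)
  have hinv : ‖Complex.exp w - Complex.exp w₀‖⁻¹ ≤ 2 * Real.exp (-R) := by
    rw [Real.exp_neg]
    calc _ ≤ (Real.exp R / 2)⁻¹ := inv_anti₀ (by positivity) hsub
      _ = _ := by field_simp
  have hg : ‖stripFun α θ w‖ ≤ (Real.exp (α * R) - 1) ^ (-θ) :=
    norm_stripFun_le hα0 hα1 hθ (him ▸ hy') h1 (by rw [hre]; exact le_abs_self _)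
  have e : stripKernel α θ w₀ w + stripFun α θ w₀ =
      stripFun α θ w * (Complex.exp w * (Complex.exp w - Complex.exp w₀)⁻¹) -
        stripFun α θ w₀ * (Complex.exp w₀ * (Complex.exp w - Complex.exp w₀)⁻¹) := by
    rw [stripKernel]
    field_simp
    ring
  rw [e]
  refine (norm_sub_le _ _).trans (add_le_add ?_ ?_)
  · rw [norm_mul, norm_mul, norm_inv, Complex.norm_exp, hre, mul_comm]
    refine mul_le_mul ?_ hg (norm_nonneg _) zero_le_two
    calc _ ≤ Real.exp R * (2 * Real.exp (-R)) := by gcongr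
      _ = 2 := by rw [mul_left_comm, ← Real.exp_add]; simp
  · rw [norm_mul, norm_mul, norm_inv, Complex.norm_exp, mul_comm 2, mul_assoc]
    gcongr

/-- To the left `e^w` tends to `0` while `stripFun` stays bounded, so nothing is contributed. -/
theorem tendsto_stripKernel_left (hα0 : 0 < α) (hα1 : α < 1) (hθ : 0 < θ) :
    Tendsto (fun R : ℝ => ∫ y : ℝ in -π..π, stripKernel α θ w₀ (-R + y * Complex.I))
      atTop (𝓝 0) := by
  have hπ := Real.pi_pos
  have hexp : Tendsto (fun R : ℝ => Real.exp (-(α * R))) atTop (𝓝 0) :=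
    Real.tendsto_exp_neg_atTop_nhds_zero.comp (tendsto_id.const_mul_atTop hα0)
  have hlim : Tendsto (fun R : ℝ => (((1 / 2 : ℝ) ^ (-θ) + ‖stripFun α θ w₀‖) *
      (2 * Real.exp (-w₀.re) * Real.exp (-R))) * |π - -π|) atTop (𝓝 0) := by
    have h2 := (Real.tendsto_exp_neg_atTop_nhds_zero.const_mul
      (2 * Real.exp (-w₀.re))).const_mul ((1 / 2 : ℝ) ^ (-θ) + ‖stripFun α θ w₀‖)
    simpa using h2.mul_const |π - -π|
  refine squeeze_zero_norm' ?_ hlim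
  have ha := Real.exp_pos w₀.re
  filter_upwards [hexp.eventually_le_const (by norm_num : (0 : ℝ) < 1 / 2),
    Real.tendsto_exp_neg_atTop_nhds_zero.eventually_le_const
      (by positivity : 0 < Real.exp w₀.re / 2)] with R h1 h2
  refine intervalIntegral.norm_integral_le_of_norm_le_const fun y hy => ?_
  rw [uIoc_of_le (by linarith)] at hy
  have hy' : |y| ≤ π := abs_le.2 ⟨hy.1.le, hy.2⟩
  set w : ℂ := -R + y * Complex.I with hw
  have hre : w.re = -R := by simp [hw]
  have him : w.im = y := by simp [hw]
  have hsub : Real.exp w₀.re / 2 ≤ ‖Complex.exp w - Complex.exp w₀‖ := by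
    have := norm_sub_norm_le (Complex.exp w₀) (Complex.exp w)
    rw [Complex.norm_exp, Complex.norm_exp, hre, norm_sub_rev] at this
    linarith
  have hinv : ‖Complex.exp w - Complex.exp w₀‖⁻¹ ≤ 2 * Real.exp (-w₀.re) := by
    rw [Real.exp_neg]
    calc _ ≤ (Real.exp w₀.re / 2)⁻¹ := inv_anti₀ (by positivity) hsub
      _ = _ := by field_simp
  have hg : ‖stripFun α θ w‖ ≤ (1 / 2 : ℝ) ^ (-θ) := by
    refine norm_stripFun_le hα0 hα1 hθ (him ▸ hy') (by norm_num) ?_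
    rw [hre, mul_neg, abs_sub_comm]
    exact le_trans (by linarith) (le_abs_self _)
  rw [stripKernel, norm_mul, div_eq_mul_inv, norm_mul, norm_inv, Complex.norm_exp w, hre,
    mul_comm (Real.exp (-R))]
  have := norm_sub_le (stripFun α θ w) (stripFun α θ w₀)
  gcongr
  linarith

/-- The Stieltjes transform of `lampertiDelta`. -/
theorem integral_lampertiDelta_div_add_exp (hα0 : 0 < α) (hα1 : α < 1) (hθ : 0 < θ)
    (hw : |w₀.im| < π) :
    ∫ t in Ioi (0 : ℝ), (lampertiDelta α θ t : ℂ) * ((t : ℂ) + Complex.exp w₀)⁻¹ =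
      stripFun α θ w₀ := by
  have hπ := Real.pi_pos
  set h : ℝ → ℂ := fun t => (lampertiDelta α θ t : ℂ) * ((t : ℂ) + Complex.exp w₀)⁻¹ with hh
  have hi : IntegrableOn h (Ioi 0) := integrableOn_lampertiDelta_div_add_exp hα0 hα1 hθ hw
  -- The substitution `t = e^x` turns the integral over `(0, ∞)` into one along the horizontal
  -- edges.
  have hder : ∀ x ∈ (univ : Set ℝ), HasDerivWithinAt Real.exp (Real.exp x) univ x := fun x _ =>
    (Real.hasDerivAt_exp x).hasDerivWithinAt
  have hinj : InjOn Real.exp univ := Real.exp_injective.injOn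
  have himg : Real.exp '' univ = Ioi 0 := by rw [image_univ, Real.range_exp]
  have hi2 := (integrableOn_image_iff_integrableOn_abs_deriv_smul MeasurableSet.univ hder hinj
    h).1 (himg ▸ hi)
  have he := integral_image_eq_integral_abs_deriv_smul MeasurableSet.univ hder hinj h
  simp only [abs_of_pos (Real.exp_pos _), integrableOn_univ, himg, Measure.restrict_univ]
    at hi2 he
  have hJ := intervalIntegral_tendsto_integral hi2 tendsto_neg_atTop_atBot tendsto_id
  rw [← he] at hJ
  have hA := tendsto_stripKernel_right (w₀ := w₀) hα0 hα1 hθ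
  have hB := tendsto_stripKernel_left (w₀ := w₀) hα0 hα1 hθ
  have hT := ((hJ.const_mul (2 * π * Complex.I)).add (hA.const_mul Complex.I)).sub
    (hB.const_mul Complex.I)
  rw [mul_zero, add_zero, sub_zero] at hT
  have hev : ∀ᶠ R : ℝ in atTop, (2 * π * Complex.I * ∫ x in -R..R, Real.exp x • h (Real.exp x)) +
      Complex.I * (∫ y : ℝ in -π..π, (stripKernel α θ w₀ (R + y * Complex.I) +
        stripFun α θ w₀)) -
      Complex.I * (∫ y : ℝ in -π..π, stripKernel α θ w₀ (-R + y * Complex.I)) =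
        2 * π * Complex.I * stripFun α θ w₀ := by
    filter_upwards [eventually_gt_atTop |w₀.re|] with R hR
    have hk := stripKernel_integral (θ := θ) hα0 hα1 hw hR
    simp_rw [stripKernel_sub hα0 hα1] at hk
    rw [intervalIntegral.integral_const_mul] at hk
    have hint : IntervalIntegrable (fun y : ℝ => stripKernel α θ w₀ (R + y * Complex.I)) volume
        (-π) π := by
      refine ContinuousOn.intervalIntegrable fun y hy => ContinuousAt.continuousWithinAt ?_
      rw [uIcc_of_le (by linarith)] at hy
      have hd : DifferentiableAt ℂ (stripKernel α θ w₀) (R + y * Complex.I) := by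
        have h1 : DifferentiableAt ℂ (stripFun α θ) (R + y * Complex.I) :=
          differentiableAt_stripFun (abs_mul_im_lt hα0 hα1 (by simpa using abs_le.2 hy))
        unfold stripKernel
        refine (h1.sub_const _).mul (Complex.differentiableAt_exp.div
          (Complex.differentiableAt_exp.sub_const _) ?_)
        refine sub_ne_zero.2 fun h0 => ?_
        have := congrArg norm h0
        rw [Complex.norm_exp, Complex.norm_exp, Real.exp_eq_exp] at this
        simp only [Complex.add_re, Complex.ofReal_re, Complex.mul_re, Complex.I_re, mul_zero,
          Complex.ofReal_im, Complex.I_im, mul_one, sub_self, add_zero] at this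
        rw [← this] at hR
        exact absurd hR (not_lt.2 (le_abs_self R))
      exact ContinuousAt.comp (f := fun y : ℝ => (R + y * Complex.I : ℂ)) hd.continuousAt
        (by fun_prop)
    rw [intervalIntegral.integral_add hint intervalIntegrable_const,
      intervalIntegral.integral_const]
    -- The length `2π` of the vertical side matches the factor `2πi` of the jump.
    have e2 : ((π - -π) • stripFun α θ w₀ : ℂ) = 2 * π * stripFun α θ w₀ := by
      rw [Complex.real_smul]
      push_cast
      ring
    rw [e2]
    linear_combination hk
  have hfin := tendsto_nhds_unique (hT.congr' hev) tendsto_const_nhds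
  exact mul_left_cancel₀ (by simp [Real.pi_ne_zero]) hfin

end ContourLimit

/-! ### The law `ϱ_α`: distribution function and Stieltjes transform. -/

section LampertiLaw

variable {α θ : ℝ}

theorem measurable_lampertiDensity : Measurable (lampertiDensity α) := by
  have := measurable_lampertiPoly (α := α)
  unfold lampertiDensity
  fun_prop

theorem lampertiDensity_nonneg (hα0 : 0 < α) (hα1 : α < 1) {x : ℝ} (hx : 0 ≤ x) :
    0 ≤ lampertiDensity α x := by
  have := sin_pi_mul_pos hα0 hα1
  have := lampertiPoly_pos hα0 hα1 hx
  unfold lampertiDensity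
  positivity

theorem hasDerivAt_lampertiCDF (hα0 : 0 < α) (hα1 : α < 1) {x : ℝ} (hx : 0 < x) :
    HasDerivAt (lampertiCDF α) (lampertiDensity α x) x := by
  have hs := sin_pi_mul_pos hα0 hα1
  have hp := lampertiPoly_pos hα0 hα1 hx.le
  have h1 : HasDerivAt (fun x : ℝ => x ^ α) (α * x ^ (α - 1)) x :=
    Real.hasDerivAt_rpow_const (Or.inl hx.ne')
  have h2 := (((((h1.div_const (Real.sin (π * α))).const_add (Real.cot (π * α))).arctan).const_sub
    (π / 2)).const_mul (1 / (π * α))).const_sub 1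
  have h3 : HasDerivAt (lampertiCDF α) _ x := h2
  refine h3.congr_deriv ?_
  have e : 1 + (Real.cot (π * α) + x ^ α / Real.sin (π * α)) ^ 2 =
      lampertiPoly α x / Real.sin (π * α) ^ 2 := by
    rw [lampertiPoly_eq hx.le, Real.cot_eq_cos_div_sin]
    field_simp
    ring
  rw [e, lampertiDensity]
  field_simp

theorem continuous_lampertiCDF (hα0 : 0 < α) : Continuous (lampertiCDF α) := by
  have h1 : Continuous fun x : ℝ => x ^ α := Real.continuous_rpow_const hα0.le
  have h2 := Real.continuous_arctan
  unfold lampertiCDF arccot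
  fun_prop

theorem lampertiCDF_zero (hα0 : 0 < α) (hα1 : α < 1) : lampertiCDF α 0 = 0 := by
  have hs := sin_pi_mul_pos hα0 hα1
  have hπ := Real.pi_pos
  have : Real.cot (π * α) = Real.tan (π / 2 - π * α) := by
    rw [Real.tan_pi_div_two_sub, Real.cot_eq_cos_div_sin, Real.tan_eq_sin_div_cos, inv_div]
  rw [lampertiCDF, arccot, Real.zero_rpow hα0.ne', zero_div, add_zero, this,
    Real.arctan_tan (by nlinarith) (by nlinarith)]
  field_simp
  ring

theorem tendsto_lampertiCDF (hα0 : 0 < α) (hα1 : α < 1) :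
    Tendsto (lampertiCDF α) atTop (𝓝 1) := by
  have hs := sin_pi_mul_pos hα0 hα1
  have h1 : Tendsto (fun x : ℝ => Real.cot (π * α) + x ^ α / Real.sin (π * α)) atTop atTop :=
    tendsto_atTop_add_const_left _ _ ((tendsto_rpow_atTop hα0).atTop_div_const hs)
  have h2 := (Real.tendsto_arctan_atTop.mono_right nhdsWithin_le_nhds).comp h1
  have h3 := ((h2.const_sub (π / 2)).const_mul (1 / (π * α))).const_sub 1
  rw [sub_self, mul_zero, sub_zero] at h3
  exact h3

theorem integrableOn_lampertiDensity (hα0 : 0 < α) (hα1 : α < 1) :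
    IntegrableOn (lampertiDensity α) (Ioi 0) :=
  integrableOn_Ioi_deriv_of_nonneg (continuous_lampertiCDF hα0).continuousWithinAt
    (fun _ hx => hasDerivAt_lampertiCDF hα0 hα1 hx)
    (fun _ hx => lampertiDensity_nonneg hα0 hα1 (le_of_lt hx)) (tendsto_lampertiCDF hα0 hα1)

theorem isProbabilityMeasure_lampertiLaw (hα0 : 0 < α) (hα1 : α < 1) :
    IsProbabilityMeasure (lampertiLaw α) := by
  constructor
  rw [lampertiLaw, withDensity_apply _ MeasurableSet.univ, Measure.restrict_univ,
    ← ofReal_integral_eq_lintegral_ofReal (integrableOn_lampertiDensity hα0 hα1)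
      ((ae_restrict_mem measurableSet_Ioi).mono fun x hx =>
        lampertiDensity_nonneg hα0 hα1 (le_of_lt hx)),
    integral_Ioi_of_hasDerivAt_of_nonneg (continuous_lampertiCDF hα0).continuousWithinAt
    (fun _ hx => hasDerivAt_lampertiCDF hα0 hα1 hx)
    (fun _ hx => lampertiDensity_nonneg hα0 hα1 (le_of_lt hx)) (tendsto_lampertiCDF hα0 hα1),
    lampertiCDF_zero hα0 hα1]
  simp

theorem lampertiLaw_real_Iic (hα0 : 0 < α) (hα1 : α < 1) {x : ℝ} (hx : 0 ≤ x) :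
    (lampertiLaw α).real (Iic x) = lampertiCDF α x := by
  rw [measureReal_def, lampertiLaw, withDensity_apply _ measurableSet_Iic,
    Measure.restrict_restrict measurableSet_Iic, inter_comm, Ioi_inter_Iic,
    ← ofReal_integral_eq_lintegral_ofReal
      ((integrableOn_lampertiDensity hα0 hα1).mono_set Ioc_subset_Ioi_self)
      ((ae_restrict_mem measurableSet_Ioc).mono fun y hy =>
        lampertiDensity_nonneg hα0 hα1 hy.1.le),
    ENNReal.toReal_ofReal (setIntegral_nonneg measurableSet_Ioc fun y hy =>
        lampertiDensity_nonneg hα0 hα1 hy.1.le),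
    ← intervalIntegral.integral_of_le hx,
    intervalIntegral.integral_eq_sub_of_hasDerivAt_of_le hx
      (continuous_lampertiCDF hα0).continuousOn
      (fun y hy => hasDerivAt_lampertiCDF hα0 hα1 hy.1)
      ((intervalIntegrable_iff_integrableOn_Ioc_of_le hx).2
        ((integrableOn_lampertiDensity hα0 hα1).mono_set Ioc_subset_Ioi_self)),
    lampertiCDF_zero hα0 hα1, sub_zero]

theorem lampertiLaw_pos : ∀ᵐ x ∂lampertiLaw α, 0 < x :=
  (withDensity_absolutelyContinuous _ _).ae_le (ae_restrict_mem measurableSet_Ioi)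

theorem lampertiLaw_Iic_zero : lampertiLaw α (Iic 0) = 0 := by
  have := lampertiLaw_pos (α := α)
  rw [ae_iff] at this
  simpa [not_lt, Iic_def] using this

theorem lampertiLaw_ae_ne (x : ℝ) : ∀ᵐ y ∂lampertiLaw α, y ≠ x :=
  (withDensity_absolutelyContinuous _ _).ae_le (ae_restrict_of_ae (Measure.ae_ne volume x))

/-- Imaginary parts in the polar form give `P^{1/2} sin(π α F) = t^α sin(πα)`, with `P` the
polynomial. Hence the contour formula at `θ = 1` is the Stieltjes transform of `ϱ_α`. -/
theorem lampertiDelta_one (hα0 : 0 < α) (hα1 : α < 1) {t : ℝ} (ht : 0 < t) :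
    lampertiDelta α 1 t = lampertiDensity α t * t := by
  have h := congrArg Complex.im (one_add_rpow_mul_exp hα0 hα1 ht.le)
  have hp := lampertiPoly_pos hα0 hα1 ht.le
  have hexp : Complex.exp (π * α * Complex.I) =
      Real.cos (π * α) + Real.sin (π * α) * Complex.I := by
    rw [Complex.exp_mul_I]
    push_cast
    ring
  have hq : lampertiPoly α t ^ (1 / 2 : ℝ) * lampertiPoly α t ^ (1 / 2 : ℝ) = lampertiPoly α t := by
    rw [← Real.rpow_add hp]
    norm_num
  have hq0 : 0 < lampertiPoly α t ^ (1 / 2 : ℝ) := by positivity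
  rw [hexp] at h
  rw [lampertiDelta, lampertiDensity, Real.rpow_sub_one ht.ne', mul_one]
  generalize Real.sin (π * α * lampertiCDF α t) = S at h ⊢
  generalize Real.cos (π * α * lampertiCDF α t) = C at h ⊢
  generalize Real.sin (π * α) = S' at h ⊢
  generalize Real.cos (π * α) = C' at h ⊢
  simp at h
  generalize lampertiPoly α t = p at *
  have e : 1 / 2 = (2 : ℝ)⁻¹ := by norm_num
  rw [e] at hq hq0 ⊢
  generalize p ^ (2 : ℝ)⁻¹ = q at *
  field_simp
  linear_combination -q * h - S * hq

theorem integral_lampertiLaw {E : Type*} [NormedAddCommGroup E] [NormedSpace ℝ E] (hα0 : 0 < α)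
    (hα1 : α < 1) (g : ℝ → E) :
    ∫ y, g y ∂lampertiLaw α = ∫ y in Ioi 0, lampertiDensity α y • g y := by
  have hm := measurable_lampertiDensity (α := α)
  rw [lampertiLaw, integral_withDensity_eq_integral_toReal_smul (by fun_prop) (by simp)]
  refine setIntegral_congr_fun measurableSet_Ioi fun y hy => ?_
  simp only [ENNReal.toReal_ofReal (lampertiDensity_nonneg hα0 hα1 (le_of_lt hy))]

/-- The Stieltjes transform of `ϱ_α`. -/
theorem integral_lampertiLaw_div_add_exp (hα0 : 0 < α) (hα1 : α < 1) {w : ℂ} (hw : |w.im| < π) :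
    ∫ y : ℝ, (y : ℂ) * ((y : ℂ) + Complex.exp w)⁻¹ ∂lampertiLaw α =
      (1 + Complex.exp (α * w))⁻¹ := by
  have h := integral_lampertiDelta_div_add_exp hα0 hα1 one_pos hw
  rw [stripFun, Complex.ofReal_one, Complex.cpow_neg_one] at h
  rw [← h, integral_lampertiLaw hα0 hα1]
  refine setIntegral_congr_fun measurableSet_Ioi fun y hy => ?_
  simp only [lampertiDelta_one hα0 hα1 hy, Complex.real_smul]
  push_cast
  ring

end LampertiLaw

/-! ### Logarithmic transform and logarithmic potential of `ϱ_α`. -/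

section LogTransform

variable {α θ : ℝ} {v : ℂ}

theorem norm_inv_add_exp_le' {w : ℂ} (hw : |w.im| < π) {t : ℝ} (ht : 0 ≤ t) :
    ‖((t : ℂ) + Complex.exp w)⁻¹‖ ≤ (Real.cos (w.im / 2))⁻¹ * (t + Real.exp w.re)⁻¹ := by
  have h1 := cos_half_im_pos hw
  have h2 := Real.exp_pos w.re
  rw [norm_inv, ← mul_inv, mul_comm]
  exact inv_anti₀ (by positivity) le_norm_add_exp

theorem one_add_exp_add_mem_slitPlane (hv : |v.im| < π) (s : ℝ) :
    1 + Complex.exp (v + s) ∈ Complex.slitPlane :=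
  one_add_exp_mem_slitPlane (by simpa using hv)

/-- The form with `-v - s` matches the Stieltjes transform at `e^(-v-s)`. It is used with
coefficient `1` for the kernel and with `α` for the integrated result. -/
theorem hasDerivAt_log_one_add_exp {α : ℝ} (hv : |(α * v).im| < π) (s : ℝ) :
    HasDerivAt (fun s : ℝ => Complex.log (1 + Complex.exp (α * (v + s))))
      (α * (1 + Complex.exp (α * (-v - s)))⁻¹) s := by
  have hs : 1 + Complex.exp (α * (v + s)) ∈ Complex.slitPlane := by
    have := one_add_exp_add_mem_slitPlane hv (α * s)
    rwa [Complex.ofReal_mul, ← mul_add] at this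
  have h1 : HasDerivAt (fun s : ℝ => (α * (v + s) : ℂ)) α s := by
    simpa using ((Complex.ofRealCLM.hasDerivAt (x := s)).const_add v).const_mul (α : ℂ)
  have h2 := ((h1.cexp).const_add 1).clog_real hs
  refine h2.congr_deriv ?_
  have e : Complex.exp (α * (-v - s)) = (Complex.exp (α * (v + s)))⁻¹ := by
    rw [← Complex.exp_neg]
    congr 1
    ring
  have h0 := Complex.exp_ne_zero (α * (v + s))
  have h3 := Complex.slitPlane_ne_zero hs
  rw [e]
  generalize Complex.exp (α * (v + s)) = z at *
  have h4 : 1 + z⁻¹ ≠ 0 := by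
    have h5 : z * (1 + z⁻¹) = 1 + z := by field_simp; ring
    exact right_ne_zero_of_mul (h5 ▸ h3)
  have h5 : z + 1 ≠ 0 := by rwa [add_comm]
  field_simp
  ring

theorem tendsto_log_one_add_exp {α : ℝ} (hα : 0 < α) :
    Tendsto (fun s : ℝ => Complex.log (1 + Complex.exp (α * (v + s)))) atBot (𝓝 0) := by
  have h1 : Tendsto (fun s : ℝ => Complex.exp (α * (v + s))) atBot (𝓝 0) := by
    rw [tendsto_zero_iff_norm_tendsto_zero]
    simp_rw [Complex.norm_exp]
    refine Real.tendsto_exp_atBot.comp ?_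
    have : ∀ s : ℝ, ((α : ℂ) * (v + s)).re = α * (v.re + s) := fun s => by simp
    simp_rw [this]
    exact (tendsto_atBot_add_const_left _ _ tendsto_id).const_mul_atBot hα
  have h2 := h1.const_add 1
  rw [add_zero] at h2
  have h3 := h2.clog (Or.inl (by simp))
  rwa [Complex.log_one] at h3

theorem exp_neg_sub_im {s : ℝ} : (-v - s : ℂ).im = -v.im := by simp

theorem norm_mul_inv_add_exp_le (hv : |v.im| < π) {y : ℝ} (hy : 0 < y) (s : ℝ) :
    ‖(y : ℂ) * ((y : ℂ) + Complex.exp (-v - s))⁻¹‖ ≤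
      (Real.cos (v.im / 2))⁻¹ * (y * (y + Real.exp (-v.re - s))⁻¹) := by
  have h := norm_inv_add_exp_le' (w := -v - s) (by simpa using hv) hy.le
  rw [exp_neg_sub_im, neg_div, Real.cos_neg] at h
  rw [norm_mul, Complex.norm_real, Real.norm_of_nonneg hy.le, mul_left_comm]
  simpa using mul_le_mul_of_nonneg_left h hy.le

/-- The primitive is `log(1 + y e^(v+s))`, which vanishes at `-∞`; the factor `y` is absorbed by
shifting `v` by `log y`. -/
theorem integral_kernel_Iic (hv : |v.im| < π) {y : ℝ} (hy : 0 < y) :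
    ∫ s : ℝ in Iic 0, (y : ℂ) * ((y : ℂ) + Complex.exp (-v - s))⁻¹ =
      Complex.log (1 + Complex.exp v * y) := by
  set v' : ℂ := v + Real.log y with hv'
  have hy' : (y : ℂ) = Complex.exp (Real.log y : ℝ) := by
    rw [← Complex.ofReal_exp, Real.exp_log hy]
  have hy0 : (y : ℂ) ≠ 0 := by exact_mod_cast hy.ne'
  have him : |v'.im| < π := by simpa [hv'] using hv
  have e1 : ∀ s : ℝ, ((1 : ℝ) : ℂ) * (1 + Complex.exp ((1 : ℝ) * (-v' - s)))⁻¹ =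
      (y : ℂ) * ((y : ℂ) + Complex.exp (-v - s))⁻¹ := by
    intro s
    have h1 : Complex.exp ((1 : ℝ) * (-v' - s)) = Complex.exp (-v - s) * (y : ℂ)⁻¹ := by
      rw [hy', ← Complex.exp_neg, ← Complex.exp_add, hv']
      congr 1
      push_cast
      ring
    rw [h1, show (y : ℂ) + Complex.exp (-v - s) = y * (1 + Complex.exp (-v - s) * (y : ℂ)⁻¹) by
      field_simp, mul_inv, mul_inv_cancel_left₀ hy0, Complex.ofReal_one, one_mul]
  have hd : ∀ s : ℝ, HasDerivAt (fun s : ℝ => Complex.log (1 + Complex.exp ((1 : ℝ) * (v' + s))))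
      ((y : ℂ) * ((y : ℂ) + Complex.exp (-v - s))⁻¹) s := fun s => by
    rw [← e1]
    exact hasDerivAt_log_one_add_exp (by simpa using him) s
  have hint : IntegrableOn (fun s : ℝ => (y : ℂ) * ((y : ℂ) + Complex.exp (-v - s))⁻¹) (Iic 0) := by
    refine ((integrableOn_exp_Iic 0).const_mul
      ((Real.cos (v.im / 2))⁻¹ * (y * Real.exp v.re))).mono'
      (by fun_prop : Measurable _).aestronglyMeasurable (ae_of_all _ fun s => ?_)
    have hc := cos_half_im_pos hv
    refine (norm_mul_inv_add_exp_le hv hy s).trans ?_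
    have h2 : (y + Real.exp (-v.re - s))⁻¹ ≤ Real.exp v.re * Real.exp s := by
      rw [← Real.exp_add, show v.re + s = -(-v.re - s) by ring, Real.exp_neg]
      exact inv_anti₀ (Real.exp_pos _) (by linarith)
    calc _ ≤ (Real.cos (v.im / 2))⁻¹ * (y * (Real.exp v.re * Real.exp s)) := by gcongr
      _ = _ := by ring
  rw [integral_Iic_of_hasDerivAt_of_tendsto' (fun s _ => hd s) hint
    (tendsto_log_one_add_exp one_pos), sub_zero]
  congr 2
  rw [hv', Complex.ofReal_one, one_mul, Complex.ofReal_zero, add_zero, Complex.exp_add, ← hy']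

/-- The logarithmic transform of `ϱ_α`, off the negative half-line. -/
theorem log_transform_lampertiLaw (hα0 : 0 < α) (hα1 : α < 1) (hv : |v.im| < π) :
    Integrable (fun y : ℝ => Complex.log (1 + Complex.exp v * y)) (lampertiLaw α) ∧
      ∫ y : ℝ, Complex.log (1 + Complex.exp v * y) ∂lampertiLaw α =
        (1 / α : ℝ) * Complex.log (1 + Complex.exp (α * v)) := by
  have := isProbabilityMeasure_lampertiLaw hα0 hα1
  have hc := cos_half_im_pos hv
  set F : ℝ × ℝ → ℂ := fun p => (p.1 : ℂ) * ((p.1 : ℂ) + Complex.exp (-v - p.2))⁻¹ with hF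
  have hFm : Measurable F := by fun_prop
  -- At real arguments the Stieltjes transform bounds the integral of the modulus, up to a constant
  -- depending on the angle; this supplies the majorant for Fubini.
  have hreal : ∀ s : ℝ, ∫ y : ℝ, y * (y + Real.exp (-v.re - s))⁻¹ ∂lampertiLaw α =
      (1 + Real.exp (α * (-v.re - s)))⁻¹ := by
    intro s
    have h := integral_lampertiLaw_div_add_exp hα0 hα1 (w := ((-v.re - s : ℝ) : ℂ))
      (by simpa using Real.pi_pos)
    apply Complex.ofReal_injective
    rw [← integral_complex_ofReal]
    push_cast at h ⊢
    exact h
  have hbd : ∀ᵐ y ∂lampertiLaw α, ∀ s : ℝ, ‖F (y, s)‖ ≤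
      (Real.cos (v.im / 2))⁻¹ * (y * (y + Real.exp (-v.re - s))⁻¹) := by
    filter_upwards [lampertiLaw_pos (α := α)] with y hy s
    exact norm_mul_inv_add_exp_le hv hy s
  have hbi : ∀ s : ℝ, Integrable (fun y : ℝ => y * (y + Real.exp (-v.re - s))⁻¹)
      (lampertiLaw α) := by
    intro s
    refine (integrable_const (1 : ℝ)).mono' (by fun_prop : Measurable _).aestronglyMeasurable ?_
    filter_upwards [lampertiLaw_pos (α := α)] with y hy
    have := Real.exp_pos (-v.re - s)
    rw [Real.norm_of_nonneg (by positivity), ← div_eq_mul_inv, div_le_one (by positivity)]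
    linarith
  have hFi : Integrable F ((lampertiLaw α).prod (volume.restrict (Iic 0))) := by
    refine (integrable_prod_iff' hFm.aestronglyMeasurable).2 ⟨ae_of_all _ fun s => ?_, ?_⟩
    · refine ((hbi s).const_mul (Real.cos (v.im / 2))⁻¹).mono'
        (by fun_prop : Measurable _).aestronglyMeasurable ?_
      filter_upwards [hbd] with y hy using hy s
    · refine ((integrableOn_exp_mul_Iic hα0 0).const_mul
        ((Real.cos (v.im / 2))⁻¹ * Real.exp (α * v.re))).mono' ?_ (ae_of_all _ fun s => ?_)
      · exact (hFm.norm.stronglyMeasurable.integral_prod_left').aestronglyMeasurable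
      · rw [Real.norm_of_nonneg (integral_nonneg fun y => norm_nonneg _)]
        calc _ ≤ ∫ y, (Real.cos (v.im / 2))⁻¹ * (y * (y + Real.exp (-v.re - s))⁻¹)
              ∂lampertiLaw α := by
              refine integral_mono_of_nonneg (ae_of_all _ fun y => norm_nonneg _)
                ((hbi s).const_mul _) ?_
              filter_upwards [hbd] with y hy using hy s
          _ = (Real.cos (v.im / 2))⁻¹ * (1 + Real.exp (α * (-v.re - s)))⁻¹ := by
              rw [integral_const_mul, hreal]
          _ ≤ (Real.cos (v.im / 2))⁻¹ * (Real.exp (α * v.re) * Real.exp (α * s)) := by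
              gcongr
              rw [← Real.exp_add, show α * v.re + α * s = -(α * (-v.re - s)) by ring, Real.exp_neg]
              exact inv_anti₀ (Real.exp_pos _) (by linarith)
          _ = _ := by ring
  have hker : ∀ᵐ y ∂lampertiLaw α, ∫ s in Iic (0 : ℝ), F (y, s) =
      Complex.log (1 + Complex.exp v * y) := by
    filter_upwards [lampertiLaw_pos (α := α)] with y hy
    exact integral_kernel_Iic hv hy
  refine ⟨(hFi.integral_prod_left).congr hker, ?_⟩
  rw [← integral_congr_ae hker]
  -- After the swap the inner integral is the Stieltjes transform, whose primitive in `s` is again a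
  -- logarithm.
  refine (integral_integral_swap (f := fun y s => F (y, s)) hFi).trans ?_
  have him : |(α * v).im| < π := by simpa using abs_mul_im_lt hα0 hα1 hv.le
  have e2 : ∀ s : ℝ, ∫ y, F (y, s) ∂lampertiLaw α = (1 + Complex.exp (α * (-v - s)))⁻¹ := fun s =>
    integral_lampertiLaw_div_add_exp hα0 hα1 (w := -v - s) (by simpa using hv)
  simp_rw [e2]
  have hint2 : IntegrableOn (fun s : ℝ => (α : ℂ) * (1 + Complex.exp (α * (-v - s)))⁻¹)
      (Iic 0) := by
    have h := hFi.integral_prod_right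
    simp_rw [e2] at h
    exact h.const_mul _
  have h3 := integral_Iic_of_hasDerivAt_of_tendsto' (a := (0 : ℝ))
    (fun s _ => hasDerivAt_log_one_add_exp him s) hint2 (tendsto_log_one_add_exp hα0)
  rw [integral_const_mul, sub_zero, Complex.ofReal_zero, add_zero] at h3
  rw [← h3]
  push_cast
  have : (α : ℂ) ≠ 0 := by exact_mod_cast hα0.ne'
  field_simp

/-- Factor `e^w` out of `y + e^w` and take the real part of the logarithmic transform at `-w`; the
term `Re w` is the same on both sides. -/
theorem integral_log_norm_add_exp (hα0 : 0 < α) (hα1 : α < 1) {w : ℂ} (hw : |w.im| < π) :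
    Integrable (fun y : ℝ => Real.log ‖(y : ℂ) + Complex.exp w‖) (lampertiLaw α) ∧
      ∫ y : ℝ, Real.log ‖(y : ℂ) + Complex.exp w‖ ∂lampertiLaw α =
        1 / α * Real.log ‖1 + Complex.exp (α * w)‖ := by
  have := isProbabilityMeasure_lampertiLaw hα0 hα1
  obtain ⟨h1, h2⟩ := log_transform_lampertiLaw hα0 hα1 (v := -w) (by simpa using hw)
  have h3 : ∀ᵐ y : ℝ ∂lampertiLaw α, w.re + (Complex.log (1 + Complex.exp (-w) * y)).re =
      Real.log ‖(y : ℂ) + Complex.exp w‖ := by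
    filter_upwards [lampertiLaw_pos (α := α)] with y hy
    have h0 := add_exp_ne_zero hw hy.le
    have e : (y : ℂ) + Complex.exp w = Complex.exp w * (1 + Complex.exp (-w) * y) := by
      rw [mul_add, ← mul_assoc, ← Complex.exp_add]
      simp [add_comm]
    rw [e] at h0 ⊢
    rw [norm_mul, Real.log_mul (norm_ne_zero_iff.2 (Complex.exp_ne_zero _))
      (norm_ne_zero_iff.2 (right_ne_zero_of_mul h0)), Complex.norm_exp, Real.log_exp,
      Complex.log_re]
  have hre : Integrable (fun y : ℝ => (Complex.log (1 + Complex.exp (-w) * y)).re)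
    (lampertiLaw α) := h1.re
  have h4 : Integrable (fun y : ℝ => w.re + (Complex.log (1 + Complex.exp (-w) * y)).re)
      (lampertiLaw α) := (integrable_const _).add hre
  refine ⟨h4.congr h3, ?_⟩
  rw [← integral_congr_ae h3, integral_add (integrable_const _) hre, integral_const,
    probReal_univ, one_smul]
  have h5 : ∫ y : ℝ, (Complex.log (1 + Complex.exp (-w) * y)).re ∂lampertiLaw α =
      (∫ y : ℝ, Complex.log (1 + Complex.exp (-w) * y) ∂lampertiLaw α).re := integral_re h1
  have hs := one_add_exp_mem_slitPlane (v := α * w) (by simpa using abs_mul_im_lt hα0 hα1 hw.le)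
  have h0 := Complex.slitPlane_ne_zero hs
  have e : 1 + Complex.exp (α * w) = Complex.exp (α * w) * (1 + Complex.exp (α * -w)) := by
    rw [mul_add, ← Complex.exp_add]
    simp [add_comm]
  rw [h5, h2, Complex.re_ofReal_mul, Complex.log_re, e]
  rw [e] at h0
  rw [norm_mul, Real.log_mul (norm_ne_zero_iff.2 (Complex.exp_ne_zero _))
      (norm_ne_zero_iff.2 (right_ne_zero_of_mul h0)), Complex.norm_exp, Real.log_exp]
  simp only [Complex.re_ofReal_mul]
  field_simp

/-- Boundary values of the logarithmic transform of `ϱ_α`. -/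
theorem logPotential_of_tendsto (hα0 : 0 < α) (hα1 : α < 1) {x : ℝ} (hx : 0 ≤ x) {w : ℕ → ℂ}
    (hw : ∀ n, |(w n).im| < π) (hlim : Tendsto (fun n => Complex.exp (w n)) atTop (𝓝 (-x : ℂ)))
    (hle : ∀ n, ‖Complex.exp (w n)‖ ≤ x + 1)
    (hge : ∀ n (y : ℝ), 0 < y → |x - y| ≤ ‖(y : ℂ) + Complex.exp (w n)‖)
    {L : ℝ} (hL : 0 < L) (hlim2 : Tendsto (fun n => ‖1 + Complex.exp (α * w n)‖) atTop (𝓝 L)) :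
    Integrable (fun y => Real.log |x - y|) (lampertiLaw α) ∧
      ∫ y, Real.log |x - y| ∂lampertiLaw α = 1 / α * Real.log L := by
  have := isProbabilityMeasure_lampertiLaw hα0 hα1
  set f : ℕ → ℝ → ℝ := fun n y => Real.log ‖(y : ℂ) + Complex.exp (w n)‖ with hf
  have hfi : ∀ n, Integrable (f n) (lampertiLaw α) := fun n =>
    (integral_log_norm_add_exp hα0 hα1 (hw n)).1
  have hfl : Tendsto (fun n => ∫ y, f n y ∂lampertiLaw α) atTop (𝓝 (1 / α * Real.log L)) := by
    have : ∀ n, ∫ y, f n y ∂lampertiLaw α = 1 / α * Real.log ‖1 + Complex.exp (α * w n)‖ := fun n =>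
      (integral_log_norm_add_exp hα0 hα1 (hw n)).2
    simp_rw [this]
    exact (hlim2.log hL.ne').const_mul _
  set g : ℝ → ℝ := fun y => Real.log (x + 1 + y) with hg
  have hgi : Integrable g (lampertiLaw α) := by
    have h := (integral_log_norm_add_exp hα0 hα1 (w := (Real.log (x + 1) : ℝ))
      (by simpa using Real.pi_pos)).1
    refine h.congr ?_
    filter_upwards [lampertiLaw_pos (α := α)] with y hy
    rw [← Complex.ofReal_exp, Real.exp_log (by linarith), ← Complex.ofReal_add, Complex.norm_real,
      Real.norm_of_nonneg (by linarith), hg, add_comm]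
  have hpt : ∀ᵐ y ∂lampertiLaw α, (∀ n, Real.log |x - y| ≤ f n y ∧ f n y ≤ g y) ∧
      Tendsto (fun n => f n y) atTop (𝓝 (Real.log |x - y|)) := by
    filter_upwards [lampertiLaw_pos (α := α), lampertiLaw_ae_ne (α := α) x] with y hy hne
    have hpos : 0 < |x - y| := abs_pos.2 (sub_ne_zero.2 hne.symm)
    refine ⟨fun n => ⟨Real.log_le_log hpos (hge n y hy),
      Real.log_le_log (hpos.trans_le (hge n y hy)) ?_⟩, ?_⟩
    · refine (norm_add_le _ _).trans ?_
      rw [Complex.norm_real, Real.norm_of_nonneg hy.le]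
      linarith [hle n]
    · refine Tendsto.log ?_ hpos.ne'
      have h := (hlim.const_add (y : ℂ)).norm
      have e : ‖(y : ℂ) + -x‖ = |x - y| := by
        rw [← sub_eq_add_neg, ← Complex.ofReal_sub, Complex.norm_real, Real.norm_eq_abs,
          abs_sub_comm]
      rwa [e] at h
  have hlm : Measurable fun y => Real.log |x - y| := by fun_prop
  have hfm : ∀ n, Measurable (f n) := fun n => by fun_prop
  have hgm : Measurable g := by fun_prop
  -- Fatou's lemma for the nonnegative `g - f n`, whose integrals converge, yields integrability of
  -- the singular limit. The `f n` are then squeezed between it and `g`.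
  have hint : Integrable (fun y => g y - Real.log |x - y|) (lampertiLaw α) := by
    refine ⟨(by fun_prop : Measurable _).aestronglyMeasurable, ?_⟩
    rw [hasFiniteIntegral_iff_ofReal
      (by filter_upwards [hpt] with y hy using sub_nonneg.2 ((hy.1 0).1.trans (hy.1 0).2))]
    calc ∫⁻ y, ENNReal.ofReal (g y - Real.log |x - y|) ∂lampertiLaw α
        = ∫⁻ y, liminf (fun n => ENNReal.ofReal (g y - f n y)) atTop ∂lampertiLaw α := by
          refine lintegral_congr_ae ?_
          filter_upwards [hpt] with y hy
          exact ((ENNReal.continuous_ofReal.tendsto _).comp (hy.2.const_sub (g y))).liminf_eq.symm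
      _ ≤ liminf (fun n => ∫⁻ y, ENNReal.ofReal (g y - f n y) ∂lampertiLaw α) atTop :=
          lintegral_liminf_le fun n => by fun_prop
      _ = liminf (fun n => ENNReal.ofReal (∫ y, g y ∂lampertiLaw α - ∫ y, f n y ∂lampertiLaw α))
            atTop := by
          congr 1
          ext n
          rw [← integral_sub hgi (hfi n)]
          refine (ofReal_integral_eq_lintegral_ofReal (f := fun y => g y - f n y)
            (hgi.sub (hfi n)) ?_).symm
          filter_upwards [hpt] with y hy using sub_nonneg.2 (hy.1 n).2
      _ = ENNReal.ofReal (∫ y, g y ∂lampertiLaw α - 1 / α * Real.log L) :=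
          ((ENNReal.continuous_ofReal.tendsto _).comp (hfl.const_sub _)).liminf_eq
      _ < ∞ := ENNReal.ofReal_lt_top
  have hli : Integrable (fun y => Real.log |x - y|) (lampertiLaw α) :=
    (hgi.sub hint).congr (ae_of_all _ fun y => sub_sub_cancel _ _)
  refine ⟨hli, tendsto_nhds_unique ?_ hfl⟩
  refine tendsto_integral_of_dominated_convergence (fun y => ‖Real.log |x - y|‖ + |g y|)
    (fun n => (hfm n).aestronglyMeasurable) (hli.norm.add hgi.abs) (fun n => ?_) ?_
  · filter_upwards [hpt] with y hy
    rw [Real.norm_eq_abs, abs_le, Real.norm_eq_abs]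
    have h1 := (hy.1 n).1
    have h2 := (hy.1 n).2
    have h3 := neg_abs_le (Real.log |x - y|)
    have h4 := le_abs_self (g y)
    have h5 := abs_nonneg (Real.log |x - y|)
    have h6 := abs_nonneg (g y)
    constructor <;> linarith
  · filter_upwards [hpt] with y hy using hy.2

/-- The point `-x` is approached by `e^w` on the circle of radius `x`, or along `e^(-n)` when `x =
0`. In both cases `|y + e^w| ≥ |x - y|`, and `|1 + e^{αw}|` tends to the modulus in the polar form.
-/
theorem logPotential_lampertiLaw (hα0 : 0 < α) (hα1 : α < 1) {x : ℝ} (hx : 0 ≤ x) :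
    Integrable (fun y => Real.log |x - y|) (lampertiLaw α) ∧
      ∫ y, Real.log |x - y| ∂lampertiLaw α =
        1 / α * Real.log (lampertiPoly α x ^ (1 / 2 : ℝ)) := by
  have hp := lampertiPoly_pos hα0 hα1 hx
  have hπ := Real.pi_pos
  have hnorm : ‖(1 + (x ^ α : ℝ) * Complex.exp (π * α * Complex.I) : ℂ)‖ =
      lampertiPoly α x ^ (1 / 2 : ℝ) := by
    rw [one_add_rpow_mul_exp hα0 hα1 hx, norm_mul, Complex.norm_real,
      Real.norm_of_nonneg (by positivity), Complex.ofReal_cos, Complex.ofReal_sin,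
      ← Complex.exp_mul_I, Complex.norm_exp_ofReal_mul_I, mul_one]
  rcases hx.eq_or_lt with rfl | hx'
  · refine logPotential_of_tendsto hα0 hα1 le_rfl (w := fun n => ((-n : ℝ) : ℂ))
      (fun n => by rw [Complex.ofReal_im, abs_zero]; exact hπ) ?_ (fun n => ?_)
      (fun n y hy => ?_) (by positivity) ?_
    · have h := Real.tendsto_exp_neg_atTop_nhds_zero.comp tendsto_natCast_atTop_atTop
      have h2 := (Complex.continuous_ofReal.tendsto _).comp h
      simpa [Function.comp_def] using h2
    · rw [Complex.norm_exp, Complex.ofReal_re, zero_add]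
      exact Real.exp_le_one_iff.2 (by simp)
    · rw [← Complex.ofReal_exp, ← Complex.ofReal_add, Complex.norm_real, Real.norm_of_nonneg
        (by positivity), zero_sub, abs_neg, abs_of_pos hy]
      linarith [Real.exp_pos (-n : ℝ)]
    · rw [← hnorm, Real.zero_rpow hα0.ne', Complex.ofReal_zero, zero_mul]
      have h := Real.tendsto_exp_neg_atTop_nhds_zero.comp
        (tendsto_natCast_atTop_atTop.const_mul_atTop hα0)
      have h2 := (((Complex.continuous_ofReal.tendsto _).comp h).const_add 1).norm
      simpa [Function.comp_def] using h2
  -- The offset `2` keeps the angle in `(0, π)` already at `n = 0`.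
  · set φ : ℕ → ℝ := fun n => π - π / (n + 2) with hφ
    have hφ0 : ∀ n, 0 < φ n := fun n => by
      have : π / ((n : ℝ) + 2) < π := div_lt_self hπ (by linarith [n.cast_nonneg (α := ℝ)])
      simp only [hφ]; linarith
    have hφ1 : ∀ n, φ n < π := fun n => by
      have : 0 < π / ((n : ℝ) + 2) := by positivity
      simp only [hφ]; linarith
    have hφl : Tendsto φ atTop (𝓝 π) := by
      have h : Tendsto (fun n : ℕ => π / ((n : ℝ) + 2)) atTop (𝓝 0) :=
        tendsto_const_nhds.div_atTop (tendsto_atTop_add_const_right _ _ tendsto_natCast_atTop_atTop)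
      simpa using h.const_sub π
    have hwl : Tendsto (fun n => (Real.log x + φ n * Complex.I : ℂ)) atTop
        (𝓝 (Real.log x + π * Complex.I)) :=
      (((Complex.continuous_ofReal.tendsto _).comp hφl).mul_const _).const_add _
    have hexp : Complex.exp (Real.log x) = x := by rw [← Complex.ofReal_exp, Real.exp_log hx']
    refine logPotential_of_tendsto hα0 hα1 hx (w := fun n => Real.log x + φ n * Complex.I)
      (fun n => ?_) ?_ (fun n => ?_) (fun n y hy => ?_) (by positivity) ?_
    · have : (Real.log x + φ n * Complex.I : ℂ).im = φ n := by simp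
      rw [this, abs_of_pos (hφ0 n)]
      exact hφ1 n
    · have h := (Complex.continuous_exp.tendsto _).comp hwl
      rwa [Complex.exp_add, hexp, Complex.exp_pi_mul_I, mul_neg_one] at h
    · rw [Complex.exp_add, norm_mul, Complex.norm_exp_ofReal_mul_I, hexp, Complex.norm_real,
        Real.norm_of_nonneg hx]
      linarith
    · rw [Complex.exp_add, hexp]
      have h := abs_norm_sub_norm_le (y : ℂ) (-(x * Complex.exp (φ n * Complex.I)))
      rwa [norm_neg, norm_mul, Complex.norm_exp_ofReal_mul_I, mul_one, Complex.norm_real,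
        Complex.norm_real, Real.norm_of_nonneg hx, Real.norm_of_nonneg hy.le, sub_neg_eq_add,
        abs_sub_comm] at h
    · have h := (((Complex.continuous_exp.tendsto _).comp (hwl.const_mul (α : ℂ))).const_add
        1).norm
      have e : ‖1 + Complex.exp (α * (Real.log x + π * Complex.I))‖ =
          lampertiPoly α x ^ (1 / 2 : ℝ) := by
        rw [← hnorm, mul_add, Complex.exp_add, ← Complex.ofReal_mul, ← Complex.ofReal_exp,
          mul_comm α, ← Real.rpow_def_of_pos hx']
        congr 4
        ring
      rwa [e] at h

/-- Since `Φ = (2α)⁻¹ log P` with `P` the polynomial, `e^(-αθΦ)` is `P^(-θ/2)`. Removing the point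
`t` from the integral is harmless as `ϱ_α` has no atoms. -/
theorem crDelta_lampertiLaw (hα0 : 0 < α) (hα1 : α < 1) {x : ℝ} (hx : 0 ≤ x) :
    crDelta (α * θ) (lampertiLaw α) x = lampertiDelta α θ x := by
  have hp := lampertiPoly_pos hα0 hα1 hx
  have h1 : logPotential (lampertiLaw α) x =
      1 / α * Real.log (lampertiPoly α x ^ (1 / 2 : ℝ)) := by
    rw [logPotential, ← (logPotential_lampertiLaw hα0 hα1 hx).2,
      Measure.restrict_eq_self_of_ae_mem]
    exact lampertiLaw_ae_ne x
  rw [crDelta, lampertiDelta, h1, lampertiLaw_real_Iic hα0 hα1 hx, Real.log_rpow hp,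
    div_eq_mul_inv (Real.sin _), ← Real.rpow_neg hp.le, Real.rpow_def_of_pos hp, mul_assoc]
  congr 3
  · ring
  · field_simp

end LogTransform

/-! ### The transform of the Dirichlet mean. -/

theorem integrable_and_integral_of_lintegral_ofReal {Ω : Type*} [MeasurableSpace Ω] {μ : Measure Ω}
    {f : Ω → ℝ} (hf : AEStronglyMeasurable f μ) (h0 : 0 ≤ᵐ[μ] f) {r : ℝ} (hr : 0 ≤ r)
    (h : ∫⁻ x, ENNReal.ofReal (f x) ∂μ = ENNReal.ofReal r) :
    Integrable f μ ∧ ∫ x, f x ∂μ = r := by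
  refine ⟨⟨hf, ?_⟩, ?_⟩
  · rw [hasFiniteIntegral_iff_ofReal h0, h]
    exact ENNReal.ofReal_lt_top
  · rw [integral_eq_lintegral_of_nonneg_ae h0 hf, h, ENNReal.toReal_ofReal hr]

/-- Homogeneity, used to pass between `1 + lX` and `s + X` with `l = 1/s`. -/
theorem rpow_mul_one_add_rpow {α θ s : ℝ} (hs : 0 < s) :
    s ^ (-(α * θ)) * (1 + s⁻¹ ^ α) ^ (-θ) = (1 + s ^ α) ^ (-θ) := by
  have h : 0 < s ^ α := by positivity
  rw [neg_mul_eq_mul_neg, Real.rpow_mul hs.le, ← Real.mul_rpow h.le (by positivity),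
    Real.inv_rpow hs.le]
  congr 1
  field_simp
  ring

theorem measurable_meanFunctional {Ω : Type*} [MeasurableSpace Ω] {P : Measure Ω}
    {D : Ω → Measure ℝ} {c : ℝ} {H : Measure ℝ} (hD : IsDirichletProcess c H D P) :
    Measurable (meanFunctional D) := by
  let κ : Kernel Ω ℝ := ⟨D, hD.measurable⟩
  have : IsMarkovKernel κ := ⟨hD.isProbabilityMeasure⟩
  have h : StronglyMeasurable fun ω => ∫ x, x ∂(κ ω) :=
    StronglyMeasurable.integral_kernel stronglyMeasurable_id
  exact h.measurable

section MeanLaw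

variable {α θ : ℝ} {Ω : Type*} [MeasurableSpace Ω] {P : Measure Ω} [IsProbabilityMeasure P]
  {D : Ω → Measure ℝ}

theorem lintegral_log_lampertiLaw (hα0 : 0 < α) (hα1 : α < 1) {l : ℝ} (hl : 0 < l) :
    ∫⁻ y, ENNReal.ofReal (Real.log (1 + (ENNReal.ofReal (l * y)).toReal)) ∂lampertiLaw α =
      ENNReal.ofReal (1 / α * Real.log (1 + l ^ α)) := by
  obtain ⟨h1, h2⟩ := log_transform_lampertiLaw hα0 hα1 (v := (Real.log l : ℝ))
    (by simpa using Real.pi_pos)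
  have h3 : ∀ᵐ y : ℝ ∂lampertiLaw α, Complex.log (1 + Complex.exp (Real.log l : ℝ) * y) =
      (Real.log (1 + (ENNReal.ofReal (l * y)).toReal) : ℝ) := by
    filter_upwards [lampertiLaw_pos (α := α)] with y hy
    rw [← Complex.ofReal_exp, Real.exp_log hl, ENNReal.toReal_ofReal (by positivity),
      Complex.ofReal_log (by positivity)]
    push_cast
    rfl
  have h4 : (1 / α : ℝ) * Complex.log (1 + Complex.exp (α * (Real.log l : ℝ))) =
      ((1 / α * Real.log (1 + l ^ α) : ℝ) : ℂ) := by
    rw [← Complex.ofReal_mul, ← Complex.ofReal_exp, mul_comm α, ← Real.rpow_def_of_pos hl,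
      Complex.ofReal_mul, Complex.ofReal_log (by positivity)]
    push_cast
    rfl
  rw [integral_congr_ae h3, integral_complex_ofReal, h4] at h2
  have h5 : Integrable (fun y : ℝ => Real.log (1 + (ENNReal.ofReal (l * y)).toReal))
      (lampertiLaw α) := by
    refine (h1.re).congr ?_
    filter_upwards [h3] with y hy
    rw [hy]
    exact Complex.ofReal_re _
  rw [← Complex.ofReal_injective h2, ofReal_integral_eq_lintegral_ofReal h5]
  exact ae_of_all _ fun y => Real.log_nonneg (by simp)

/-- Stated with an extended integral because the finiteness of the mean is deduced from it. -/
theorem lintegral_mean_rpow (hα0 : 0 < α) (hα1 : α < 1) (hθ : 0 < θ)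
    (hD : IsDirichletProcess (α * θ) (lampertiLaw α) D P) {l : ℝ} (hl : 0 < l) :
    ∫⁻ ω, (1 + ENNReal.ofReal l * ∫⁻ x, ENNReal.ofReal x ∂(D ω)) ^ (-(α * θ)) ∂P =
      ENNReal.ofReal ((1 + l ^ α) ^ (-θ)) := by
  have := isProbabilityMeasure_lampertiLaw hα0 hα1
  have hlog := lintegral_log_lampertiLaw hα0 hα1 hl
  have h := hD.markovKrein (mul_pos hα0 hθ) (f := fun x => l * x) (by fun_prop)
    (by rw [hlog]; exact ENNReal.ofReal_ne_top)
  have hp : 0 < 1 + l ^ α := by positivity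
  rw [hlog, ENNReal.toReal_ofReal (mul_nonneg (by positivity)
    (Real.log_nonneg (by linarith [Real.rpow_nonneg hl.le α])))] at h
  simp_rw [ENNReal.ofReal_mul hl.le] at h
  simp_rw [lintegral_const_mul' (ENNReal.ofReal l) _ ENNReal.ofReal_ne_top] at h
  rw [h, Real.rpow_def_of_pos hp]
  congr 2
  field_simp

/-- The integrand vanishes where the mean is infinite and is at most `1` elsewhere, while its
expectation `(1 + l^α)^(-θ)` tends to `1` as `l → 0`. -/
theorem ae_lintegral_lt_top (hα0 : 0 < α) (hα1 : α < 1) (hθ : 0 < θ)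
    (hD : IsDirichletProcess (α * θ) (lampertiLaw α) D P) :
    ∀ᵐ ω ∂P, ∫⁻ x, ENNReal.ofReal x ∂(D ω) < ∞ := by
  set N : Ω → ℝ≥0∞ := fun ω => ∫⁻ x, ENNReal.ofReal x ∂(D ω) with hN
  have hNm : Measurable N := hD.measurable_lintegral (by fun_prop)
  have hset : MeasurableSet {ω | N ω < ∞} := measurableSet_lt hNm measurable_const
  have hle : ∀ l : ℝ, 0 < l → ENNReal.ofReal ((1 + l ^ α) ^ (-θ)) ≤ P {ω | N ω < ∞} := by
    intro l hl
    rw [← lintegral_mean_rpow hα0 hα1 hθ hD hl, ← lintegral_indicator_one hset]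
    refine lintegral_mono fun ω => ?_
    by_cases h : N ω < ∞
    · rw [indicator_of_mem (by exact h)]
      exact ENNReal.rpow_le_one_of_one_le_of_neg le_self_add (by nlinarith)
    · have h' : ∫⁻ x, ENNReal.ofReal x ∂(D ω) = ∞ := not_lt_top_iff.1 h
      simp only
      rw [h', ENNReal.mul_top (ENNReal.ofReal_pos.2 hl).ne', add_top,
        ENNReal.top_rpow_of_neg (by nlinarith)]
      exact zero_le
  have hlim : Tendsto (fun l : ℝ => ENNReal.ofReal ((1 + l ^ α) ^ (-θ))) (𝓝[>] 0) (𝓝 1) := by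
    have h1 : Tendsto (fun l : ℝ => l ^ α) (𝓝[>] 0) (𝓝 0) := by
      have := (Real.continuous_rpow_const hα0.le).tendsto 0
      rw [Real.zero_rpow hα0.ne'] at this
      exact this.mono_left nhdsWithin_le_nhds
    have h2 := (h1.const_add 1).rpow_const (p := -θ) (Or.inl (by norm_num))
    rw [add_zero, Real.one_rpow] at h2
    have h3 := (ENNReal.continuous_ofReal.tendsto _).comp h2
    rwa [ENNReal.ofReal_one] at h3
  have h1 : 1 ≤ P {ω | N ω < ∞} := le_of_tendsto hlim (by
    filter_upwards [self_mem_nhdsWithin] with l hl using hle l hl)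
  exact (prob_compl_eq_zero_iff hset).2 (le_antisymm prob_le_one h1)

theorem ae_integrable_and_mean (hα0 : 0 < α) (hα1 : α < 1) (hθ : 0 < θ)
    (hD : IsDirichletProcess (α * θ) (lampertiLaw α) D P) :
    ∀ᵐ ω ∂P, Integrable (fun x : ℝ => x) (D ω) ∧ 0 ≤ meanFunctional D ω ∧
      ENNReal.ofReal (meanFunctional D ω) = ∫⁻ x, ENNReal.ofReal x ∂(D ω) := by
  filter_upwards [ae_lintegral_lt_top hα0 hα1 hθ hD,
    hD.ae_measure_eq_zero measurableSet_Iic lampertiLaw_Iic_zero] with ω h1 h2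
  have hpos : ∀ᵐ x ∂(D ω), 0 ≤ x := by
    rw [ae_iff]
    exact measure_mono_null (fun x hx => by simpa using le_of_not_ge hx) h2
  have hi : Integrable (fun x : ℝ => x) (D ω) :=
    ⟨measurable_id.aestronglyMeasurable, (hasFiniteIntegral_iff_ofReal hpos).2 h1⟩
  exact ⟨hi, integral_nonneg_of_ae hpos, ofReal_integral_eq_lintegral_ofReal hi hpos⟩

theorem mean_stieltjes (hα0 : 0 < α) (hα1 : α < 1) (hθ : 0 < θ)
    (hD : IsDirichletProcess (α * θ) (lampertiLaw α) D P) {s : ℝ} (hs : 0 < s) :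
    ∫⁻ x, ENNReal.ofReal ((s + x) ^ (-(α * θ))) ∂(P.map (meanFunctional D)) =
      ENNReal.ofReal ((1 + s ^ α) ^ (-θ)) := by
  have hm := measurable_meanFunctional hD
  rw [lintegral_map (by fun_prop) hm, ← rpow_mul_one_add_rpow hs,
    ENNReal.ofReal_mul (by positivity), ← lintegral_mean_rpow hα0 hα1 hθ hD (inv_pos.2 hs),
    ← lintegral_const_mul' _ _ ENNReal.ofReal_ne_top]
  refine lintegral_congr_ae ?_
  filter_upwards [ae_integrable_and_mean hα0 hα1 hθ hD] with ω ⟨_, h1, h2⟩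
  rw [← h2, ← ENNReal.ofReal_mul (by positivity), ← ENNReal.ofReal_one,
    ← ENNReal.ofReal_add zero_le_one (by positivity), ENNReal.ofReal_rpow_of_pos (by positivity),
    ← ENNReal.ofReal_mul (by positivity), ← Real.mul_rpow hs.le (by positivity)]
  congr 2
  field_simp

theorem mean_nonneg (hα0 : 0 < α) (hα1 : α < 1) (hθ : 0 < θ)
    (hD : IsDirichletProcess (α * θ) (lampertiLaw α) D P) :
    ∀ᵐ x ∂(P.map (meanFunctional D)), 0 ≤ x := by
  refine (ae_map_iff (measurable_meanFunctional hD).aemeasurable measurableSet_Ici).2 ?_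
  filter_upwards [ae_integrable_and_mean hα0 hα1 hθ hD] with ω h using h.2.1

/-- The law of the mean is determined by its generalized Stieltjes transform. -/
theorem map_mean_eq (hα0 : 0 < α) (hα1 : α < 1) (hθ : 0 < θ)
    (hD : IsDirichletProcess (α * θ) (lampertiLaw α) D P) {ν : Measure ℝ} (hν : ∀ᵐ x ∂ν, 0 ≤ x)
    (h : ∀ s : ℝ, 0 < s → ∫⁻ x, ENNReal.ofReal ((s + x) ^ (-(α * θ))) ∂ν =
      ENNReal.ofReal ((1 + s ^ α) ^ (-θ))) :
    P.map (meanFunctional D) = ν := by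
  have key : ∀ {m : Measure ℝ}, (∀ᵐ x ∂m, 0 ≤ x) → ∀ s : ℝ, 0 < s →
      ∫⁻ x, ENNReal.ofReal ((s + x) ^ (-(α * θ))) ∂m = ENNReal.ofReal ((1 + s ^ α) ^ (-θ)) →
      Integrable (fun x => (s + x) ^ (-(α * θ))) m ∧
        ∫ x, (s + x) ^ (-(α * θ)) ∂m = (1 + s ^ α) ^ (-θ) := fun hm s hs h =>
    integrable_and_integral_of_lintegral_ofReal (by fun_prop : Measurable _).aestronglyMeasurable
      (hm.mono fun x hx => Real.rpow_nonneg (by linarith) _) (by positivity) h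
  have h0 := mean_nonneg hα0 hα1 hθ hD
  have hM := fun s hs => key h0 s hs (mean_stieltjes hα0 hα1 hθ hD hs)
  have hN := fun s hs => key hν s hs (h s hs)
  exact measure_eq_of_stieltjes (mul_pos hα0 hθ) h0 hν (fun s hs => (hM s hs).1)
    (fun s hs => (hN s hs).1) fun s hs => by rw [(hM s hs).2, (hN s hs).2]

end MeanLaw

/-! ### The transform of `S_α / T_{α,αθ}`. -/

section StableRatio

variable {α θ : ℝ} {μ m : Measure ℝ}

theorem IsPositiveStable.ae_nonneg (h : IsPositiveStable α μ) : ∀ᵐ x ∂μ, 0 ≤ x := by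
  rw [ae_iff]
  simpa [Iio_def] using h.nonneg

theorem IsPositiveStable.lintegral_exp (h : IsPositiveStable α μ) {l : ℝ} (hl : 0 ≤ l) :
    ∫⁻ s, ENNReal.ofReal (Real.exp (-(l * s))) ∂μ = ENNReal.ofReal (Real.exp (-(l ^ α))) := by
  have := h.isProbabilityMeasure
  rw [← h.laplace l hl, ofReal_integral_eq_lintegral_ofReal]
  · refine (integrable_const (1 : ℝ)).mono' (by fun_prop : Measurable _).aestronglyMeasurable ?_
    filter_upwards [h.ae_nonneg] with s hs
    rw [Real.norm_of_nonneg (Real.exp_pos _).le]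
    exact Real.exp_le_one_iff.2 (by nlinarith)
  · exact ae_of_all _ fun s => (Real.exp_pos _).le

/-- The mass at `0` is at most the Laplace transform `exp(-l^α)` for every `l ≥ 0`; let `l → ∞`. -/
theorem IsPositiveStable.ae_pos (hα0 : 0 < α) (h : IsPositiveStable α μ) : ∀ᵐ x ∂μ, 0 < x := by
  have h0 : μ {0} = 0 := by
    have hlim : Tendsto (fun l : ℝ => ENNReal.ofReal (Real.exp (-(l ^ α)))) atTop (𝓝 0) := by
      have h1 := Real.tendsto_exp_neg_atTop_nhds_zero.comp (tendsto_rpow_atTop hα0)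
      have h2 := (ENNReal.continuous_ofReal.tendsto _).comp h1
      rwa [ENNReal.ofReal_zero] at h2
    refine le_antisymm (ge_of_tendsto hlim ?_) zero_le
    filter_upwards [eventually_ge_atTop 0] with l hl
    rw [← h.lintegral_exp hl, ← lintegral_indicator_one (measurableSet_singleton (0 : ℝ))]
    refine lintegral_mono fun x => ?_
    by_cases hx : x = 0
    · simp [hx]
    · simp [hx]
  have h1 : ∀ᵐ x ∂μ, x ≠ 0 := by
    rw [ae_iff]
    simpa using h0
  filter_upwards [h.ae_nonneg, h1] with x h2 h3 using lt_of_le_of_ne h2 h3.symm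

theorem lintegral_rpow_mul_exp_rpow (hα0 : 0 < α) (hθ : 0 < θ) {b : ℝ} (hb : 0 < b) :
    ∫⁻ u in Ioi (0 : ℝ), ENNReal.ofReal (u ^ (α * θ - 1) * Real.exp (-(b * u ^ α))) =
      ENNReal.ofReal (b ^ (-θ) * (1 / α * Real.Gamma θ)) := by
  have h := integral_rpow_mul_exp_neg_mul_rpow hα0
    (by nlinarith [mul_pos hα0 hθ] : -1 < α * θ - 1) hb
  have hG := Real.Gamma_pos_of_pos hθ
  have e1 : -(α * θ - 1 + 1) / α = -θ := by field_simp; ring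
  have e2 : (α * θ - 1 + 1) / α = θ := by field_simp; ring
  rw [e1, e2] at h
  simp_rw [neg_mul] at h
  rw [← ofReal_integral_eq_lintegral_ofReal, h, mul_assoc]
  · refine not_imp_comm.1 integral_undef ?_
    rw [h]
    positivity
  · filter_upwards [ae_restrict_mem measurableSet_Ioi] with t ht
    have : 0 < t := ht
    simp only [Pi.zero_apply]
    positivity

/-- Negative moments of `T + λ S` for independent positive stable variables. -/
theorem lintegral_stable_add_rpow (hα0 : 0 < α) (hθ : 0 < θ) (hμ : IsPositiveStable α μ)
    (hm : IsPositiveStable α m) {l : ℝ} (hl : 0 ≤ l) :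
    ∫⁻ s, ∫⁻ t, ENNReal.ofReal ((t + l * s) ^ (-(α * θ))) ∂m ∂μ =
      ENNReal.ofReal (1 / α * Real.Gamma θ / Real.Gamma (α * θ) * (1 + l ^ α) ^ (-θ)) := by
  have := hμ.isProbabilityMeasure
  have := hm.isProbabilityMeasure
  have hc : 0 < α * θ := mul_pos hα0 hθ
  have hG := Real.Gamma_pos_of_pos hc
  have hGE : ENNReal.ofReal (Real.Gamma (α * θ)) ≠ 0 := (ENNReal.ofReal_pos.2 hG).ne'
  have hG' := Real.Gamma_pos_of_pos hθ
  refine (ENNReal.mul_right_inj hGE ENNReal.ofReal_ne_top).1 ?_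
  rw [lintegral_lintegral (f := fun s t => ENNReal.ofReal ((t + l * s) ^ (-(α * θ))))
    (by fun_prop), ← lintegral_const_mul _ (by fun_prop)]
  have hpos : ∀ᵐ p ∂(μ.prod m), 0 < p.2 + l * p.1 := by
    filter_upwards [Measure.quasiMeasurePreserving_fst.ae (hμ.ae_pos hα0),
      Measure.quasiMeasurePreserving_snd.ae (hm.ae_pos hα0)] with p h1 h2
    have : 0 ≤ l * p.1 := mul_nonneg hl h1.le
    linarith
  calc
    _ = ∫⁻ p, (∫⁻ u in Ioi (0 : ℝ),
          ENNReal.ofReal (u ^ (α * θ - 1) * Real.exp (-((p.2 + l * p.1) * u)))) ∂(μ.prod m) := by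
      refine lintegral_congr_ae ?_
      filter_upwards [hpos] with p hp
      rw [lintegral_rpow_mul_exp hc hp, ENNReal.ofReal_mul hG.le]
    _ = ∫⁻ u in Ioi (0 : ℝ), ∫⁻ p,
          ENNReal.ofReal (u ^ (α * θ - 1) * Real.exp (-((p.2 + l * p.1) * u))) ∂(μ.prod m) :=
      lintegral_lintegral_swap (by fun_prop)
    _ = ∫⁻ u in Ioi (0 : ℝ),
          ENNReal.ofReal (u ^ (α * θ - 1) * Real.exp (-((1 + l ^ α) * u ^ α))) := by
      -- Independence splits the exponential into Laplace transforms at `l u` and `u`, whose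
      -- exponents add up to `(1 + l^α) u^α`.
      refine setLIntegral_congr_fun measurableSet_Ioi fun u hu => ?_
      have hu : 0 < u := hu
      have e : ∀ p : ℝ × ℝ,
          ENNReal.ofReal (u ^ (α * θ - 1) * Real.exp (-((p.2 + l * p.1) * u))) =
          ENNReal.ofReal (u ^ (α * θ - 1)) * (ENNReal.ofReal (Real.exp (-((l * u) * p.1))) *
            ENNReal.ofReal (Real.exp (-(u * p.2)))) := fun p => by
        rw [← ENNReal.ofReal_mul (by positivity), ← Real.exp_add,
          ← ENNReal.ofReal_mul (by positivity)]
        ring_nf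
      simp_rw [e]
      rw [lintegral_const_mul _ (by fun_prop), lintegral_prod_mul
        (f := fun s => ENNReal.ofReal (Real.exp (-((l * u) * s))))
        (g := fun t => ENNReal.ofReal (Real.exp (-(u * t)))) (by fun_prop) (by fun_prop),
        hμ.lintegral_exp (by positivity), hm.lintegral_exp hu.le,
        ← ENNReal.ofReal_mul (by positivity), ← ENNReal.ofReal_mul (by positivity),
        ← Real.exp_add, Real.mul_rpow hl hu.le]
      ring_nf
    _ = _ := by
      rw [lintegral_rpow_mul_exp_rpow hα0 hθ (by positivity), ← ENNReal.ofReal_mul hG.le]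
      congr 1
      field_simp

/-- The case `l = 0`; its being positive and finite makes the tilt a probability measure. -/
theorem powerTilt_moment (hα0 : 0 < α) (hθ : 0 < θ) (hm : IsPositiveStable α m) :
    ∫⁻ t, ENNReal.ofReal (t ^ (-(α * θ))) ∂m =
      ENNReal.ofReal (1 / α * Real.Gamma θ / Real.Gamma (α * θ)) := by
  have := hm.isProbabilityMeasure
  have h := lintegral_stable_add_rpow hα0 hθ hm hm le_rfl
  simpa [Real.zero_rpow hα0.ne'] using h

theorem powerTilt_ae_pos (hα0 : 0 < α) {a : ℝ} (hm : IsPositiveStable α m) :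
    ∀ᵐ t ∂(powerTilt a m), 0 < t := by
  refine Measure.ae_smul_measure ?_ _
  exact (withDensity_absolutelyContinuous _ _).ae_le (hm.ae_pos hα0)

theorem isProbabilityMeasure_powerTilt (hα0 : 0 < α) (hθ : 0 < θ) (hm : IsPositiveStable α m) :
    IsProbabilityMeasure (powerTilt (α * θ) m) := by
  have hG := Real.Gamma_pos_of_pos (mul_pos hα0 hθ)
  have hG' := Real.Gamma_pos_of_pos hθ
  constructor
  rw [powerTilt, Measure.smul_apply, withDensity_apply _ MeasurableSet.univ,
    Measure.restrict_univ, smul_eq_mul]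
  refine ENNReal.inv_mul_cancel ?_ ?_ <;> rw [powerTilt_moment hα0 hθ hm]
  · exact (ENNReal.ofReal_pos.2 (by positivity)).ne'
  · exact ENNReal.ofReal_ne_top

theorem IsTiltedStable.isProbabilityMeasure {τ : Measure ℝ} (hα0 : 0 < α) (hθ : 0 < θ)
    (hτ : IsTiltedStable α (α * θ) τ) : IsProbabilityMeasure τ := by
  obtain ⟨m, hm, rfl⟩ := hτ
  exact isProbabilityMeasure_powerTilt hα0 hθ hm

/-- The generalized Stieltjes transform of `S_α / T_{α,αθ}`. -/
theorem ratio_stieltjes {τ : Measure ℝ} (hα0 : 0 < α) (hθ : 0 < θ) (hμ : IsPositiveStable α μ)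
    (hτ : IsTiltedStable α (α * θ) τ) {r : ℝ} (hr : 0 < r) :
    ∫⁻ x, ENNReal.ofReal ((r + x) ^ (-(α * θ))) ∂((μ.prod τ).map fun p => p.1 / p.2) =
      ENNReal.ofReal ((1 + r ^ α) ^ (-θ)) := by
  have := hμ.isProbabilityMeasure
  have := hτ.isProbabilityMeasure hα0 hθ
  obtain ⟨m, hm, rfl⟩ := hτ
  have := hm.isProbabilityMeasure
  have hG := Real.Gamma_pos_of_pos (mul_pos hα0 hθ)
  have hG' := Real.Gamma_pos_of_pos hθ
  have hC : 0 < 1 / α * Real.Gamma θ / Real.Gamma (α * θ) := by positivity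
  rw [lintegral_map (by fun_prop) (by fun_prop), lintegral_prod _ (by fun_prop)]
  -- The tilt weight turns `(r + s/t)^(-αθ)` into `(r t + s)^(-αθ)`, the negative moment computed
  -- above with `l = 1/r`.
  have e : ∀ᵐ s ∂μ, ∫⁻ t, ENNReal.ofReal ((r + s / t) ^ (-(α * θ))) ∂(powerTilt (α * θ) m) =
      ENNReal.ofReal (1 / α * Real.Gamma θ / Real.Gamma (α * θ))⁻¹ *
        (ENNReal.ofReal (r ^ (-(α * θ))) *
        ∫⁻ t, ENNReal.ofReal ((t + r⁻¹ * s) ^ (-(α * θ))) ∂m) := by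
    filter_upwards [hμ.ae_pos hα0] with s hs
    rw [powerTilt, powerTilt_moment hα0 hθ hm, lintegral_smul_measure,
      lintegral_withDensity_eq_lintegral_mul _ (by fun_prop) (by fun_prop),
      ← ENNReal.ofReal_inv_of_pos hC, smul_eq_mul,
      ← lintegral_const_mul (ENNReal.ofReal (r ^ (-(α * θ)))) (by fun_prop)]
    congr 1
    refine lintegral_congr_ae ?_
    filter_upwards [hm.ae_pos hα0] with t ht
    simp only [Pi.mul_apply]
    rw [← ENNReal.ofReal_mul (by positivity), ← ENNReal.ofReal_mul (by positivity),
      ← Real.mul_rpow ht.le (by positivity), ← Real.mul_rpow hr.le (by positivity)]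
    congr 2
    field_simp
  rw [lintegral_congr_ae e, lintegral_const_mul _ (by fun_prop),
    lintegral_const_mul _ (by fun_prop),
    lintegral_stable_add_rpow hα0 hθ hμ hm (inv_pos.2 hr).le, ← ENNReal.ofReal_mul (by positivity),
    ← ENNReal.ofReal_mul (by positivity), ← rpow_mul_one_add_rpow hr]
  congr 1
  field_simp

theorem ratio_nonneg {τ : Measure ℝ} (hα0 : 0 < α) (hθ : 0 < θ) (hμ : IsPositiveStable α μ)
    (hτ : IsTiltedStable α (α * θ) τ) :
    ∀ᵐ x ∂((μ.prod τ).map fun p => p.1 / p.2), 0 ≤ x := by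
  have := hμ.isProbabilityMeasure
  have := hτ.isProbabilityMeasure hα0 hθ
  obtain ⟨m, hm, rfl⟩ := hτ
  refine (ae_map_iff (by fun_prop) measurableSet_Ici).2 ?_
  filter_upwards [Measure.quasiMeasurePreserving_fst.ae (hμ.ae_pos hα0),
    Measure.quasiMeasurePreserving_snd.ae (powerTilt_ae_pos hα0 hm)] with p h1 h2
  exact (div_pos h1 h2).le

end StableRatio

/-! ### Local time at an independent stable time. -/

section LocalTime

variable {Ω : Type*} [MeasurableSpace Ω]

/-- The approximation of `s` from above on the grid of step `1 / (n + 1)`. -/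
noncomputable def gridAbove (n : ℕ) (s : ℝ≥0) : ℝ≥0 := ((⌊(n + 1) * s⌋₊ : ℝ≥0) + 1) / (n + 1)

theorem le_gridAbove (n : ℕ) (s : ℝ≥0) : s ≤ gridAbove n s := by
  rw [gridAbove, le_div_iff₀ (by positivity), mul_comm]
  exact (Nat.lt_floor_add_one _).le

theorem gridAbove_le (n : ℕ) (s : ℝ≥0) : gridAbove n s ≤ s + 1 / (n + 1) := by
  rw [gridAbove, add_div]
  gcongr
  rw [div_le_iff₀ (by positivity), mul_comm]
  exact Nat.floor_le (by positivity)

/-- The limit is taken from above because the paths are only right-continuous. -/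
theorem tendsto_gridAbove (s : ℝ≥0) :
    Tendsto (fun n => gridAbove n s) atTop (𝓝[≥] s) := by
  refine tendsto_nhdsWithin_iff.2 ⟨?_, Eventually.of_forall fun n => le_gridAbove n s⟩
  refine tendsto_of_tendsto_of_tendsto_of_le_of_le tendsto_const_nhds ?_
    (fun n => le_gridAbove n s) (fun n => gridAbove_le n s)
  simpa using (tendsto_one_div_add_atTop_nhds_zero_nat (𝕜 := ℝ≥0)).const_add s

theorem measurable_eval_nat {Z : ℕ → Ω → ℝ} (hZ : ∀ k, Measurable (Z k)) {K : Ω → ℕ}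
    (hK : Measurable K) : Measurable fun ω => Z (K ω) ω :=
  (measurable_from_prod_countable_right (f := fun p : ℕ × Ω => Z p.1 p.2) hZ).comp
    (hK.prodMk measurable_id)

theorem measurable_process_gridAbove {Y : ℝ≥0 → Ω → ℝ} {S : Ω → ℝ≥0} (hY : ∀ t, Measurable (Y t))
    (hS : Measurable S) (n : ℕ) : Measurable fun ω => Y (gridAbove n (S ω)) ω := by
  have hK : Measurable fun ω => ⌊(n + 1) * S ω⌋₊ := by fun_prop
  simp only [gridAbove]
  exact measurable_eval_nat (Z := fun k => Y (((k : ℝ≥0) + 1) / (n + 1))) (fun k => hY _) hK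

variable {α θ : ℝ} {P : Measure Ω} [IsProbabilityMeasure P]

/-- Evaluation of a right-continuous process at an independent random time. -/
theorem map_process_at_indep {ℓ : ℝ≥0 → Ω → ℝ} {X : ℝ≥0 → Ω → ℝ} {S : Ω → ℝ≥0}
    (hℓ : ∀ t, Measurable (ℓ t)) (hX : ∀ t, Measurable (X t)) (hS : Measurable S)
    (hℓc : ∀ ω t, ContinuousWithinAt (fun s => ℓ s ω) (Ici t) t)
    (hXc : ∀ ω t, ContinuousWithinAt (fun s => X s ω) (Ici t) t)
    (hlaw : ∀ t, P.map (ℓ t) = P.map (X t)) (hℓi : ∀ t, IndepFun S (ℓ t) P)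
    (hXi : ∀ t, IndepFun S (X t) P) :
    Measurable (fun ω => ℓ (S ω) ω) ∧
      P.map (fun ω => ℓ (S ω) ω) = P.map fun ω => X (S ω) ω := by
  set K : ℕ → Ω → ℕ := fun n ω => ⌊(n + 1) * S ω⌋₊ with hK
  have hKm : ∀ n, Measurable (K n) := fun n => by fun_prop
  have hmeas : ∀ {Y : ℝ≥0 → Ω → ℝ}, (∀ t, Measurable (Y t)) →
      ∀ n, Measurable fun ω => Y (gridAbove n (S ω)) ω := fun hY n =>
    measurable_process_gridAbove hY hS n
  have hmeas' : ∀ {Y : ℝ≥0 → Ω → ℝ}, (∀ t, Measurable (Y t)) →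
      (∀ ω t, ContinuousWithinAt (fun s => Y s ω) (Ici t) t) →
      Measurable fun ω => Y (S ω) ω := fun hY hYc =>
    measurable_of_tendsto_metrizable (hmeas hY)
      (tendsto_pi_nhds.2 fun ω => (hYc ω (S ω)).tendsto.comp (tendsto_gridAbove (S ω)))
  -- The discretized time has countably many values, so independence of `S` from each single `Y t`
  -- lets only the one-dimensional laws of `Y` enter.
  have hgrid : ∀ {Y : ℝ≥0 → Ω → ℝ}, (∀ t, Measurable (Y t)) → (∀ t, IndepFun S (Y t) P) →
      ∀ (n : ℕ) (f : BoundedContinuousFunction ℝ ℝ≥0),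
      ∫⁻ ω, f (Y (gridAbove n (S ω)) ω) ∂P =
        ∑' k : ℕ, P (K n ⁻¹' {k}) * ∫⁻ y, f y ∂(P.map (Y (((k : ℝ≥0) + 1) / (n + 1)))) := by
    intro Y hY hYi n f
    have hfm : Measurable fun y => (f y : ℝ≥0∞) := by
      have := f.continuous.measurable
      fun_prop
    have hun : ⋃ k, K n ⁻¹' {k} = univ := by
      ext ω; simp
    rw [← setLIntegral_univ, ← hun, lintegral_iUnion
      (fun k => hKm n (measurableSet_singleton k))
      (fun i j hij => Disjoint.preimage _ (by simpa using hij))]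
    congr 1
    ext k
    have hset : MeasurableSet (K n ⁻¹' {k}) := hKm n (measurableSet_singleton k)
    rw [lintegral_map hfm (hY _), ← lintegral_indicator_one hset, ← lintegral_indicator hset]
    have hind : IndepFun ((K n ⁻¹' {k}).indicator (1 : Ω → ℝ≥0∞))
        (fun ω => (f (Y (((k : ℝ≥0) + 1) / (n + 1)) ω) : ℝ≥0∞)) P := by
      have h1 : Measurable fun s : ℝ≥0 => ({k} : Set ℕ).indicator (1 : ℕ → ℝ≥0∞)
          ⌊(n + 1) * s⌋₊ :=
        (measurable_of_countable (({k} : Set ℕ).indicator (1 : ℕ → ℝ≥0∞))).comp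
          (by fun_prop : Measurable fun s : ℝ≥0 => ⌊(n + 1) * s⌋₊)
      exact (hYi _).comp h1 hfm
    refine Eq.trans (lintegral_congr fun ω => ?_)
      (lintegral_mul_eq_lintegral_mul_lintegral_of_indepFun (measurable_one.indicator hset)
        (hfm.comp (hY _)) hind)
    by_cases hω : ω ∈ K n ⁻¹' {k}
    · have hk : ⌊(n + 1) * S ω⌋₊ = k := hω
      simp [hω, gridAbove, hk]
    · simp [hω]
  have hlim : ∀ {Y : ℝ≥0 → Ω → ℝ}, (∀ t, Measurable (Y t)) →
      (∀ ω t, ContinuousWithinAt (fun s => Y s ω) (Ici t) t) →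
      ∀ f : BoundedContinuousFunction ℝ ℝ≥0,
      Tendsto (fun n => ∫⁻ ω, f (Y (gridAbove n (S ω)) ω) ∂P) atTop
        (𝓝 (∫⁻ ω, f (Y (S ω) ω) ∂P)) := by
    intro Y hY hYc f
    refine tendsto_lintegral_of_dominated_convergence (fun _ => (nndist f 0 : ℝ≥0∞)) (fun n => ?_)
      (fun n => ae_of_all _ fun ω => ?_) (by simp) (ae_of_all _ fun ω => ?_)
    · exact (f.continuous.measurable.comp (hmeas hY n)).coe_nnreal_ennreal
    · exact ENNReal.coe_le_coe.2 (BoundedContinuousFunction.NNReal.upper_bound f _)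
    · exact (ENNReal.continuous_coe.tendsto _).comp ((f.continuous.tendsto _).comp
        ((hYc ω (S ω)).tendsto.comp (tendsto_gridAbove (S ω))))
  refine ⟨hmeas' hℓ hℓc, ?_⟩
  have := Measure.isProbabilityMeasure_map (μ := P) (hmeas' hℓ hℓc).aemeasurable
  have := Measure.isProbabilityMeasure_map (μ := P) (hmeas' hX hXc).aemeasurable
  refine ext_of_forall_lintegral_eq_of_IsFiniteMeasure fun f => ?_
  have hfm : Measurable fun y => (f y : ℝ≥0∞) := by
    have := f.continuous.measurable
    fun_prop
  rw [lintegral_map hfm (hmeas' hℓ hℓc), lintegral_map hfm (hmeas' hX hXc)]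
  refine tendsto_nhds_unique (hlim hℓ hℓc f) ?_
  simp_rw [hgrid hℓ hℓi, hlaw, ← hgrid hX hXi]
  exact hlim hX hXc f

theorem map_div_of_indepFun {S T : Ω → ℝ} (hS : Measurable S) (hT : Measurable T)
    (hind : IndepFun S T P) :
    P.map (fun ω => S ω / T ω) = ((P.map S).prod (P.map T)).map fun p => p.1 / p.2 := by
  rw [← (indepFun_iff_map_prod_eq_prod_map_map hS.aemeasurable hT.aemeasurable).1 hind,
    Measure.map_map (by fun_prop) (by fun_prop)]
  rfl

/-- The law of the local time at an independent stable time. -/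
theorem map_localTime_rpow (hα0 : 0 < α) (hθ : 0 < θ) {ℓ : ℝ≥0 → Ω → ℝ} {S : Ω → ℝ}
    (hℓ : IsPDLocalTime α (α * θ) ℓ P) (hS : Measurable S)
    (hSs : IsPositiveStable α (P.map S)) (hind : IndepFun S (fun ω t => ℓ t ω) P) :
    Measurable (fun ω => ℓ (S ω).toNNReal ω ^ (1 / α)) ∧
    ∃ τ : Measure ℝ, IsTiltedStable α (α * θ) τ ∧
      P.map (fun ω => ℓ (S ω).toNNReal ω ^ (1 / α)) =
        ((P.map S).prod τ).map fun p => p.1 / p.2 := by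
  obtain ⟨τ, hτ, hτlaw⟩ := hℓ.law_one
  have := hτ.isProbabilityMeasure hα0 hθ
  have hSn : Measurable fun ω => (S ω).toNNReal := by fun_prop
  have hm1 := hℓ.measurable 1
  have hi : ∀ t, IndepFun (fun ω => (S ω).toNNReal) (ℓ t) P := fun t =>
    hind.comp measurable_real_toNNReal (measurable_pi_apply t)
  have hcont : Continuous fun t : ℝ≥0 => (t : ℝ) ^ α :=
    (Real.continuous_rpow_const hα0.le).comp NNReal.continuous_coe
  -- The comparison process `t^α ℓ_1` has the same one-dimensional laws by scaling, and its value at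
  -- `S` is explicit.
  obtain ⟨hm, hmap⟩ := map_process_at_indep (X := fun t ω => (t : ℝ) ^ α * ℓ 1 ω) hℓ.measurable
    (fun t => by fun_prop) hSn hℓ.right_continuous
    (fun ω t => (hcont.mul continuous_const).continuousWithinAt) hℓ.scaling hi
    (fun t => (hi 1).comp measurable_id (measurable_id.const_mul _))
  refine ⟨hm.pow_const _, τ, hτ, ?_⟩
  have h1 : P.map (fun ω => ℓ (S ω).toNNReal ω ^ (1 / α)) =
      P.map fun ω => (((S ω).toNNReal : ℝ) ^ α * ℓ 1 ω) ^ (1 / α) := by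
    have h := congrArg (fun m => m.map fun y : ℝ => y ^ (1 / α)) hmap
    rwa [Measure.map_map (by fun_prop) hm, Measure.map_map (by fun_prop)
      (by fun_prop)] at h
  have h2 : P.map (fun ω => (((S ω).toNNReal : ℝ) ^ α * ℓ 1 ω) ^ (1 / α)) =
      P.map fun ω => S ω * ℓ 1 ω ^ (1 / α) := by
    refine Measure.map_congr ?_
    filter_upwards [ae_of_ae_map hS.aemeasurable hSs.ae_nonneg] with ω hω
    rw [Real.coe_toNNReal _ hω, Real.mul_rpow (by positivity) (hℓ.nonneg 1 ω),
      ← Real.rpow_mul hω, mul_one_div_cancel hα0.ne', Real.rpow_one]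
  have hi1 : IndepFun S (fun ω => ℓ 1 ω ^ (1 / α)) P :=
    hind.comp (φ := id) (ψ := fun f : ℝ≥0 → ℝ => f 1 ^ (1 / α)) measurable_id (by fun_prop)
  have h3 : P.map (fun ω => S ω * ℓ 1 ω ^ (1 / α)) =
      ((P.map S).prod (τ.map fun t => 1 / t)).map fun p => p.1 * p.2 := by
    rw [← hτlaw, ← (indepFun_iff_map_prod_eq_prod_map_map hS.aemeasurable (by fun_prop)).1 hi1,
      Measure.map_map (by fun_prop) (by fun_prop)]
    rfl
  have h4 : (P.map S).prod (τ.map fun t => 1 / t) =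
      ((P.map S).prod τ).map (Prod.map id fun t => 1 / t) := by
    have := Measure.isProbabilityMeasure_map (μ := P) hS.aemeasurable
    rw [← Measure.map_prod_map _ _ measurable_id (by fun_prop), Measure.map_id]
  rw [h1, h2, h3, h4, Measure.map_map (by fun_prop) (by fun_prop)]
  congr 1
  ext p
  simp [div_eq_mul_inv]

end LocalTime

/-! ### The derivative of `Δ` and its size. -/

section DeltaDerivative

variable {α θ : ℝ}

theorem hasDerivAt_lampertiPoly {x : ℝ} (hx : 0 < x) :
    HasDerivAt (lampertiPoly α) (2 * α * x ^ (α - 1) * (x ^ α + Real.cos (π * α))) x := by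
  have h1 : HasDerivAt (fun x : ℝ => x ^ α) (α * x ^ (α - 1)) x :=
    Real.hasDerivAt_rpow_const (Or.inl hx.ne')
  have h2 := ((h1.add_const (Real.cos (π * α))).fun_pow 2).add_const (Real.sin (π * α) ^ 2)
  refine (h2.congr_of_eventuallyEq ?_).congr_deriv (by norm_num; ring)
  filter_upwards [lt_mem_nhds hx] with y hy using lampertiPoly_eq hy.le

theorem hasDerivAt_lampertiDelta (hα0 : 0 < α) (hα1 : α < 1) {x : ℝ} (hx : 0 < x) :
    HasDerivAt (lampertiDelta α θ) (lampertiD α θ x) x := by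
  have hp := lampertiPoly_pos hα0 hα1 hx.le
  have hs := sin_pi_mul_pos hα0 hα1
  have h1 := ((hasDerivAt_lampertiCDF hα0 hα1 hx).const_mul (π * θ * α)).sin
  have h2 := (hasDerivAt_lampertiPoly (α := α) hx).rpow_const (p := θ / 2) (Or.inl hp.ne')
  have h3 : HasDerivAt (lampertiDelta α θ) _ x :=
    (h1.div h2 (by positivity)).const_mul (1 / π)
  refine h3.congr_deriv ?_
  -- The second term of the expansion accounts for the `cos(πα)` in the derivative of the
  -- polynomial.
  have e : Real.sin (π * α * (1 - θ * lampertiCDF α x)) =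
      Real.sin (π * α) * Real.cos (π * θ * α * lampertiCDF α x) -
        Real.cos (π * α) * Real.sin (π * θ * α * lampertiCDF α x) := by
    rw [← Real.sin_sub]
    congr 1
    ring
  rw [lampertiD, e, lampertiDensity, Real.rpow_sub_one hp.ne', Real.rpow_add_one hp.ne']
  have hq : 0 < lampertiPoly α x ^ (θ / 2) := by positivity
  field_simp
  ring

theorem crDelta_eventuallyEq (hα0 : 0 < α) (hα1 : α < 1) {x : ℝ} (hx : 0 < x) :
    crDelta (α * θ) (lampertiLaw α) =ᶠ[𝓝 x] lampertiDelta α θ := by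
  filter_upwards [lt_mem_nhds hx] with y hy using crDelta_lampertiLaw hα0 hα1 hy.le

theorem measurable_lampertiD : Measurable (lampertiD α θ) := by
  have := measurable_lampertiPoly (α := α)
  have := measurable_lampertiCDF (α := α)
  unfold lampertiD
  fun_prop

theorem continuousOn_lampertiDelta (hα0 : 0 < α) (hα1 : α < 1) :
    ContinuousOn (lampertiDelta α θ) (Ici 0) := by
  have h1 := continuous_lampertiCDF hα0
  have h2 : Continuous fun x : ℝ => x ^ α := Real.continuous_rpow_const hα0.le
  have h3 : Continuous fun x : ℝ => x ^ (2 * α) := Real.continuous_rpow_const (by positivity)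
  have h4 : Continuous (lampertiPoly α) := by
    unfold lampertiPoly
    fun_prop
  have h5 : ∀ x ∈ Ici (0 : ℝ), lampertiPoly α x ^ (θ / 2) ≠ 0 := fun x hx =>
    (Real.rpow_pos_of_pos (lampertiPoly_pos hα0 hα1 hx) _).ne'
  have h6 : ContinuousOn (fun x => lampertiPoly α x ^ (θ / 2)) (Ici 0) :=
    h4.continuousOn.rpow_const fun x hx => Or.inl (lampertiPoly_pos hα0 hα1 hx).ne'
  exact continuousOn_const.mul (ContinuousOn.div (by fun_prop) h6 h5)

theorem lampertiDelta_zero (hα0 : 0 < α) (hα1 : α < 1) : lampertiDelta α θ 0 = 0 := by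
  rw [lampertiDelta, lampertiCDF_zero hα0 hα1]
  simp

/-- The numerator is at most `1 + x^α`, which one factor of the polynomial `P` absorbs: `1 + y ≤ 2(1
+ y²)` and `(1 + y²) sin²(πα) ≤ 2P` for `y = x^α`, hence the constant `4`. -/
theorem exists_abs_lampertiD_le (hα0 : 0 < α) (hα1 : α < 1) (hθ : 0 < θ) :
    ∃ C : ℝ, 0 ≤ C ∧ ∀ x : ℝ, 0 < x → |lampertiD α θ x| ≤ C * x ^ (α - 1) := by
  have hs := sin_pi_mul_pos hα0 hα1
  have hπ := Real.pi_pos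
  set σ := Real.sin (π * α) with hσ
  refine ⟨α * θ / π * (4 / (σ ^ 2 * (σ ^ 2) ^ (θ / 2))), by positivity, fun x hx => ?_⟩
  have hp := lampertiPoly_pos hα0 hα1 hx.le
  have h1 := sin_sq_le_lampertiPoly (α := α) hx.le
  have h2 := rpow_mul_sin_sq_le_lampertiPoly (α := α) hx.le
  have hy : 0 < x ^ α := by positivity
  have hx' : 0 < x ^ (α - 1) := by positivity
  have h3 : (σ ^ 2) ^ (θ / 2) ≤ lampertiPoly α x ^ (θ / 2) := by gcongr
  have h4 : (1 + x ^ α) * σ ^ 2 ≤ 4 * lampertiPoly α x := by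
    have : 1 + x ^ α ≤ 2 * (1 + (x ^ α) ^ 2) := by nlinarith [sq_nonneg (x ^ α - 1)]
    have := mul_le_mul_of_nonneg_right this (sq_nonneg σ)
    linarith
  have h5 : |Real.sin (π * α * (1 - θ * lampertiCDF α x))
        - x ^ α * Real.sin (π * θ * α * lampertiCDF α x)| ≤ 1 + x ^ α := by
    refine (abs_sub _ _).trans (add_le_add (Real.abs_sin_le_one _) ?_)
    rw [abs_mul, abs_of_pos hy]
    exact mul_le_of_le_one_right hy.le (Real.abs_sin_le_one _)
  rw [lampertiD, abs_mul, abs_of_pos (a := α * θ * x ^ (α - 1) / π) (by positivity),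
    Real.rpow_add_one hp.ne', abs_div, abs_of_pos (a := _ * _) (by positivity)]
  have h6 : |Real.sin (π * α * (1 - θ * lampertiCDF α x))
        - x ^ α * Real.sin (π * θ * α * lampertiCDF α x)| /
        (lampertiPoly α x ^ (θ / 2) * lampertiPoly α x) ≤ 4 / (σ ^ 2 * (σ ^ 2) ^ (θ / 2)) := by
    refine (div_le_div_of_nonneg_right h5 (by positivity)).trans ?_
    rw [div_le_div_iff₀ (by positivity) (by positivity)]
    calc (1 + x ^ α) * (σ ^ 2 * (σ ^ 2) ^ (θ / 2))
        = ((1 + x ^ α) * σ ^ 2) * (σ ^ 2) ^ (θ / 2) := by ring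
      _ ≤ (4 * lampertiPoly α x) * lampertiPoly α x ^ (θ / 2) := by gcongr
      _ = _ := by ring
  calc _ ≤ α * θ * x ^ (α - 1) / π * (4 / (σ ^ 2 * (σ ^ 2) ^ (θ / 2))) := by gcongr
    _ = _ := by ring

end DeltaDerivative

/-! ### Fractional integrals and their differentiation. -/

section AbelTransform

variable {c : ℝ}

theorem intervalIntegrable_beta {b : ℝ} (hb : 0 < b) (hc : 0 < c) :
    IntervalIntegrable (fun u : ℝ => (1 - u) ^ (c - 1) * u ^ (b - 1)) volume 0 1 := by
  have h := (Complex.betaIntegral_convergent (u := b) (v := c) (by simpa) (by simpa)).norm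
  rw [intervalIntegrable_iff_integrableOn_Ioo_of_le zero_le_one] at h ⊢
  refine h.congr_fun (fun u hu => ?_) measurableSet_Ioo
  have h1 : (0 : ℝ) < 1 - u := sub_pos.2 hu.2
  have e1 : ((1 : ℂ) - u) = ((1 - u : ℝ) : ℂ) := by push_cast; rfl
  simp only
  rw [norm_mul, e1, Complex.norm_cpow_eq_rpow_re_of_pos hu.1,
    Complex.norm_cpow_eq_rpow_re_of_pos h1]
  simp [mul_comm]

theorem abel_comp_mul (g : ℝ → ℝ) {x : ℝ} (hx : 0 < x) {u : ℝ} (hu : u ≤ 1) :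
    (x - x * u) ^ (c - 1) * g (x * u) = x ^ (c - 1) * ((1 - u) ^ (c - 1) * g (x * u)) := by
  rw [← mul_one_sub, Real.mul_rpow hx.le (by linarith), mul_assoc]

/-- The substitution `t = x u` fixes the singularity of the kernel at `u = 1`, so one may
differentiate in `x` under the integral even when `c < 1`. -/
theorem abel_integral_eq (g : ℝ → ℝ) {x : ℝ} (hx : 0 < x) :
    ∫ t in (0 : ℝ)..x, (x - t) ^ (c - 1) * g t =
      x ^ c * ∫ u in (0 : ℝ)..1, (1 - u) ^ (c - 1) * g (x * u) := by
  have h := intervalIntegral.integral_comp_mul_left (a := 0) (b := 1)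
    (fun t => (x - t) ^ (c - 1) * g t) hx.ne'
  rw [mul_zero, mul_one] at h
  have h2 : ∫ u in (0 : ℝ)..1, (x - x * u) ^ (c - 1) * g (x * u) =
      x ^ (c - 1) * ∫ u in (0 : ℝ)..1, (1 - u) ^ (c - 1) * g (x * u) := by
    rw [← intervalIntegral.integral_const_mul]
    refine intervalIntegral.integral_congr fun u hu => ?_
    rw [uIcc_of_le zero_le_one] at hu
    exact abel_comp_mul g hx hu.2
  rw [h2, Real.rpow_sub_one hx.ne', smul_eq_mul] at h
  field_simp at h
  linarith

theorem abel_intervalIntegrable (g : ℝ → ℝ) {x : ℝ} (hx : 0 < x)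
    (hg : IntervalIntegrable (fun u => (1 - u) ^ (c - 1) * g (x * u)) volume 0 1) :
    IntervalIntegrable (fun t => (x - t) ^ (c - 1) * g t) volume 0 x := by
  have h : IntervalIntegrable (fun u => (x - x * u) ^ (c - 1) * g (x * u)) volume 0 1 := by
    refine (hg.const_mul (x ^ (c - 1))).congr fun u hu => ?_
    rw [uIoc_of_le zero_le_one] at hu
    exact (abel_comp_mul g hx hu.2).symm
  have h1 := h.comp_mul_left (c := x⁻¹)
  simpa only [mul_inv_cancel_left₀ hx.ne', zero_div, one_div, inv_inv] using h1

/-- A power bound suffices for the fractional integral of order `c` to converge. -/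
theorem intervalIntegrable_of_le_rpow {b C : ℝ} (hb : 0 < b) (hc : 0 < c) {g : ℝ → ℝ}
    (hgm : Measurable g) (hg : ∀ t, 0 < t → |g t| ≤ C * t ^ (b - 1)) {x : ℝ} (hx : 0 < x) :
    IntervalIntegrable (fun u => (1 - u) ^ (c - 1) * g (x * u)) volume 0 1 := by
  refine ((intervalIntegrable_beta hb hc).const_mul (C * x ^ (b - 1))).mono_fun'
    (by fun_prop : Measurable _).aestronglyMeasurable ?_
  rw [uIoc_of_le zero_le_one]
  filter_upwards [ae_restrict_mem measurableSet_Ioc] with u hu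
  have h1 : (0 : ℝ) ≤ (1 - u) ^ (c - 1) := Real.rpow_nonneg (sub_nonneg.2 hu.2) _
  have h2 := hg (x * u) (mul_pos hx hu.1)
  rw [norm_mul, Real.norm_of_nonneg h1, Real.norm_eq_abs]
  calc _ ≤ (1 - u) ^ (c - 1) * (C * (x * u) ^ (b - 1)) := by gcongr
    _ = _ := by rw [Real.mul_rpow hx.le hu.1.le]; ring

/-- Differentiation of a fractional integral of order `c`. -/
theorem hasDerivAt_abel {b C K : ℝ} (hb : 0 < b) (hb1 : b ≤ 1) (hC : 0 ≤ C) (hc : 0 < c)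
    {g g' : ℝ → ℝ} (hgm : Measurable g) (hgm' : Measurable g') (hg0 : g 0 = 0)
    (hgc : ContinuousOn g (Ici 0)) (hgK : ∀ t, 0 < t → |g t| ≤ K)
    (hg : ∀ t, 0 < t → HasDerivAt g (g' t) t) (hg' : ∀ t, 0 < t → |g' t| ≤ C * t ^ (b - 1))
    {x : ℝ} (hx : 0 < x) :
    HasDerivAt (fun x => ∫ t in (0 : ℝ)..x, (x - t) ^ (c - 1) * g t)
      (∫ t in (0 : ℝ)..x, (x - t) ^ (c - 1) * g' t) x := by
  have hgi : ∀ {y : ℝ}, 0 < y →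
      IntervalIntegrable (fun u => (1 - u) ^ (c - 1) * g (y * u)) volume 0 1 := fun hy =>
    intervalIntegrable_of_le_rpow one_pos hc hgm (C := K) (by simpa using hgK) hy
  have hgi' : ∀ {y : ℝ}, 0 < y →
      IntervalIntegrable (fun u => (1 - u) ^ (c - 1) * g' (y * u)) volume 0 1 := fun hy =>
    intervalIntegrable_of_le_rpow hb hc hgm' hg' hy
  have hui : ∀ {m : ℝ → ℝ}, IntervalIntegrable m volume 0 1 →
      IntervalIntegrable (fun u => u * m u) volume 0 1 := fun hm =>
    hm.continuousOn_mul continuous_id.continuousOn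
  have hI : HasDerivAt (fun y => ∫ u in (0 : ℝ)..1, (1 - u) ^ (c - 1) * g (y * u))
      (∫ u in (0 : ℝ)..1, (1 - u) ^ (c - 1) * (g' (x * u) * u)) x := by
    refine (intervalIntegral.hasDerivAt_integral_of_dominated_loc_of_deriv_le
      (F := fun y u => (1 - u) ^ (c - 1) * g (y * u))
      (F' := fun y u => (1 - u) ^ (c - 1) * (g' (y * u) * u))
      (bound := fun u => (C * (x / 2) ^ (b - 1)) * (u * ((1 - u) ^ (c - 1) * u ^ (b - 1))))
      (Ioi_mem_nhds (half_lt_self hx))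
      (Eventually.of_forall fun y => (by fun_prop : Measurable _).aestronglyMeasurable)
      (hgi hx) (by fun_prop : Measurable _).aestronglyMeasurable ?_
      ((hui (intervalIntegrable_beta hb hc)).const_mul _) ?_).2
    · refine ae_of_all _ fun u hu y hy => ?_
      rw [uIoc_of_le zero_le_one] at hu
      have hy' : x / 2 < y := hy
      have hy0 : 0 < y := (half_pos hx).trans hy'
      have h1 : (0 : ℝ) ≤ (1 - u) ^ (c - 1) := Real.rpow_nonneg (sub_nonneg.2 hu.2) _
      have hu0 : 0 < u := hu.1
      have h2 := hg' (y * u) (mul_pos hy0 hu.1)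
      have h3 : y ^ (b - 1) ≤ (x / 2) ^ (b - 1) :=
        Real.rpow_le_rpow_of_nonpos (half_pos hx) hy'.le (by linarith)
      rw [norm_mul, norm_mul, Real.norm_of_nonneg h1, Real.norm_eq_abs, Real.norm_of_nonneg hu.1.le]
      calc _ ≤ (1 - u) ^ (c - 1) * (C * (y * u) ^ (b - 1) * u) := by gcongr
        _ = (C * y ^ (b - 1)) * (u * ((1 - u) ^ (c - 1) * u ^ (b - 1))) := by
          rw [Real.mul_rpow hy0.le hu.1.le]; ring
        _ ≤ _ := by gcongr
    · refine ae_of_all _ fun u hu y hy => ?_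
      rw [uIoc_of_le zero_le_one] at hu
      have hy0 : 0 < y := (half_pos hx).trans hy
      have h := (hg (y * u) (mul_pos hy0 hu.1)).comp y ((hasDerivAt_id y).mul_const u)
      simpa using h.const_mul ((1 - u) ^ (c - 1))
  have hR : HasDerivAt (fun x => ∫ t in (0 : ℝ)..x, (x - t) ^ (c - 1) * g t) _ x :=
    ((Real.hasDerivAt_rpow_const (p := c) (Or.inl hx.ne')).mul hI).congr_of_eventuallyEq (by
      filter_upwards [lt_mem_nhds hx] with y hy using abel_integral_eq g hy)
  refine hR.congr_deriv ?_
  rw [abel_integral_eq g' hx]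
  -- Integration by parts with `(1 - u)^c g(xu)`, whose boundary values vanish since `g 0 = 0` and
  -- `c > 0`. It trades the term in `g` that comes from differentiating `x^c` for terms in `g'`.
  have hxx : ∀ t ∈ Ioo (0 : ℝ) 1, HasDerivAt (fun u => (1 - u) ^ c * g (x * u))
      (x * ((1 - t) ^ (c - 1) * g' (x * t) - t * ((1 - t) ^ (c - 1) * g' (x * t))) -
        c * ((1 - t) ^ (c - 1) * g (x * t))) t := by
    intro t ht
    have h1 : (0 : ℝ) < 1 - t := sub_pos.2 ht.2
    have h2 := ((hasDerivAt_id t).const_sub 1).rpow_const (p := c) (Or.inl h1.ne')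
    have h3 := (hg (x * t) (mul_pos hx ht.1)).comp t ((hasDerivAt_id t).const_mul x)
    refine (h2.mul h3).congr_deriv ?_
    have h4 : (1 - t) ^ c = (1 - t) ^ (c - 1) * (1 - t) := by
      rw [← Real.rpow_add_one h1.ne', sub_add_cancel]
    simp only [id, h4, Function.comp]
    ring
  have hcont : ContinuousOn (fun u : ℝ => (1 - u) ^ c * g (x * u)) (Icc 0 1) := by
    have h1 : Continuous fun u : ℝ => (1 - u) ^ c :=
      (Real.continuous_rpow_const hc.le).comp (continuous_const.sub continuous_id)
    refine h1.continuousOn.mul (hgc.comp (by fun_prop) fun u hu => ?_)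
    exact mul_nonneg hx.le hu.1
  have hi2 := (((hgi' hx).sub (hui (hgi' hx))).const_mul x).sub ((hgi hx).const_mul c)
  have hparts := intervalIntegral.integral_eq_sub_of_hasDerivAt_of_le zero_le_one hcont hxx hi2
  rw [intervalIntegral.integral_sub (((hgi' hx).sub (hui (hgi' hx))).const_mul x)
    ((hgi hx).const_mul c), intervalIntegral.integral_const_mul,
    intervalIntegral.integral_const_mul, intervalIntegral.integral_sub (hgi' hx) (hui (hgi' hx)),
    mul_zero, hg0, sub_self, Real.zero_rpow hc.ne', mul_zero, zero_mul, sub_zero] at hparts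
  have e : ∫ u in (0 : ℝ)..1, (1 - u) ^ (c - 1) * (g' (x * u) * u) =
      ∫ u in (0 : ℝ)..1, u * ((1 - u) ^ (c - 1) * g' (x * u)) := by
    congr 1
    ext u
    ring
  have e2 : x ^ c = x ^ (c - 1) * x := by rw [← Real.rpow_add_one hx.ne', sub_add_cancel]
  rw [e, e2]
  linear_combination (-x ^ (c - 1)) * hparts

/-- Continuity at `0` of a fractional integral. -/
theorem tendsto_abel_zero {K : ℝ} (hc : 0 < c) {g : ℝ → ℝ} (hgK : ∀ t, 0 < t → |g t| ≤ K) :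
    Tendsto (fun x => ∫ t in (0 : ℝ)..x, (x - t) ^ (c - 1) * g t) (𝓝[>] 0) (𝓝 0) := by
  set B := ∫ u in (0 : ℝ)..1, (1 - u) ^ (c - 1) * u ^ ((1 : ℝ) - 1) with hB
  have h1 : Tendsto (fun x : ℝ => x ^ c * (K * B)) (𝓝[>] 0) (𝓝 0) := by
    have := ((Real.continuous_rpow_const hc.le).tendsto 0).mul_const (K * B)
    rw [Real.zero_rpow hc.ne', zero_mul] at this
    exact this.mono_left nhdsWithin_le_nhds
  refine squeeze_zero_norm' ?_ h1
  filter_upwards [self_mem_nhdsWithin] with x hx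
  have hx' : 0 < x := hx
  rw [abel_integral_eq g hx, norm_mul, Real.norm_of_nonneg (by positivity), hB,
    ← intervalIntegral.integral_const_mul]
  gcongr
  refine intervalIntegral.norm_integral_le_of_norm_le zero_le_one (ae_of_all _ fun u hu => ?_)
    ((intervalIntegrable_beta one_pos hc).const_mul K)
  have h1 : (0 : ℝ) ≤ (1 - u) ^ (c - 1) := Real.rpow_nonneg (sub_nonneg.2 hu.2) _
  rw [norm_mul, Real.norm_of_nonneg h1, Real.norm_eq_abs, sub_self, Real.rpow_zero, mul_one,
    mul_comm]
  gcongr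
  exact hgK _ (mul_pos hx' hu.1)

end AbelTransform

/-! ### Stieltjes transforms of signed densities, fractional integrals and distribution functions.
-/

section Stieltjes

/-- A signed density on `(0, ∞)` with vanishing generalized Stieltjes transform vanishes. -/
theorem ae_eq_zero_of_stieltjes {a : ℝ} (ha : 0 < a) {k : ℝ → ℝ}
    (hk : AEStronglyMeasurable k (volume.restrict (Ioi 0)))
    (hki : ∀ s : ℝ, 0 < s → IntegrableOn (fun x => (s + x) ^ (-a) * k x) (Ioi 0))
    (h : ∀ s : ℝ, 0 < s → ∫ x in Ioi (0 : ℝ), (s + x) ^ (-a) * k x = 0) :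
    k =ᵐ[volume.restrict (Ioi 0)] 0 := by
  set m : Measure ℝ := volume.restrict (Ioi 0) with hm
  have hm0 : ∀ᵐ x ∂m, 0 < x := ae_restrict_mem measurableSet_Ioi
  have hkm : AEMeasurable k m := hk.aemeasurable
  have hpart : ∀ {j : ℝ → ℝ}, AEMeasurable j m → (∀ x, |j x| = |k x|) → ∀ s : ℝ, 0 < s →
      Integrable (fun x => (ENNReal.ofReal (j x)).toReal • (s + x) ^ (-a)) m := by
    intro j hj hjk s hs
    refine (hki s hs).norm.mono' (by
      have : Measurable fun x : ℝ => (s + x) ^ (-a) := by fun_prop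
      exact (hj.ennreal_ofReal.ennreal_toReal.smul this.aemeasurable).aestronglyMeasurable) ?_
    refine ae_of_all _ fun x => ?_
    rw [norm_smul, norm_mul, mul_comm, Real.norm_eq_abs (k x), ← hjk x,
      Real.norm_eq_abs (ENNReal.toReal _),
      ENNReal.toReal_ofReal']
    refine mul_le_mul_of_nonneg_left ?_ (norm_nonneg _)
    rw [abs_of_nonneg (le_max_right _ _)]
    exact max_le (le_abs_self _) (abs_nonneg _)
  have hp := hpart hkm fun _ => rfl
  have hn := hpart hkm.neg fun x => abs_neg (k x)
  have hfin : ∀ {j : ℝ → ℝ}, ∀ᵐ x ∂m, ENNReal.ofReal (j x) < ∞ := fun {j} =>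
    ae_of_all _ fun x => ENNReal.ofReal_lt_top
  -- The positive and negative parts of `k` are densities of two measures with the same transform.
  have heq := measure_eq_of_stieltjes (μ := m.withDensity fun x => ENNReal.ofReal (k x))
    (ν := m.withDensity fun x => ENNReal.ofReal ((-k) x)) ha
    ((withDensity_absolutelyContinuous _ _).ae_le (hm0.mono fun x hx => hx.le))
    ((withDensity_absolutelyContinuous _ _).ae_le (hm0.mono fun x hx => hx.le))
    (fun s hs => (integrable_withDensity_iff_integrable_smul₀' hkm.ennreal_ofReal hfin).2 (hp s hs))
    (fun s hs => (integrable_withDensity_iff_integrable_smul₀' hkm.neg.ennreal_ofReal hfin).2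
      (hn s hs))
    (fun s hs => by
      rw [integral_withDensity_eq_integral_toReal_smul₀ hkm.ennreal_ofReal hfin,
        integral_withDensity_eq_integral_toReal_smul₀ hkm.neg.ennreal_ofReal hfin, ← sub_eq_zero,
        ← integral_sub (hp s hs) (hn s hs), ← h s hs]
      congr 1
      ext x
      rw [← sub_smul, Pi.neg_apply, ENNReal.toReal_ofReal', ENNReal.toReal_ofReal',
        max_zero_sub_max_neg_zero_eq_self, smul_eq_mul, mul_comm])
  rw [withDensity_eq_iff_of_sigmaFinite hkm.ennreal_ofReal hkm.neg.ennreal_ofReal] at heq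
  filter_upwards [heq] with x hx
  have := congrArg ENNReal.toReal hx
  rw [ENNReal.toReal_ofReal', ENNReal.toReal_ofReal', Pi.neg_apply] at this
  have h3 := max_zero_sub_max_neg_zero_eq_self (k x)
  simp only [Pi.zero_apply]
  grind

variable {c : ℝ}

/-- A primitive is `(c(s + t))⁻¹ ((x - t)/(s + x))^c`, where the ratio rises from `0` at `t` to `1`
at infinity. -/
theorem stieltjes_kernel (hc : 0 < c) {s t : ℝ} (hs : 0 < s) (ht : 0 ≤ t) :
    IntegrableOn (fun x => (s + x) ^ (-(c + 1)) * (x - t) ^ (c - 1)) (Ioi t) ∧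
      ∫ x in Ioi t, (s + x) ^ (-(c + 1)) * (x - t) ^ (c - 1) = (c * (s + t))⁻¹ := by
  have hst : 0 < s + t := by linarith
  set G : ℝ → ℝ := fun x => (c * (s + t))⁻¹ * ((x - t) / (s + x)) ^ c with hG
  have hcont : ContinuousWithinAt G (Ici t) t := by
    refine ContinuousAt.continuousWithinAt (ContinuousAt.mul continuousAt_const ?_)
    refine ContinuousAt.rpow_const (ContinuousAt.div (by fun_prop) (by fun_prop) hst.ne')
      (Or.inr hc.le)
  have hderiv : ∀ x ∈ Ioi t, HasDerivAt G ((s + x) ^ (-(c + 1)) * (x - t) ^ (c - 1)) x := by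
    intro x hx
    have h1 : 0 < x - t := sub_pos.2 hx
    have h2 : 0 < s + x := by linarith
    have h3 := ((((hasDerivAt_id x).sub_const t).div ((hasDerivAt_id x).const_add s)
      h2.ne').rpow_const (p := c) (Or.inl (div_pos h1 h2).ne')).const_mul (c * (s + t))⁻¹
    refine h3.congr_deriv ?_
    simp only [id, Pi.div_apply]
    rw [Real.div_rpow h1.le h2.le, Real.rpow_neg h2.le, Real.rpow_add_one h2.ne',
      Real.rpow_sub_one h2.ne']
    have h4 : (0 : ℝ) < (s + x) ^ c := by positivity
    field_simp
    ring
  have hnonneg : ∀ x ∈ Ioi t, 0 ≤ (s + x) ^ (-(c + 1)) * (x - t) ^ (c - 1) := fun x hx => by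
    have h1 : 0 < x - t := sub_pos.2 hx
    have h2 : 0 < s + x := by linarith
    positivity
  have hlim : Tendsto G atTop (𝓝 ((c * (s + t))⁻¹ * 1)) := by
    refine Tendsto.const_mul _ ?_
    have h1 : Tendsto (fun x : ℝ => 1 - (s + t) / (s + x)) atTop (𝓝 (1 - 0)) :=
      (Tendsto.div_atTop tendsto_const_nhds
        (tendsto_atTop_add_const_left _ s tendsto_id)).const_sub 1
    rw [sub_zero] at h1
    have h2 := h1.rpow_const (p := c) (Or.inl one_ne_zero)
    rw [Real.one_rpow] at h2
    refine h2.congr' ?_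
    filter_upwards [eventually_gt_atTop t] with x hx
    have : s + x ≠ 0 := by linarith
    congr 1
    field_simp
    ring
  have hGt : G t = 0 := by simp [hG, Real.zero_rpow hc.ne']
  refine ⟨integrableOn_Ioi_deriv_of_nonneg hcont hderiv hnonneg hlim, ?_⟩
  rw [integral_Ioi_of_hasDerivAt_of_nonneg hcont hderiv hnonneg hlim, hGt, mul_one, sub_zero]

/-- The generalized Stieltjes transform of order `c + 1` of a fractional integral of order `c`. -/
theorem stieltjes_abel (hc : 0 < c) {s : ℝ} (hs : 0 < s) {g : ℝ → ℝ} (hgm : Measurable g)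
    (hg : IntegrableOn (fun t => g t * (s + t)⁻¹) (Ioi 0)) :
    IntegrableOn (fun x => (s + x) ^ (-(c + 1)) * ∫ t in (0 : ℝ)..x, (x - t) ^ (c - 1) * g t)
        (Ioi 0) ∧
      ∫ x in Ioi (0 : ℝ), (s + x) ^ (-(c + 1)) * ∫ t in (0 : ℝ)..x, (x - t) ^ (c - 1) * g t =
        c⁻¹ * ∫ t in Ioi (0 : ℝ), g t * (s + t)⁻¹ := by
  set m : Measure ℝ := volume.restrict (Ioi 0) with hm
  -- On the triangle `t < x`, integration in `t` first gives the fractional integral, and in `x`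
  -- first gives `stieltjes_kernel`.
  set K : ℝ × ℝ → ℝ := {p : ℝ × ℝ | p.1 < p.2}.indicator
    fun p => (s + p.2) ^ (-(c + 1)) * (p.2 - p.1) ^ (c - 1) * g p.1 with hK
  have hset : MeasurableSet {p : ℝ × ℝ | p.1 < p.2} :=
    measurableSet_lt measurable_fst measurable_snd
  have hKm : Measurable K := Measurable.indicator (by fun_prop) hset
  have hK1 : ∀ t, (fun x => K (t, x)) = (Ioi t).indicator
      fun x => (s + x) ^ (-(c + 1)) * (x - t) ^ (c - 1) * g t := fun t => by
    ext x; simp [hK, indicator]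
  have hK2 : ∀ x, (fun t => K (t, x)) = (Iio x).indicator
      fun t => (s + x) ^ (-(c + 1)) * ((x - t) ^ (c - 1) * g t) := fun x => by
    ext t; simp [hK, indicator, mul_assoc]
  have hinter : ∀ {t : ℝ}, 0 < t → m.restrict (Ioi t) = volume.restrict (Ioi t) := fun {t} ht => by
    rw [hm, Measure.restrict_restrict measurableSet_Ioi,
      inter_eq_left.2 (Ioi_subset_Ioi ht.le)]
  have hpos : ∀ᵐ t ∂m, 0 < t := ae_restrict_mem measurableSet_Ioi
  have hint : Integrable K (m.prod m) := by
    rw [integrable_prod_iff hKm.aestronglyMeasurable]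
    constructor
    · filter_upwards [hpos] with t ht
      rw [hK1, integrable_indicator_iff measurableSet_Ioi, IntegrableOn, hinter ht]
      exact (stieltjes_kernel hc hs ht.le).1.mul_const _
    · refine (hg.norm.const_mul c⁻¹).congr ?_
      filter_upwards [hpos] with t ht
      have h1 : (fun x => ‖K (t, x)‖) = (Ioi t).indicator
          fun x => ((s + x) ^ (-(c + 1)) * (x - t) ^ (c - 1)) * ‖g t‖ := by
        ext x
        rw [congrFun (hK1 t) x, norm_indicator_eq_indicator_norm]
        by_cases hx : x ∈ Ioi t
        · rw [indicator_of_mem hx, indicator_of_mem hx, norm_mul, Real.norm_of_nonneg]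
          have h1 : 0 < x - t := sub_pos.2 hx
          have h2 : 0 < s + x := by linarith
          positivity
        · rw [indicator_of_notMem hx, indicator_of_notMem hx]
      have hst : 0 < s + t := by linarith
      rw [h1, integral_indicator measurableSet_Ioi, hinter ht, integral_mul_const,
        (stieltjes_kernel hc hs ht.le).2, norm_mul, norm_inv, Real.norm_of_nonneg hst.le, mul_inv]
      ring
  have hx : ∀ᵐ x ∂m, ∫ t, K (t, x) ∂m =
      (s + x) ^ (-(c + 1)) * ∫ t in (0 : ℝ)..x, (x - t) ^ (c - 1) * g t := by
    filter_upwards [hpos] with x hx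
    rw [hK2, integral_indicator measurableSet_Iio, hm, Measure.restrict_restrict measurableSet_Iio,
      inter_comm, Ioi_inter_Iio, integral_const_mul, intervalIntegral.integral_of_le hx.le,
      integral_Ioc_eq_integral_Ioo]
  have ht : ∀ᵐ t ∂m, ∫ x, K (t, x) ∂m = c⁻¹ * (g t * (s + t)⁻¹) := by
    filter_upwards [hpos] with t ht
    rw [hK1, integral_indicator measurableSet_Ioi, hinter ht, integral_mul_const,
      (stieltjes_kernel hc hs ht.le).2, mul_inv]
    ring
  refine ⟨hint.integral_prod_right.congr hx, ?_⟩
  rw [← integral_congr_ae hx, ← integral_const_mul, ← integral_congr_ae ht]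
  exact (integral_integral_swap (f := fun t x => K (t, x)) hint).symm

theorem lintegral_Ioi_add_rpow (hc : 0 < c) {s y : ℝ} (hsy : 0 < s + y) :
    ∫⁻ x in Ioi y, ENNReal.ofReal ((s + x) ^ (-(c + 1))) =
      ENNReal.ofReal (c⁻¹ * (s + y) ^ (-c)) := by
  have hcont : ContinuousOn (fun x => -c⁻¹ * (s + x) ^ (-c)) (Ici y) := by
    refine continuousOn_const.mul (ContinuousOn.rpow_const (by fun_prop) fun x hx => Or.inl ?_)
    have : y ≤ x := hx
    linarith
  have hderiv : ∀ x ∈ Ioi y, HasDerivAt (fun x => -c⁻¹ * (s + x) ^ (-c))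
      ((s + x) ^ (-(c + 1))) x := by
    intro x hx
    have h1 : s + x ≠ 0 := by linarith [show y < x from hx]
    refine ((((hasDerivAt_id x).const_add s).rpow_const (p := -c) (Or.inl h1)).const_mul
      (-c⁻¹)).congr_deriv ?_
    simp only [id, ← neg_add']
    field_simp
  have hnonneg : ∀ x ∈ Ioi y, 0 ≤ (s + x) ^ (-(c + 1)) := fun x hx =>
    Real.rpow_nonneg (by linarith [show y < x from hx]) _
  have hlim : Tendsto (fun x => -c⁻¹ * (s + x) ^ (-c)) atTop (𝓝 (-c⁻¹ * 0)) :=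
    ((tendsto_rpow_neg_atTop hc).comp (tendsto_atTop_add_const_left _ s tendsto_id)).const_mul _
  have hcw := hcont.continuousWithinAt self_mem_Ici
  rw [← ofReal_integral_eq_lintegral_ofReal
      (integrableOn_Ioi_deriv_of_nonneg hcw hderiv hnonneg hlim)
      ((ae_restrict_mem measurableSet_Ioi).mono hnonneg),
    integral_Ioi_of_hasDerivAt_of_nonneg hcw hderiv hnonneg hlim]
  congr 1
  ring

/-- The generalized Stieltjes transform of order `c + 1` of a distribution function. -/
theorem stieltjes_cdf (hc : 0 < c) {μ : Measure ℝ} [IsProbabilityMeasure μ]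
    (hμ : ∀ᵐ x ∂μ, 0 ≤ x) {s : ℝ} (hs : 0 < s) :
    ∫⁻ x in Ioi (0 : ℝ), ENNReal.ofReal ((s + x) ^ (-(c + 1)) * μ.real (Iic x)) =
      ENNReal.ofReal c⁻¹ * ∫⁻ y, ENNReal.ofReal ((s + y) ^ (-c)) ∂μ := by
  have hset : MeasurableSet {p : ℝ × ℝ | p.2 ≤ p.1} :=
    measurableSet_le measurable_snd measurable_fst
  have h1 : ∀ x ∈ Ioi (0 : ℝ), ENNReal.ofReal ((s + x) ^ (-(c + 1)) * μ.real (Iic x)) =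
      ∫⁻ y, {p : ℝ × ℝ | p.2 ≤ p.1}.indicator
        (fun p => ENNReal.ofReal ((s + p.1) ^ (-(c + 1)))) (x, y) ∂μ := by
    intro x hx
    have hx0 : 0 < s + x := by linarith [show 0 < x from hx]
    have e : (fun y => {p : ℝ × ℝ | p.2 ≤ p.1}.indicator
        (fun p => ENNReal.ofReal ((s + p.1) ^ (-(c + 1)))) (x, y)) =
        (Iic x).indicator fun _ => ENNReal.ofReal ((s + x) ^ (-(c + 1))) := by
      ext y; simp [indicator]
    rw [e, lintegral_indicator_const measurableSet_Iic, ENNReal.ofReal_mul (by positivity),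
      ofReal_measureReal]
  have hmeas : Measurable ({p : ℝ × ℝ | p.2 ≤ p.1}.indicator
    fun p => ENNReal.ofReal ((s + p.1) ^ (-(c + 1)))) := Measurable.indicator (by fun_prop) hset
  rw [setLIntegral_congr_fun measurableSet_Ioi h1, lintegral_lintegral_swap
    (f := fun x y => {p : ℝ × ℝ | p.2 ≤ p.1}.indicator
      (fun p => ENNReal.ofReal ((s + p.1) ^ (-(c + 1)))) (x, y)) hmeas.aemeasurable,
    ← lintegral_const_mul' _ _ ENNReal.ofReal_ne_top]
  refine lintegral_congr_ae ?_
  filter_upwards [hμ] with y hy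
  have e : (fun x => {p : ℝ × ℝ | p.2 ≤ p.1}.indicator
      (fun p => ENNReal.ofReal ((s + p.1) ^ (-(c + 1)))) (x, y)) =
      (Ici y).indicator fun x => ENNReal.ofReal ((s + x) ^ (-(c + 1))) := by
    ext x; simp [indicator]
  rw [e, lintegral_indicator measurableSet_Ici, Measure.restrict_restrict measurableSet_Ici,
    ← ENNReal.ofReal_mul (by positivity), ← lintegral_Ioi_add_rpow hc (by linarith)]
  refine setLIntegral_congr ?_
  have h2 : (Ici y ∩ Ioi 0 : Set ℝ) =ᵐ[volume] (Ici y ∩ Ici 0 : Set ℝ) :=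
    (ae_eq_refl _).inter Ioi_ae_eq_Ici
  rw [Ici_inter_Ici, sup_of_le_left hy] at h2
  exact h2.trans Ioi_ae_eq_Ici.symm

end Stieltjes

/-- Every right neighbourhood of `x` has positive measure and so contains points of agreement.
One-sided limits allow `x = 0`. -/
theorem eq_of_ae_eq_of_tendsto_right {q r : ℝ → ℝ} (h : q =ᵐ[volume.restrict (Ioi 0)] r) {x : ℝ}
    (hx : 0 ≤ x) (hq : Tendsto q (𝓝[>] x) (𝓝 (q x))) (hr : Tendsto r (𝓝[>] x) (𝓝 (r x))) :
    q x = r x := by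
  have hfreq : ∃ᶠ y in 𝓝[>] x, q y - r y ∈ ({0} : Set ℝ) := by
    intro hne
    obtain ⟨b, hb, hsub⟩ := mem_nhdsGT_iff_exists_Ioo_subset.1 hne
    have hb' : x < b := hb
    have h0 : volume (Ioo x b) = 0 := by
      refine measure_mono_null (fun y hy => ?_) ((ae_restrict_iff' measurableSet_Ioi).1 h)
      intro hy'
      exact hsub hy (sub_eq_zero.2 (hy' (hx.trans_lt hy.1)))
    rw [Real.volume_Ioo, ENNReal.ofReal_eq_zero] at h0
    linarith
  have := isClosed_singleton.mem_of_frequently_of_tendsto hfreq (hq.sub hr)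
  exact sub_eq_zero.1 this

/-! ### Distribution function and density of the mean. -/

section MeanDensity

variable {α θ : ℝ}

theorem stieltjes_lampertiDelta (hα0 : 0 < α) (hα1 : α < 1) (hθ : 0 < θ) {s : ℝ} (hs : 0 < s) :
    IntegrableOn (fun t => lampertiDelta α θ t * (s + t)⁻¹) (Ioi 0) ∧
      ∫ t in Ioi (0 : ℝ), lampertiDelta α θ t * (s + t)⁻¹ = (1 + s ^ α) ^ (-θ) := by
  have hw : |((Real.log s : ℝ) : ℂ).im| < π := by simpa using Real.pi_pos
  have h1 := integrableOn_lampertiDelta_div_add_exp hα0 hα1 hθ hw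
  have h2 := integral_lampertiDelta_div_add_exp hα0 hα1 hθ hw
  have e : (fun t : ℝ => (lampertiDelta α θ t : ℂ) * ((t : ℂ) + Complex.exp (Real.log s : ℝ))⁻¹) =
      fun t => ((lampertiDelta α θ t * (s + t)⁻¹ : ℝ) : ℂ) := by
    ext t
    rw [← Complex.ofReal_exp, Real.exp_log hs]
    push_cast
    ring
  rw [e] at h1 h2
  refine ⟨h1.re, ?_⟩
  rw [integral_complex_ofReal, stripFun, ← Complex.ofReal_mul, ← Complex.ofReal_exp, mul_comm α,
    ← Real.rpow_def_of_pos hs] at h2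
  have hp : 0 ≤ 1 + s ^ α := by positivity
  apply Complex.ofReal_injective
  rw [h2, Complex.ofReal_cpow hp]
  push_cast
  rfl

/-- The fractional integral of `Δ` is differentiable, with derivative that of `Δ'`. -/
theorem hasDerivAt_abel_lampertiDelta (hα0 : 0 < α) (hα1 : α < 1) (hθ : 0 < θ) {x : ℝ}
    (hx : 0 < x) :
    HasDerivAt (fun x => ∫ t in (0 : ℝ)..x, (x - t) ^ (α * θ - 1) * lampertiDelta α θ t)
      (∫ t in (0 : ℝ)..x, (x - t) ^ (α * θ - 1) * lampertiD α θ t) x := by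
  obtain ⟨C, hC, hd⟩ := exists_abs_lampertiD_le hα0 hα1 hθ
  exact hasDerivAt_abel hα0 hα1.le hC (mul_pos hα0 hθ) measurable_lampertiDelta
    measurable_lampertiD (lampertiDelta_zero hα0 hα1) (continuousOn_lampertiDelta hα0 hα1)
    (fun t ht => abs_lampertiDelta_le_const hα0 hα1 hθ ht.le)
    (fun t ht => hasDerivAt_lampertiDelta hα0 hα1 ht) hd hx

theorem tendsto_abel_lampertiDelta (hα0 : 0 < α) (hα1 : α < 1) (hθ : 0 < θ) {x : ℝ}
    (hx : 0 ≤ x) :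
    Tendsto (fun x => ∫ t in (0 : ℝ)..x, (x - t) ^ (α * θ - 1) * lampertiDelta α θ t) (𝓝[>] x)
      (𝓝 (∫ t in (0 : ℝ)..x, (x - t) ^ (α * θ - 1) * lampertiDelta α θ t)) := by
  rcases hx.eq_or_lt with rfl | hx
  · rw [intervalIntegral.integral_same]
    exact tendsto_abel_zero (mul_pos hα0 hθ)
      fun t ht => abs_lampertiDelta_le_const hα0 hα1 hθ ht.le
  · exact (hasDerivAt_abel_lampertiDelta hα0 hα1 hθ hx).continuousAt.tendsto.mono_left
      nhdsWithin_le_nhds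

theorem intervalIntegrable_abel_lampertiDelta (hα0 : 0 < α) (hα1 : α < 1) (hθ : 0 < θ) {x : ℝ}
    (hx : 0 < x) :
    IntervalIntegrable (fun t => (x - t) ^ (α * θ - 1) * lampertiDelta α θ t) volume 0 x :=
  abel_intervalIntegrable _ hx <| intervalIntegrable_of_le_rpow one_pos (mul_pos hα0 hθ)
    (C := Real.sin (π * α) ^ (-θ)) measurable_lampertiDelta
    (fun t ht => by simpa using abs_lampertiDelta_le_const hα0 hα1 hθ ht.le) hx

theorem intervalIntegrable_abel_lampertiD (hα0 : 0 < α) (hα1 : α < 1) (hθ : 0 < θ) {x : ℝ}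
    (hx : 0 < x) :
    IntervalIntegrable (fun t => (x - t) ^ (α * θ - 1) * lampertiD α θ t) volume 0 x := by
  obtain ⟨C, -, hd⟩ := exists_abs_lampertiD_le hα0 hα1 hθ
  exact abel_intervalIntegrable _ hx
    (intervalIntegrable_of_le_rpow hα0 (mul_pos hα0 hθ) measurable_lampertiD hd hx)

variable {Ω : Type*} [MeasurableSpace Ω] {P : Measure Ω} [IsProbabilityMeasure P]
  {D : Ω → Measure ℝ}

/-- The distribution function of the Dirichlet mean. -/
theorem cdf_mean (hα0 : 0 < α) (hα1 : α < 1) (hθ : 0 < θ)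
    (hD : IsDirichletProcess (α * θ) (lampertiLaw α) D P) {x : ℝ} (hx : 0 ≤ x) :
    cdf (P.map (meanFunctional D)) x =
      ∫ t in (0 : ℝ)..x, (x - t) ^ (α * θ - 1) * lampertiDelta α θ t := by
  have hc := mul_pos hα0 hθ
  have hprob : IsProbabilityMeasure (P.map (meanFunctional D)) :=
    Measure.isProbabilityMeasure_map (measurable_meanFunctional hD).aemeasurable
  set μ := P.map (meanFunctional D) with hμ
  -- The distribution function and the fractional integral of `Δ` (in `hR`) have the same transform
  -- of order `αθ + 1`, so their difference is a signed density with vanishing transform.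
  have hQ : ∀ s : ℝ, 0 < s →
      IntegrableOn (fun x => (s + x) ^ (-(α * θ + 1)) * cdf μ x) (Ioi 0) ∧
        ∫ x in Ioi (0 : ℝ), (s + x) ^ (-(α * θ + 1)) * cdf μ x =
          (α * θ)⁻¹ * (1 + s ^ α) ^ (-θ) := by
    intro s hs
    have hcm : Measurable (cdf μ) := (monotone_cdf μ).measurable
    refine integrable_and_integral_of_lintegral_ofReal
      (by fun_prop : Measurable _).aestronglyMeasurable ?_ (by positivity) ?_
    · filter_upwards [ae_restrict_mem measurableSet_Ioi] with x hx
      have : 0 < s + x := by linarith [show 0 < x from hx]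
      have := cdf_nonneg μ x
      simp only [Pi.zero_apply]
      positivity
    · simp_rw [cdf_eq_real]
      rw [stieltjes_cdf hc (mean_nonneg hα0 hα1 hθ hD) hs, mean_stieltjes hα0 hα1 hθ hD hs,
        ENNReal.ofReal_mul (by positivity)]
  have hR : ∀ s : ℝ, 0 < s → _ := fun s hs => by
    have h := stieltjes_lampertiDelta hα0 hα1 hθ hs
    have h2 := stieltjes_abel hc hs measurable_lampertiDelta h.1
    rw [h.2] at h2
    exact h2
  have hRm : AEStronglyMeasurable (fun x => ∫ t in (0 : ℝ)..x, (x - t) ^ (α * θ - 1) *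
      lampertiDelta α θ t) (volume.restrict (Ioi 0)) :=
    ContinuousOn.aestronglyMeasurable (fun y hy =>
      (hasDerivAt_abel_lampertiDelta hα0 hα1 hθ hy).continuousAt.continuousWithinAt)
      measurableSet_Ioi
  have hae := ae_eq_zero_of_stieltjes (add_pos hc one_pos)
    ((monotone_cdf μ).measurable.aestronglyMeasurable.sub hRm)
    (fun s hs => by
      refine ((hQ s hs).1.sub (hR s hs).1).congr (ae_of_all _ fun x => ?_)
      simp only [Pi.sub_apply, mul_sub])
    (fun s hs => by
      simp only [Pi.sub_apply, mul_sub]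
      rw [integral_sub (hQ s hs).1 (hR s hs).1, (hQ s hs).2, (hR s hs).2, sub_self])
  refine eq_of_ae_eq_of_tendsto_right ?_ hx ?_ (tendsto_abel_lampertiDelta hα0 hα1 hθ hx)
  · filter_upwards [hae] with y hy
    exact sub_eq_zero.1 hy
  · exact ((cdf μ).right_continuous x).tendsto.mono_left (nhdsWithin_mono _ Ioi_subset_Ici_self)

theorem hasDerivAt_cdf_mean (hα0 : 0 < α) (hα1 : α < 1) (hθ : 0 < θ)
    (hD : IsDirichletProcess (α * θ) (lampertiLaw α) D P) {x : ℝ} (hx : 0 < x) :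
    HasDerivAt (cdf (P.map (meanFunctional D)))
      (∫ t in (0 : ℝ)..x, (x - t) ^ (α * θ - 1) * lampertiD α θ t) x := by
  refine (hasDerivAt_abel_lampertiDelta hα0 hα1 hθ hx).congr_of_eventuallyEq ?_
  filter_upwards [lt_mem_nhds hx] with y hy using cdf_mean hα0 hα1 hθ hD hy.le

/-- The sign is not visible in the formula; it comes from monotonicity of the distribution function.
-/
theorem density_mean_nonneg (hα0 : 0 < α) (hα1 : α < 1) (hθ : 0 < θ)
    (hD : IsDirichletProcess (α * θ) (lampertiLaw α) D P) {x : ℝ} (hx : 0 < x) :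
    0 ≤ ∫ t in (0 : ℝ)..x, (x - t) ^ (α * θ - 1) * lampertiD α θ t := by
  rw [← (hasDerivAt_cdf_mean hα0 hα1 hθ hD hx).deriv]
  exact (monotone_cdf _).deriv_nonneg

/-- The density of the Dirichlet mean. -/
theorem map_mean_eq_withDensity (hα0 : 0 < α) (hα1 : α < 1) (hθ : 0 < θ)
    (hD : IsDirichletProcess (α * θ) (lampertiLaw α) D P) :
    P.map (meanFunctional D) = (volume.restrict (Ioi 0)).withDensity fun x =>
      ENNReal.ofReal (∫ t in (0 : ℝ)..x, (x - t) ^ (α * θ - 1) * lampertiD α θ t) := by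
  have hprob : IsProbabilityMeasure (P.map (meanFunctional D)) :=
    Measure.isProbabilityMeasure_map (measurable_meanFunctional hD).aemeasurable
  have hderiv := fun x (hx : 0 < x) => hasDerivAt_cdf_mean hα0 hα1 hθ hD hx
  have hnonneg := fun x (hx : 0 < x) => density_mean_nonneg hα0 hα1 hθ hD hx
  have hzero : cdf (P.map (meanFunctional D)) 0 = 0 := by
    rw [cdf_mean hα0 hα1 hθ hD le_rfl, intervalIntegral.integral_same]
  set μ := P.map (meanFunctional D) with hμ
  refine Measure.ext_of_Iic _ _ fun x => ?_
  rw [withDensity_apply _ measurableSet_Iic, Measure.restrict_restrict measurableSet_Iic,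
    inter_comm, Ioi_inter_Iic, ← ofReal_cdf]
  rcases le_or_gt x 0 with hx | hx
  · rw [Ioc_eq_empty hx.not_gt, setLIntegral_empty, ENNReal.ofReal_eq_zero, ← hzero]
    exact monotone_cdf μ hx
  -- Differentiability is available only on `(0, ∞)`; at `0` the right-continuity of `cdf μ`
  -- suffices.
  · have hcont : ContinuousOn (cdf μ) (Icc 0 x) := by
      intro y hy
      rcases hy.1.eq_or_lt with rfl | hy0
      · exact ((cdf μ).right_continuous _).mono Icc_subset_Ici_self
      · exact (hderiv y hy0).continuousAt.continuousWithinAt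
    have hi := intervalIntegral.integrableOn_deriv_of_nonneg hcont (fun y hy => hderiv y hy.1)
      (fun y hy => hnonneg y hy.1)
    have hii := (intervalIntegrable_iff_integrableOn_Ioc_of_le hx.le).2 hi
    have hint := intervalIntegral.integral_eq_sub_of_hasDerivAt_of_le hx.le hcont
      (fun y hy => hderiv y hy.1) hii
    rw [hzero, sub_zero, intervalIntegral.integral_of_le hx.le] at hint
    rw [← hint]
    exact ofReal_integral_eq_lintegral_ofReal hi
      ((ae_restrict_mem measurableSet_Ioc).mono fun y hy => hnonneg y hy.1)

end MeanDensity

/-! ### Assembly of the theorem. -/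

theorem theorem4p2 (α θ : ℝ) (hα0 : 0 < α) (hα1 : α < 1) (hθ : 0 < θ)
    -- a Dirichlet process `D` with parameter measure `αθ ϱ_α`
    {Ω : Type*} [MeasurableSpace Ω] (P : Measure Ω) [IsProbabilityMeasure P]
    (D : Ω → Measure ℝ) (hD : IsDirichletProcess (α * θ) (lampertiLaw α) D P) :
    -- its mean functional is well defined
    (∀ᵐ ω ∂P, Integrable (fun x : ℝ => x) (D ω)) ∧
    -- equality in law with a local time evaluated at an independent `S_α`
    (∀ {Ω' : Type*} [MeasurableSpace Ω'] (P' : Measure Ω') [IsProbabilityMeasure P']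
      (ℓ : ℝ≥0 → Ω' → ℝ) (S : Ω' → ℝ), IsPDLocalTime α (α * θ) ℓ P' →
      Measurable S → IsPositiveStable α (P'.map S) → IndepFun S (fun ω t => ℓ t ω) P' →
      IdentDistrib (meanFunctional D) (fun ω => ℓ (S ω).toNNReal ω ^ (1 / α)) P P') ∧
    -- equality in law with `S_α / T_{α,αθ}`
    (∀ {Ω' : Type*} [MeasurableSpace Ω'] (P' : Measure Ω') [IsProbabilityMeasure P']
      (S T : Ω' → ℝ), Measurable S → IsPositiveStable α (P'.map S) →
      Measurable T → IsTiltedStable α (α * θ) (P'.map T) → IndepFun S T P' →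
      IdentDistrib (meanFunctional D) (fun ω => S ω / T ω) P P') ∧
    -- the explicit forms of `F_{X_α}` and `Δ_{αθ}(·|ϱ_α)`
    (∀ x : ℝ, 0 ≤ x → (lampertiLaw α).real (Iic x) = lampertiCDF α x) ∧
    (∀ x : ℝ, 0 ≤ x →
      Integrable (fun y => Real.log |x - y|) (lampertiLaw α) ∧
      crDelta (α * θ) (lampertiLaw α) x =
        1 / π * (Real.sin (π * θ * α * lampertiCDF α x) / lampertiPoly α x ^ (θ / 2))) ∧
    -- the distribution function
    (∀ x : ℝ, 0 ≤ x →
      IntervalIntegrable (fun t => (x - t) ^ (α * θ - 1) * crDelta (α * θ) (lampertiLaw α) t)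
        volume 0 x ∧
      P.real {ω | meanFunctional D ω ≤ x} =
        ∫ t in (0 : ℝ)..x, (x - t) ^ (α * θ - 1) * crDelta (α * θ) (lampertiLaw α) t) ∧
    -- `d_{αθ}(·|ϱ_α)` is the derivative of `Δ_{αθ}(·|ϱ_α)`, and the density
    (∀ x : ℝ, 0 < x →
      HasDerivAt (crDelta (α * θ) (lampertiLaw α)) (lampertiD α θ x) x) ∧
    (∀ x : ℝ, 0 < x →
      IntervalIntegrable (fun t => (x - t) ^ (α * θ - 1) * lampertiD α θ t) volume 0 x ∧
      0 ≤ ∫ t in (0 : ℝ)..x, (x - t) ^ (α * θ - 1) * lampertiD α θ t) ∧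
    P.map (meanFunctional D) =
      (volume.restrict (Ioi 0)).withDensity fun x =>
        ENNReal.ofReal (∫ t in (0 : ℝ)..x, (x - t) ^ (α * θ - 1) * lampertiD α θ t) := by
  have hm := (measurable_meanFunctional hD).aemeasurable (μ := P)
  have hΔ : ∀ x : ℝ, 0 ≤ x → EqOn
      (fun t => (x - t) ^ (α * θ - 1) * crDelta (α * θ) (lampertiLaw α) t)
      (fun t => (x - t) ^ (α * θ - 1) * lampertiDelta α θ t) (uIcc 0 x) := by
    intro x hx t ht
    rw [uIcc_of_le hx] at ht
    simp only [crDelta_lampertiLaw hα0 hα1 ht.1]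
  refine ⟨(ae_integrable_and_mean hα0 hα1 hθ hD).mono fun ω h => h.1, ?_, ?_,
    fun x hx => lampertiLaw_real_Iic hα0 hα1 hx, fun x hx =>
      ⟨(logPotential_lampertiLaw hα0 hα1 hx).1, crDelta_lampertiLaw hα0 hα1 hx⟩,
    fun x hx => ⟨?_, ?_⟩, fun x hx => (hasDerivAt_lampertiDelta hα0 hα1 hx).congr_of_eventuallyEq
      (crDelta_eventuallyEq hα0 hα1 hx), fun x hx =>
      ⟨intervalIntegrable_abel_lampertiD hα0 hα1 hθ hx, density_mean_nonneg hα0 hα1 hθ hD hx⟩,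
    map_mean_eq_withDensity hα0 hα1 hθ hD⟩
  · intro Ω' _ P' _ ℓ S hℓ hS hSs hind
    obtain ⟨hmeas, τ, hτ, hlaw⟩ := map_localTime_rpow hα0 hθ hℓ hS hSs hind
    refine ⟨hm, hmeas.aemeasurable, ?_⟩
    rw [hlaw]
    exact map_mean_eq hα0 hα1 hθ hD (ratio_nonneg hα0 hθ hSs hτ)
      fun s hs => ratio_stieltjes hα0 hθ hSs hτ hs
  · intro Ω' _ P' _ S T hS hSs hT hTt hind
    refine ⟨hm, (hS.div hT).aemeasurable, ?_⟩
    rw [map_div_of_indepFun hS hT hind]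
    exact map_mean_eq hα0 hα1 hθ hD (ratio_nonneg hα0 hθ hSs hTt)
      fun s hs => ratio_stieltjes hα0 hθ hSs hTt hs
  · rcases hx.eq_or_lt with rfl | hx'
    · exact IntervalIntegrable.refl
    · exact (intervalIntegrable_abel_lampertiDelta hα0 hα1 hθ hx').congr
        fun t ht => (hΔ x hx (uIoc_subset_uIcc ht)).symm
  · have := Measure.isProbabilityMeasure_map (μ := P) hm
    rw [intervalIntegral.integral_congr (hΔ x hx), ← cdf_mean hα0 hα1 hθ hD hx, cdf_eq_real,
      map_measureReal_apply (measurable_meanFunctional hD) measurableSet_Iic]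
    rfl
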